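/- Let $d\in\{2,3\}$ and let $\Omega\subset\mathbb R^d$ be a nonempty bounded open set with $|\partial\Omega|=0$ whose closure is a finite union of closed axis-parallel boxes. Let $T>0$, $\varepsilon>0$, $\gamma\ge 1$, $Q=(0,T)\times\Omega$, $p(\rho)=\rho^\gamma$, $\psi_\gamma(\rho)=\rho\ln\rho$ if $\gamma=1$ and $\psi_\gamma(\rho)=\rho^\gamma/(\gamma-1)$ if $\gamma>1$, and $\Pi_\gamma(\rho)=\psi_\gamma(\rho)-\psi_\gamma(1)-\psi_\gamma'(1)(\rho-1)$. Write $a^\pm=\frac12(a\pm|a|)$. **Grid.** A MAC grid is a partition $\mathcal M$ of $\bar\Omega$ into finitely many nondegenerate closed boxes with disjoint interiors, conforming in the sense that two cells meeting in a $(d-1)$-dimensional set share a whole face. $\mathcal E=\bigcup_i\mathcal E^{(i)}$ is the set of faces, $\mathcal E^{(i)}$ those orthogonal to $e^{(i)}$; a face is internal, $\sigma=K|L$, if it is shared by two cells, and external otherwise. The dual cell $D_\sigma$ is the union of the adjacent halves of the cells having $\sigma$ as a face, and $|D_\sigma|\,\rho_{D_\sigma}=\frac{|K|}2\rho_K+\frac{|L|}2\rho_L$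 for $\sigma=K|L$. Let $\nu_{\sigma,K}$ be the outward unit normal, $h=\max_K\mathrm{diam}(K)$, and $(\partial^{(i)}_{\mathcal E}q)_\sigma=\frac{|\sigma|}{|D_\sigma|}(q_L-q_K)\,e^{(i)}\cdot\nu_{\sigma,K}$ for internal $\sigma=K|L\in\mathcal E^{(i)}$, and $0$ on external faces. **Scheme.** Let $\delta t=T/N$ with $N\ge1$ an integer, and let $\eta^n_\sigma>0$ be stabilisation parameters. A discrete solution with initial data $(\rho_0,u_0)$ consists of $\rho^n_K$ and $u^n_\sigma$, $0\le n\le N$, with $u^n_\sigma=0$ on external faces, $\rho^0_K=\frac1{|K|}\int_K\rho_0$, $u^0_\sigma=\frac1{|D_\sigma|}\int_{D_\sigma}(u_0)_i$ for internal $\sigma\in\mathcal E^{(i)}$, such that for $0\le n<N$ $$\tfrac1{\delta t}(\rho_K^{n+1}-\rho_K^n)+\tfrac1{|K|}\sum_{\sigma\in\mathcal E(K)}F_{\sigma,K}=0\quad\text{for all }K\in\mathcal M,$$ $$\tfrac1{\delta t}(\rho^{n+1}_{D_\sigma}u^{n+1}_\sigma-\rho^{n}_{D_\sigma}u^{n}_\sigma)+\tfrac1{|D_\sigma|}\sum_{\epsilon}F_{\epsilon,\sigma}u^n_{\epsilon,\mathrm{up}}+\tfrac1{\varepsilon^2}(\partial^{(i)}_{\mathcal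 E}p(\rho^{n+1}))_\sigma=0\quad\text{for all }i\text{ and all internal }\sigma\in\mathcal E^{(i)},$$ where the second sum runs over the faces $\epsilon$ of $D_\sigma$. Here, with $u_{\sigma,K}=u^n_\sigma\,e^{(i)}\cdot\nu_{\sigma,K}$, $\delta u_\sigma=\frac{\eta^n_\sigma\delta t}{\varepsilon^2}(\partial^{(i)}_{\mathcal E}p(\rho^{n+1}))_\sigma$ and $\delta u_{\sigma,K}=\delta u_\sigma\,e^{(i)}\cdot\nu_{\sigma,K}$, the mass flux is $$F_{\sigma,K}=|\sigma|\big\{\rho_K^{n+1}(u_{\sigma,K}^+-\delta u_{\sigma,K}^-)+\rho^{n+1}_L(u_{\sigma,K}^--\delta u_{\sigma,K}^+)\big\}$$ for $\sigma=K|L$, and $F_{\sigma,K}=0$ for external $\sigma$. The dual fluxes, for $\sigma=K|L\in\mathcal E^{(i)}$, are as follows. If $\epsilon\subset K$ is orthogonal to $e^{(i)}$, then $F_{\epsilon,\sigma}=\frac12(F_{\sigma',K}-F_{\sigma,K})$, where $\sigma'$ is the face of $K$ opposite to $\sigma$ (and the same with $L$ in place of $K$). If $\epsilon$ is parallel to $e^{(i)}$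 and consists of halves of a face $\tau$ of $K$ and a face $\tau'$ of $L$, then $F_{\epsilon,\sigma}=\frac12(F_{\tau,K}+F_{\tau',L})$. For $\epsilon=D_\sigma|D_{\sigma'}$, $u_{\epsilon,\mathrm{up}}=u_\sigma$ if $F_{\epsilon,\sigma}\ge0$ and $u_{\epsilon,\mathrm{up}}=u_{\sigma'}$ otherwise. The associated functions on $Q$ are, for $t\in[n\delta t,(n+1)\delta t)$, $\rho(t,\cdot)=\rho^n_K$ on $K$, and $u(t,\cdot)$ with $i$-th component $u^n_\sigma$ on $D_\sigma$, $\sigma\in\mathcal E^{(i)}$. **Theorem.** Let $(\mathcal M^{(m)},\mathcal E^{(m)},\delta t^{(m)})_{m\in\mathbb N}$ be discretisations with $\delta t^{(m)}\to0$ and $h^{(m)}\to0$, let the stabilisation parameters be bounded above uniformly in $m$, $n$, $\sigma$, and let $(\rho^{(m)},u^{(m)})$ be corresponding discrete solutions with initial data $(\rho^\varepsilon_0,u^\varepsilon_0)\in L^\infty(\Omega)^{1+d}$. Assume that there are constants $\underline C>0$, $\overline C$, $C$, $\theta$ independent of $m$ such that, for all $m$, - $\underline C\le(\rho^{(m)})^n_K\le\overline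 C$ and $|(u^{(m)})^n_\sigma|\le C$ for all $K$, $\sigma$ and $0\le n\le N^{(m)}$; - $\dfrac{\delta t^{(m)}}{\min_K|K|}\le\theta$ and $\displaystyle\max_K\frac{\mathrm{diam}(K)^d}{|K|}\le\theta$; - $\displaystyle\sum_{n=0}^{N^{(m)}-1}\sum_{K\in\mathcal M^{(m)}}|K|\,|(\rho^{(m)})^{n+1}_K-(\rho^{(m)})^n_K|\le C$ and $\displaystyle\sum_{n=0}^{N^{(m)}-1}\sum_{\sigma\in\mathcal E^{(m)}}|D_\sigma|\,|(u^{(m)})^{n+1}_\sigma-(u^{(m)})^n_\sigma|\le C$. Assume also that $\delta t^{(m)}/\min_{\sigma\in\mathcal E^{(m)}}|\sigma|\to0$, and that $(\rho^{(m)},u^{(m)})\to(\rho^\varepsilon,u^\varepsilon)\in L^\infty(Q)^{1+d}$ in $L^r(Q)^{1+d}$ for every $1\le r<\infty$. Then, for every $\psi\in C_c^\infty([0,T)\times\bar\Omega)$ with $\psi\ge0$, $$-\int_0^T\!\!\int_\Omega\Big[\zeta^\varepsilon\,\partial_t\psi+\Big(\tfrac12\rho^\varepsilon|u^\varepsilon|^2+\tfrac1{\varepsilon^2}\psi_\gamma(\rho^\varepsilon)-\tfrac1{\varepsilon^2}\psi_\gamma'(1)\rho^\varepsilon+\tfrac1{\varepsilon^2}p(\rho^\varepsilon)\Big)u^\varepsilon\cdot\nabla\psi\Big]\,dx\,dt\le\int_\Omega\zeta^\varepsilon_0\,\psi(0,x)\,dx,$$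 where $\zeta^\varepsilon=\frac1{\varepsilon^2}\Pi_\gamma(\rho^\varepsilon)+\frac12\rho^\varepsilon|u^\varepsilon|^2$ and $\zeta^\varepsilon_0=\frac1{\varepsilon^2}\Pi_\gamma(\rho^\varepsilon_0)+\frac12\rho^\varepsilon_0|u^\varepsilon_0|^2$. -/

import Mathlib

noncomputable section

namespace MAC

/-! ### Boxes and faces -/

/-- An axis-parallel closed box `∏ᵢ [loᵢ, hiᵢ]` of `ℝ^d`. -/
structure Box (d : ℕ) where
  lo : Fin d → ℝ
  hi : Fin d → ℝ

/-- An axis-parallel face orthogonal to the `dir`-th unit vector: the set `∏ⱼ [loⱼ, hiⱼ]`, where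
`lo` and `hi` have the same `dir`-th coordinate. -/
structure Face (d : ℕ) where
  dir : Fin d
  lo : Fin d → ℝ
  hi : Fin d → ℝ

variable {d : ℕ}

/-- The closed box as a set. -/
def Box.toSet (K : Box d) : Set (Fin d → ℝ) := Set.Icc K.lo K.hi

/-- The open box as a set. -/
def Box.openSet (K : Box d) : Set (Fin d → ℝ) :=
  Set.univ.pi fun i => Set.Ioo (K.lo i) (K.hi i)

/-- The `d`-dimensional volume `|K|`. -/
def Box.vol (K : Box d) : ℝ := ∏ i, (K.hi i - K.lo i)

/-- The Euclidean diameter of a box, i.e. the length of its diagonal. -/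
def Box.diam (K : Box d) : ℝ := Real.sqrt (∑ i, (K.hi i - K.lo i) ^ 2)

/-- The face of `K` orthogonal to the `i`-th unit vector, on the upper (`s = true`) or on the
lower (`s = false`) side. -/
def Box.face (K : Box d) (i : Fin d) (s : Bool) : Face d where
  dir := i
  lo := Function.update K.lo i (if s then K.hi i else K.lo i)
  hi := Function.update K.hi i (if s then K.hi i else K.lo i)

/-- The half of `K` adjacent to its face `K.face i s`. -/
def Box.half (K : Box d) (i : Fin d) (s : Bool) : Set (Fin d → ℝ) :=
  {x | x ∈ K.toSet ∧
    (if s then (K.lo i + K.hi i) / 2 ≤ x i else x i ≤ (K.lo i + K.hi i) / 2)}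

/-- The `(d-1)`-dimensional measure `|σ|`. -/
def Face.area (σ : Face d) : ℝ := ∏ j ∈ Finset.univ.erase σ.dir, (σ.hi j - σ.lo j)

/-! ### MAC grids -/

/-- A MAC grid of `Ω`: a finite family of nondegenerate closed boxes with pairwise disjoint
interiors whose union is the closure of `Ω`, and which is conforming: two cells that meet in a
`(d-1)`-dimensional set have a whole face in common. -/
structure Mesh (d : ℕ) (Ω : Set (Fin d → ℝ)) where
  cells : Finset (Box d)
  lo_lt_hi : ∀ K ∈ cells, ∀ i, K.lo i < K.hi i
  disjoint : ∀ K ∈ cells, ∀ L ∈ cells, K ≠ L → Disjoint K.openSet L.openSet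
  union_eq : (⋃ K ∈ cells, K.toSet) = closure Ω
  conforming : ∀ K ∈ cells, ∀ L ∈ cells, ∀ i : Fin d, K.hi i = L.lo i →
    (∀ j, j ≠ i → max (K.lo j) (L.lo j) < min (K.hi j) (L.hi j)) →
    K.face i true = L.face i false

variable {Ω : Set (Fin d → ℝ)}

open Classical in
/-- The set `𝓔` of all faces of the cells. -/
def Mesh.faces (M : Mesh d Ω) : Finset (Face d) :=
  M.cells.biUnion fun K =>
    (Finset.univ : Finset (Fin d × Bool)).image fun is => K.face is.1 is.2

/-- The face `K.face i s` of the cell `K` is internal: it is also a face of another cell. -/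
def Mesh.IsInternal (M : Mesh d Ω) (K : Box d) (i : Fin d) (s : Bool) : Prop :=
  ∃ L ∈ M.cells, L.face i (!s) = K.face i s

open Classical in
/-- The cell `L` with `K.face i s = K|L` if this face is internal, and `K` itself if the face is
external. -/
def Mesh.nbr (M : Mesh d Ω) (K : Box d) (i : Fin d) (s : Bool) : Box d :=
  if h : M.IsInternal K i s then h.choose else K

/-- The dual cell `D_σ`: the union of the adjacent halves of the cells having `σ` as a face. -/
def Mesh.dualCell (M : Mesh d Ω) (σ : Face d) : Set (Fin d → ℝ) :=
  {x | ∃ K ∈ M.cells, ∃ s, K.face σ.dir s = σ ∧ x ∈ K.half σ.dir s}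

open Classical in
/-- The volume `|D_σ|` of the dual cell: each cell having `σ` as a face contributes one half of its
volume. -/
def Mesh.dualVol (M : Mesh d Ω) (σ : Face d) : ℝ :=
  ∑ K ∈ M.cells, ∑ s : Bool, if K.face σ.dir s = σ then K.vol / 2 else 0

open Classical in
/-- The dual average `q_{D_σ}`, defined by `|D_σ| q_{D_σ} = |D_{σ,K}| q_K + |D_{σ,L}| q_L`. -/
def Mesh.dualAvg (M : Mesh d Ω) (q : Box d → ℝ) (σ : Face d) : ℝ :=
  (∑ K ∈ M.cells, ∑ s : Bool, if K.face σ.dir s = σ then K.vol / 2 * q K else 0) / M.dualVol σ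

/-- The mesh size `h`, the largest diameter of a cell. -/
def Mesh.size (M : Mesh d Ω) : ℝ := sSup (Box.diam '' (M.cells : Set (Box d)))

/-- The smallest measure `|σ|` of a face. -/
def Mesh.minArea (M : Mesh d Ω) : ℝ := sInf (Face.area '' (M.faces : Set (Face d)))

/-! ### Discrete operators and fluxes -/

/-- The number `e⁽ⁱ⁾ · ν_{σ,K}` for `σ = K.face i s`. -/
def sgn (s : Bool) : ℝ := if s then 1 else -1

/-- `a⁺ = (a + |a|) / 2`. -/
def pos (a : ℝ) : ℝ := (a + |a|) / 2

/-- `a⁻ = (a - |a|) / 2`, which is nonpositive. -/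
def neg (a : ℝ) : ℝ := (a - |a|) / 2

/-- The pressure law `p(r) = r^γ`. -/
def pressure (γ r : ℝ) : ℝ := r ^ γ

/-- The discrete derivative `(∂⁽ⁱ⁾ q)_σ = |σ| / |D_σ| (q_L - q_K) e⁽ⁱ⁾ · ν_{σ,K}` at
`σ = K.face i s`; it vanishes if `σ` is external. -/
def Mesh.grad (M : Mesh d Ω) (q : Box d → ℝ) (K : Box d) (i : Fin d) (s : Bool) : ℝ :=
  (K.face i s).area / M.dualVol (K.face i s) * (q (M.nbr K i s) - q K) * sgn s

/-- The outward component `δu_{σ,K}` at `σ = K.face i s` of the velocity shift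
`δu_σ = η_σ δt / ε² (∂⁽ⁱ⁾ p(ρ))_σ`. -/
def Mesh.shift (M : Mesh d Ω) (γ ε δt : ℝ) (η : Face d → ℝ) (ρ : Box d → ℝ)
    (K : Box d) (i : Fin d) (s : Bool) : ℝ :=
  η (K.face i s) * δt / ε ^ 2 * M.grad (fun L => pressure γ (ρ L)) K i s * sgn s

/-- The stabilised upwind mass flux `F_{σ,K} = |σ| (ρ_K (v_{σ,K})⁺ + ρ_L (v_{σ,K})⁻)` through
`σ = K.face i s`, with `(v_{σ,K})⁺ = u_{σ,K}⁺ - δu_{σ,K}⁻` and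
`(v_{σ,K})⁻ = u_{σ,K}⁻ - δu_{σ,K}⁺`. -/
def Mesh.massFlux (M : Mesh d Ω) (γ ε δt : ℝ) (η : Face d → ℝ) (ρ : Box d → ℝ)
    (u : Face d → ℝ) (K : Box d) (i : Fin d) (s : Bool) : ℝ :=
  (K.face i s).area *
    (ρ K * (pos (u (K.face i s) * sgn s) - neg (M.shift γ ε δt η ρ K i s)) +
      ρ (M.nbr K i s) * (neg (u (K.face i s) * sgn s) - pos (M.shift γ ε δt η ρ K i s)))

/-- The upwind flux `F a` if `F ≥ 0`, and `F b` otherwise. -/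
def upwind (F a b : ℝ) : ℝ := F * (if 0 ≤ F then a else b)

open Classical in
/-- Let `σ = K.face i true = K|L` be internal and `j ≠ i`. The dual cell next to `D_σ` across its
lower or upper side in direction `j` (according to `s`) is the one of this face. It is found
above or below `K` if there is a cell there, and otherwise above or below `L`. -/
def Mesh.transFace (M : Mesh d Ω) (K : Box d) (i j : Fin d) (s : Bool) : Face d :=
  if M.IsInternal K j s then (M.nbr K j s).face i true
  else (M.nbr (M.nbr K i true) j s).face i false

/-- The net upwind momentum flux `∑_ϵ F_{ϵ,σ} u_{ϵ,up}` through the boundary of `D_σ`, for the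
internal face `σ = K.face i true = K|L` and the primal mass fluxes `F`. The dual fluxes are
`F_{ϵ,σ} = (F_{σ,K} n_ϵ · ν_{σ,K} + F_{σ',K} n_ϵ · ν_{σ',K}) / 2` if `ϵ ⊆ K` is orthogonal to `e⁽ⁱ⁾`
(`σ'` being the face of `K` opposite to `σ`, `n_ϵ` the normal to `ϵ` outward to `D_σ`), similarly
in `L`, and `F_{ϵ,σ} = (F_{τ,K} + F_{τ',L}) / 2` if `ϵ` consists of the halves of a face `τ` of `K`
and a face `τ'` of `L`. -/
def Mesh.momFlux (M : Mesh d Ω) (F : Box d → Fin d → Bool → ℝ) (u : Face d → ℝ)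
    (K : Box d) (i : Fin d) : ℝ :=
  upwind ((F K i false - F K i true) / 2) (u (K.face i true)) (u (K.face i false)) +
  upwind ((F (M.nbr K i true) i true - F (M.nbr K i true) i false) / 2)
    (u (K.face i true)) (u ((M.nbr K i true).face i true)) +
  ∑ j ∈ Finset.univ.erase i, ∑ s : Bool,
    upwind ((F K j s + F (M.nbr K i true) j s) / 2)
      (u (K.face i true)) (u (M.transFace K i j s))

/-! ### The scheme -/

/-- `(ρ n K)` and `(u n σ)`, `0 ≤ n ≤ N`, solve the semi-implicit upwind scheme with constant time
step `δt`, stabilisation parameters `η n σ` and initial data `(ρ₀, u₀)`. Internal faces are written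
as `K.face i true`, with `K` the cell on their lower side. -/
structure IsSolution (M : Mesh d Ω) (γ ε δt : ℝ) (N : ℕ) (η : ℕ → Face d → ℝ)
    (ρ₀ : (Fin d → ℝ) → ℝ) (u₀ : (Fin d → ℝ) → Fin d → ℝ)
    (ρ : ℕ → Box d → ℝ) (u : ℕ → Face d → ℝ) : Prop where
  init_density : ∀ K ∈ M.cells, ρ 0 K = (∫ x in K.toSet, ρ₀ x) / K.vol
  init_velocity : ∀ K ∈ M.cells, ∀ i, M.IsInternal K i true →
    u 0 (K.face i true) =
      (∫ x in M.dualCell (K.face i true), u₀ x i) / M.dualVol (K.face i true)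
  boundary : ∀ n ≤ N, ∀ K ∈ M.cells, ∀ i s, ¬ M.IsInternal K i s → u n (K.face i s) = 0
  mass : ∀ n < N, ∀ K ∈ M.cells,
    (ρ (n + 1) K - ρ n K) / δt +
      (∑ i, ∑ s, M.massFlux γ ε δt (η n) (ρ (n + 1)) (u n) K i s) / K.vol = 0
  momentum : ∀ n < N, ∀ K ∈ M.cells, ∀ i, M.IsInternal K i true →
    (M.dualAvg (ρ (n + 1)) (K.face i true) * u (n + 1) (K.face i true) -
        M.dualAvg (ρ n) (K.face i true) * u n (K.face i true)) / δt +
      M.momFlux (M.massFlux γ ε δt (η n) (ρ (n + 1)) (u n)) (u n) K i /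
        M.dualVol (K.face i true) +
      1 / ε ^ 2 * M.grad (fun L => pressure γ (ρ (n + 1) L)) K i true = 0

/-- The piecewise constant density: `ρ n K` on `[n δt, (n+1) δt) × K`. -/
def Mesh.density (M : Mesh d Ω) (δt : ℝ) (ρ : ℕ → Box d → ℝ) (z : ℝ × (Fin d → ℝ)) : ℝ :=
  ∑ K ∈ M.cells, K.toSet.indicator (fun _ => ρ ⌊z.1 / δt⌋₊ K) z.2

open Classical in
/-- The piecewise constant velocity: its `i`-th component is `u n σ` on
`[n δt, (n+1) δt) × D_σ` for the faces `σ` orthogonal to the `i`-th unit vector. -/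
def Mesh.velocity (M : Mesh d Ω) (δt : ℝ) (u : ℕ → Face d → ℝ) (z : ℝ × (Fin d → ℝ))
    (i : Fin d) : ℝ :=
  ∑ σ ∈ M.faces with σ.dir = i, (M.dualCell σ).indicator (fun _ => u ⌊z.1 / δt⌋₊ σ) z.2

/-! ### Entropy -/

/-- The Helmholtz function `ψ_γ`. -/
def helmholtz (γ r : ℝ) : ℝ := if γ = 1 then r * Real.log r else r ^ γ / (γ - 1)

/-- The relative internal energy `Π_γ`. -/
def relEnergy (γ r : ℝ) : ℝ :=
  helmholtz γ r - helmholtz γ 1 - deriv (helmholtz γ) 1 * (r - 1)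

/-- The total entropy `ζ = Π_γ(r) / ε² + r |v|² / 2`. -/
def entropy (γ ε r : ℝ) (v : Fin d → ℝ) : ℝ :=
  1 / ε ^ 2 * relEnergy γ r + 1 / 2 * r * ∑ i, v i ^ 2

/-- The factor `r |v|² / 2 + (ψ_γ(r) - ψ_γ'(1) r + p(r)) / ε²` multiplying the velocity in the
entropy flux. -/
def entropyFlux (γ ε r : ℝ) (v : Fin d → ℝ) : ℝ :=
  1 / 2 * r * ∑ i, v i ^ 2 + 1 / ε ^ 2 * helmholtz γ r
    - 1 / ε ^ 2 * deriv (helmholtz γ) 1 * r + 1 / ε ^ 2 * pressure γ r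

/-- The time derivative of a function of `(t, x)`. -/
def dt (ψ : ℝ × (Fin d → ℝ) → ℝ) (z : ℝ × (Fin d → ℝ)) : ℝ := fderiv ℝ ψ z (1, 0)

/-- The `i`-th space derivative of a function of `(t, x)`. -/
def dx (ψ : ℝ × (Fin d → ℝ) → ℝ) (i : Fin d) (z : ℝ × (Fin d → ℝ)) : ℝ :=
  fderiv ℝ ψ z (0, Pi.single i 1)

/-- Test functions in `C_c^∞([0,T) × closure Ω)`, `Ω` bounded: smooth functions that vanish on
`closure Ω` for all times close to `T`. -/
def IsTestFunction (T : ℝ) (Ω : Set (Fin d → ℝ)) (ψ : ℝ × (Fin d → ℝ) → ℝ) : Prop :=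
  ContDiff ℝ (⊤ : ℕ∞) ψ ∧ ∃ T' < T, ∀ t ∈ Set.Icc T' T, ∀ x ∈ closure Ω, ψ (t, x) = 0

end MAC

end

/-! The scheme satisfies a local energy inequality, tested with nonnegative weights, whose fluxes
are consistent with the entropy flux; the theorem is its limit.

Internal energy: multiply the mass balance of K by Π_γ'(ρ_K^{n+1}). Convexity of Π_γ, together with
implicit upwinding, turns this into an inequality with the upwind flux of Π_γ and the work of p - 1,
because ρΠ_γ' - Π_γ = p - 1 (`Mesh.internal_energy_cell`). Kinetic energy: multiply the momentum
balance by the old velocity u_σ^n. The dual fluxes inherit a mass balance on D_σ, and upwinding of u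
yields upwinding of u²/2; the price of the explicit velocity is a residual ρ|u^{n+1} - u^n|²/2 of
the wrong sign (`Mesh.kinetic_energy_face`). In the sum the work of the pressure against u^n
cancels, while its work against the shift δu is minus a sum of squares (`Mesh.sum_shift_nonpos`).
This gives `Mesh.sum_energy_step`.

The weights are the values of the test function at the centres of cells, of faces and of edges.
Since fluxes telescope, a centre common to several cells may be subtracted, and every flux is then
multiplied by a difference of two values of ψ inside one cell. Divided by the length of the cell,
these are difference quotients and converge uniformly (`RegularSequence.good_quotient`). Where the
boundary of Ω interrupts the telescoping, the velocity vanishes and the missing terms have the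
favourable sign.

The residual tends to zero: the momentum balance gives |u^{n+1} - u^n| ≤ Aκ, where δt ≤ κ times any
length of a cell, and the remaining factor is summed by the BV bound in time
(`SolutionSequence.exists_residual_bound`). That κ → 0 follows from δt / min|σ| → 0 and shape
regularity.

Finally, the L¹ convergence passes to the next time level by the BV bound and to neighbouring cells
by approximation with continuous functions (`Pieces.lconv_of_average`). Along a subsequence
everything is bounded and converges almost everywhere, so that nonlinear expressions and upwind
choices pass to the limit by dominated convergence (`Pieces.Good.tendsto_sum`). A subsequence
suffices, as the conclusion speaks only of the limit. -/

open MeasureTheory Filter Topology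

/-! ### Convergence of piecewise constant functions on a sequence of partitions. -/

/-- A sequence of finite partitions (up to a null set) of a measure space. -/
structure Pieces (X ι : Type*) [MeasurableSpace X] (μ : Measure X) where
  idx : ℕ → Finset ι
  piece : ℕ → ι → Set X
  measurable : ∀ m, ∀ k ∈ idx m, MeasurableSet (piece m k)
  disjoint : ∀ m, ∀ k ∈ idx m, ∀ k' ∈ idx m, k ≠ k' → Disjoint (piece m k) (piece m k')
  cover : ∀ m, ∀ᵐ z ∂μ, ∃ k ∈ idx m, z ∈ piece m k

namespace Pieces

variable {X ι : Type*} [MeasurableSpace X] {μ : Measure X} (D : Pieces X ι μ)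

/-- The piecewise constant function with the values `q m k`. -/
noncomputable def recon (q : ℕ → ι → ℝ) (m : ℕ) (z : X) : ℝ :=
  ∑ k ∈ D.idx m, (D.piece m k).indicator (fun _ => q m k) z

theorem recon_eq (q : ℕ → ι → ℝ) {m : ℕ} {k : ι} (hk : k ∈ D.idx m) {z : X}
    (hz : z ∈ D.piece m k) : D.recon q m z = q m k := by
  unfold recon
  rw [Finset.sum_eq_single k]
  · simp [hz]
  · intro k' hk' hne
    have := Set.disjoint_left.1 (D.disjoint m k hk k' hk' hne.symm) hz
    simp [this]
  · exact fun h => absurd hk h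

theorem ae_forall_mem : ∀ᵐ z ∂μ, ∀ m, ∃ k ∈ D.idx m, z ∈ D.piece m k :=
  ae_all_iff.2 D.cover

theorem measurable_recon (q : ℕ → ι → ℝ) (m : ℕ) : Measurable (D.recon q m) := by
  unfold recon
  exact Finset.measurable_sum _ fun k hk => measurable_const.indicator (D.measurable m k hk)

theorem integral_eq_sum {g : X → ℝ} (hg : Integrable g μ) (m : ℕ) :
    ∫ z, g z ∂μ = ∑ k ∈ D.idx m, ∫ z in D.piece m k, g z ∂μ := by
  rw [← integral_biUnion_finset _ (D.measurable m)
    (fun k hk k' hk' h => D.disjoint m k hk k' hk' h) (fun _ _ => hg.integrableOn),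
    ← setIntegral_univ]
  apply setIntegral_congr_set
  filter_upwards [D.cover m] with z hz
  obtain ⟨k, hk, hz⟩ := hz
  apply propext
  have : z ∈ ⋃ k ∈ D.idx m, D.piece m k := by simp only [Set.mem_iUnion]; exact ⟨k, hk, hz⟩
  exact ⟨fun _ => this, fun _ => Set.mem_univ z⟩

theorem integrable_recon [IsFiniteMeasure μ] (q : ℕ → ι → ℝ) (m : ℕ) :
    Integrable (D.recon q m) μ := by
  unfold recon
  exact integrable_finsetSum _ fun k hk => (integrable_const _).indicator (D.measurable m k hk)

theorem setIntegral_recon_comp (q : ℕ → ι → ℝ) {m : ℕ} {k : ι} (hk : k ∈ D.idx m)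
    (g : ℝ → X → ℝ) :
    ∫ z in D.piece m k, g (D.recon q m z) z ∂μ = ∫ z in D.piece m k, g (q m k) z ∂μ :=
  setIntegral_congr_fun (D.measurable m k hk) fun z hz => by simp only [D.recon_eq q hk hz]

theorem integral_recon [IsFiniteMeasure μ] (q : ℕ → ι → ℝ) (m : ℕ) :
    ∫ z, D.recon q m z ∂μ = ∑ k ∈ D.idx m, μ.real (D.piece m k) * q m k := by
  rw [D.integral_eq_sum (D.integrable_recon q m) m]
  refine Finset.sum_congr rfl fun k hk => ?_
  rw [D.setIntegral_recon_comp q hk fun a _ => a]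
  simp

/-- Convergence in `L¹` of the piecewise constant functions with the values `q`. -/
def Lconv (q : ℕ → ι → ℝ) (f : X → ℝ) : Prop :=
  Tendsto (fun m => ∫ z, |D.recon q m z - f z| ∂μ) atTop (𝓝 0)

/-- A family of functions that is close in `L¹` to a convergent one converges. -/
theorem lconv_of_close [IsFiniteMeasure μ] {q : ℕ → ι → ℝ} {f : X → ℝ} {F : ℕ → X → ℝ}
    (hf : Integrable f μ)
    (hFi : ∀ m, Integrable (F m) μ)
    (hF : Tendsto (fun m => ∫ z, |F m z - f z| ∂μ) atTop (𝓝 0))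
    (hq : Tendsto (fun m => ∫ z, |D.recon q m z - F m z| ∂μ) atTop (𝓝 0)) : D.Lconv q f := by
  refine squeeze_zero (fun m => integral_nonneg fun z => abs_nonneg _) (fun m => ?_)
    (by simpa using hq.add hF)
  have h1 : Integrable (fun z => |D.recon q m z - F m z|) μ :=
    ((D.integrable_recon q m).sub (hFi m)).abs
  have h2 : Integrable (fun z => |F m z - f z|) μ := ((hFi m).sub hf).abs
  rw [← integral_add h1 h2]
  refine integral_mono ((D.integrable_recon q m).sub hf).abs (h1.add h2) fun z => ?_
  exact abs_sub_le _ _ _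

open Classical in
/-- Piecewise constant functions converge in `L¹` to the limit of functions `F m`, if their values
are controlled by averages of `F m` over the piece itself and over a neighbouring piece. -/
theorem lconv_of_average {X : Type*} [PseudoMetricSpace X] [MeasurableSpace X] [BorelSpace X]
    [ProperSpace X] {μ : Measure X} [IsFiniteMeasure μ] (D : Pieces X ι μ)
    {f : X → ℝ} (hf : Integrable f μ) {F : ℕ → X → ℝ} (hFi : ∀ m, Integrable (F m) μ)
    (hF : Tendsto (fun m => ∫ z, |F m z - f z| ∂μ) atTop (𝓝 0))
    (S : ℕ → Set ι) (π : ℕ → ι → ι)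
    (hπ : ∀ m, ∀ k ∈ D.idx m, k ∈ S m → π m k ∈ D.idx m)
    (hinj : ∀ m, ∀ k ∈ D.idx m, k ∈ S m → ∀ k' ∈ D.idx m, k' ∈ S m → π m k = π m k' → k = k')
    {δ : ℕ → ℝ} (hδ : Tendsto δ atTop (𝓝 0))
    (hd : ∀ m, ∀ k ∈ D.idx m, ∀ x ∈ D.piece m k, ∀ y ∈ D.piece m k, dist x y ≤ δ m)
    (hdπ : ∀ m, ∀ k ∈ D.idx m, k ∈ S m → ∀ x ∈ D.piece m k, ∀ y ∈ D.piece m (π m k),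
      dist x y ≤ δ m)
    {C : ℝ} (hC : 0 ≤ C) {a : ℕ → ι → ℝ}
    (ha : ∀ m, ∀ k ∈ D.idx m, ∀ c : ℝ, μ.real (D.piece m k) * |a m k - c| ≤
      C * (∫ z in D.piece m k, |F m z - c| ∂μ +
        if k ∈ S m then ∫ z in D.piece m (π m k), |F m z - c| ∂μ else 0)) :
    D.Lconv a f := by
  have key : ∀ ε > 0, ∀ᶠ m in atTop, ∫ z, |D.recon a m z - f z| ∂μ ≤
      (2 * C + 1) * (ε + ε + ε * μ.real Set.univ) := by
    intro ε hε
    -- A uniformly continuous approximation of the limit: on a small piece and its neighbour it is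
    -- constant up to ε, and this constant will be the c of the hypothesis `ha`.
    obtain ⟨φ, hφc, hφ, hφcont, hφi⟩ := hf.exists_hasCompactSupport_integral_sub_le hε
    obtain ⟨δ₀, hδ₀, huc⟩ := Metric.uniformContinuous_iff.1
      (hφc.uniformContinuous_of_continuous hφcont) ε hε
    filter_upwards [hδ.eventually (gt_mem_nhds hδ₀), hF.eventually (gt_mem_nhds hε)] with m hm hFm
    -- G dominates the distance from F m to any value of φ at a distance of at most δ m, and its
    -- integral is of order ε.
    set G : X → ℝ := fun z => |F m z - f z| + |f z - φ z| + ε with hG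
    have hi1 : Integrable (fun z => |F m z - f z|) μ := ((hFi m).sub hf).abs
    have hi2 : Integrable (fun z => |f z - φ z|) μ := (hf.sub hφi).abs
    have hGi : Integrable G μ := (hi1.add hi2).add (integrable_const ε)
    have hG0 : ∀ z, 0 ≤ G z := fun z => by positivity
    have hGint : ∫ z, G z ∂μ ≤ ε + ε + ε * μ.real Set.univ := by
      have : ∫ z, G z ∂μ = ∫ z, |F m z - f z| ∂μ + ∫ z, |f z - φ z| ∂μ + ε * μ.real Set.univ := by
        have hi3 : Integrable (fun z => |F m z - f z| + |f z - φ z|) μ := hi1.add hi2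
        simp only [hG]
        rw [integral_add hi3 (integrable_const ε), integral_add hi1 hi2]
        simp [mul_comm]
      rw [this]
      have h2 : ∫ z, |f z - φ z| ∂μ ≤ ε := by simpa [Real.norm_eq_abs] using hφ
      linarith
    have hbase : ∀ k ∈ D.idx m, ∫ z in D.piece m k, |D.recon a m z - f z| ∂μ ≤
        C * (∫ z in D.piece m k, G z ∂μ +
          if k ∈ S m then ∫ z in D.piece m (π m k), G z ∂μ else 0) +
          ∫ z in D.piece m k, G z ∂μ := by
      intro k hk
      rcases (D.piece m k).eq_empty_or_nonempty with he | ⟨x, hx⟩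
      · simp only [he, Measure.restrict_empty, integral_zero_measure, zero_add, add_zero]
        refine mul_nonneg hC ?_
        split_ifs
        · exact integral_nonneg fun z => hG0 z
        · exact le_rfl
      set c := φ x
      have hclose : ∀ y, dist x y ≤ δ m → |φ y - c| ≤ ε := fun y hy => by
        have := huc (hy.trans_lt hm)
        rw [Real.dist_eq, abs_sub_comm] at this
        exact this.le
      have hFc : ∀ y, dist x y ≤ δ m → |F m y - c| ≤ G y := fun y hy => by
        have h1 := hclose y hy
        have h2 : F m y - c = (F m y - f y) + (f y - φ y) + (φ y - c) := by ring
        rw [h2]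
        exact (abs_add_three _ _ _).trans (by simp only [hG]; linarith)
      have hFi' : Integrable (fun z => |F m z - c|) μ := ((hFi m).sub (integrable_const c)).abs
      have h1 : ∫ z in D.piece m k, |F m z - c| ∂μ ≤ ∫ z in D.piece m k, G z ∂μ :=
        setIntegral_mono_on hFi'.integrableOn hGi.integrableOn (D.measurable m k hk)
          fun y hy => hFc y (hd m k hk x hx y hy)
      have h2 : (if k ∈ S m then ∫ z in D.piece m (π m k), |F m z - c| ∂μ else 0) ≤
          if k ∈ S m then ∫ z in D.piece m (π m k), G z ∂μ else 0 := by
        split_ifs with hS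
        · exact setIntegral_mono_on hFi'.integrableOn hGi.integrableOn
            (D.measurable m _ (hπ m k hk hS)) fun y hy => hFc y (hdπ m k hk hS x hx y hy)
        · exact le_rfl
      have h3 := ha m k hk c
      rw [D.setIntegral_recon_comp a hk fun b z => |b - f z|]
      have h4 : ∫ z in D.piece m k, |a m k - f z| ∂μ ≤
          ∫ z in D.piece m k, (|a m k - c| + G z) ∂μ := by
        refine setIntegral_mono_on ((integrable_const _).sub hf).abs.integrableOn
          ((integrable_const _).add hGi).integrableOn (D.measurable m k hk) fun y hy => ?_
        have h5 := hclose y (hd m k hk x hx y hy)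
        have h6 : a m k - f y = (a m k - c) + (c - φ y) + (φ y - f y) := by ring
        rw [h6]
        refine (abs_add_three _ _ _).trans ?_
        rw [abs_sub_comm c, abs_sub_comm (φ y) (f y)]
        simp only [hG]
        linarith [abs_nonneg (F m y - f y)]
      rw [integral_add (integrable_const _) hGi.integrableOn] at h4
      simp only [integral_const, measureReal_restrict_apply MeasurableSet.univ, Set.univ_inter,
        smul_eq_mul] at h4
      have h7 := mul_le_mul_of_nonneg_left (add_le_add h1 h2) hC
      linarith
    have hif : Integrable (fun z => |D.recon a m z - f z|) μ := ((D.integrable_recon a m).sub hf).abs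
    rw [D.integral_eq_sum hif m]
    refine (Finset.sum_le_sum hbase).trans ?_
    rw [Finset.sum_add_distrib, ← Finset.mul_sum, Finset.sum_add_distrib,
      ← D.integral_eq_sum hGi m]
    -- By injectivity no piece serves as a neighbour twice, so the neighbours together cost at most
    -- one more integral of G.
    have hπs : ∑ k ∈ D.idx m, (if k ∈ S m then ∫ z in D.piece m (π m k), G z ∂μ else 0) ≤
        ∫ z, G z ∂μ := by
      rw [← Finset.sum_filter, D.integral_eq_sum hGi m]
      have hinj' : Set.InjOn (π m) ((D.idx m).filter (· ∈ S m)) := by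
        intro k hk k' hk' h
        simp only [Finset.coe_filter, Set.mem_ofPred_eq] at hk hk'
        exact hinj m k hk.1 hk.2 k' hk'.1 hk'.2 h
      rw [← Finset.sum_image (f := fun k => ∫ z in D.piece m k, G z ∂μ) hinj']
      refine Finset.sum_le_sum_of_subset_of_nonneg ?_ fun k _ _ => integral_nonneg fun z => hG0 z
      intro k hk
      obtain ⟨k', hk', rfl⟩ := Finset.mem_image.1 hk
      exact hπ m k' (Finset.mem_filter.1 hk').1 (Finset.mem_filter.1 hk').2
    nlinarith
  refine Metric.tendsto_nhds.2 fun ε hε => ?_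
  have hpos : 0 < 2 * ((2 * C + 1) * (2 + μ.real Set.univ)) := by positivity
  filter_upwards [key _ (div_pos hε hpos)] with m hm
  rw [Real.dist_0_eq_abs, abs_of_nonneg (integral_nonneg fun z => abs_nonneg _)]
  refine hm.trans_lt ?_
  have : (2 * C + 1) * (ε / (2 * ((2 * C + 1) * (2 + μ.real Set.univ))) +
      ε / (2 * ((2 * C + 1) * (2 + μ.real Set.univ))) +
      ε / (2 * ((2 * C + 1) * (2 + μ.real Set.univ))) * μ.real Set.univ) = ε / 2 := by
    have h1 : (2 + μ.real Set.univ) ≠ 0 := by positivity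
    have h2 : (2 * C + 1) ≠ 0 := by positivity
    field_simp
    ring
  rw [this]
  exact half_lt_self hε

/-- Boundedness, together with convergence almost everywhere along the filter `l`. -/
def Good (l : Filter ℕ) (q : ℕ → ι → ℝ) (f : X → ℝ) : Prop :=
  (∃ C, ∀ m, ∀ k ∈ D.idx m, |q m k| ≤ C) ∧
    ∀ᵐ z ∂μ, Tendsto (fun m => D.recon q m z) l (𝓝 (f z))

variable {D} {l : Filter ℕ} {q q' : ℕ → ι → ℝ} {f f' : X → ℝ}

theorem Good.congr (h : D.Good l q f) (hq : ∀ m, ∀ k ∈ D.idx m, q m k = q' m k)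
    (hf : ∀ z, f z = f' z) : D.Good l q' f' := by
  obtain rfl : f = f' := funext hf
  obtain ⟨⟨C, hC⟩, hl⟩ := h
  refine ⟨⟨C, fun m k hk => hq m k hk ▸ hC m k hk⟩, ?_⟩
  have : ∀ m z, D.recon q m z = D.recon q' m z := fun m z =>
    Finset.sum_congr rfl fun k hk => by rw [hq m k hk]
  simpa only [this] using hl

/-- On a single piece all the functions are constant, so g may be applied to the values. The bounds
confine them to a compact rectangle, hence continuity of g alone keeps them bounded. -/
theorem Good.comp₂ (h : D.Good l q f) (h' : D.Good l q' f') {g : ℝ × ℝ → ℝ}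
    (hg : Continuous g) :
    D.Good l (fun m k => g (q m k, q' m k)) (fun z => g (f z, f' z)) := by
  obtain ⟨⟨C, hC⟩, hl⟩ := h
  obtain ⟨⟨C', hC'⟩, hl'⟩ := h'
  obtain ⟨B, hB⟩ := ((isCompact_Icc (a := -C) (b := C)).prod
    (isCompact_Icc (a := -C') (b := C'))).exists_bound_of_continuousOn hg.continuousOn
  refine ⟨⟨B, fun m k hk => hB _ ⟨abs_le.1 (hC m k hk), abs_le.1 (hC' m k hk)⟩⟩, ?_⟩
  filter_upwards [hl, hl', D.ae_forall_mem] with z hz hz' hk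
  have : ∀ m, D.recon (fun m k => g (q m k, q' m k)) m z =
      g (D.recon q m z, D.recon q' m z) := fun m => by
    obtain ⟨k, hk, hzk⟩ := hk m
    rw [D.recon_eq _ hk hzk, D.recon_eq _ hk hzk, D.recon_eq _ hk hzk]
  simp only [this]
  exact (hg.tendsto _).comp (hz.prodMk_nhds hz')

theorem Good.comp (h : D.Good l q f) {g : ℝ → ℝ} (hg : Continuous g) :
    D.Good l (fun m k => g (q m k)) (fun z => g (f z)) :=
  h.comp₂ h (g := fun p => g p.1) (hg.comp continuous_fst)

theorem Good.add (h : D.Good l q f) (h' : D.Good l q' f') :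
    D.Good l (fun m k => q m k + q' m k) (fun z => f z + f' z) :=
  h.comp₂ h' (g := fun p => p.1 + p.2) (by fun_prop)

theorem Good.sub (h : D.Good l q f) (h' : D.Good l q' f') :
    D.Good l (fun m k => q m k - q' m k) (fun z => f z - f' z) :=
  h.comp₂ h' (g := fun p => p.1 - p.2) (by fun_prop)

theorem Good.mul (h : D.Good l q f) (h' : D.Good l q' f') :
    D.Good l (fun m k => q m k * q' m k) (fun z => f z * f' z) :=
  h.comp₂ h' (g := fun p => p.1 * p.2) (by fun_prop)

theorem Good.neg (h : D.Good l q f) : D.Good l (fun m k => -q m k) (fun z => -f z) :=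
  h.comp (g := fun p => -p) (by fun_prop)

theorem Good.const_mul (h : D.Good l q f) (c : ℝ) :
    D.Good l (fun m k => c * q m k) (fun z => c * f z) :=
  h.comp (g := fun p => c * p) (by fun_prop)

theorem good_const (c : ℝ) : D.Good l (fun _ _ => c) (fun _ => c) := by
  refine ⟨⟨|c|, fun _ _ _ => le_rfl⟩, ?_⟩
  filter_upwards [D.ae_forall_mem] with z hz
  have : ∀ m, D.recon (fun _ _ => c) m z = c := fun m => by
    obtain ⟨k, hk, hzk⟩ := hz m
    rw [D.recon_eq _ hk hzk]
  simp only [this]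
  exact tendsto_const_nhds

theorem Good.sum {A : Type*} (s : Finset A) {q : A → ℕ → ι → ℝ} {f : A → X → ℝ}
    (h : ∀ a ∈ s, D.Good l (q a) (f a)) :
    D.Good l (fun m k => ∑ a ∈ s, q a m k) (fun z => ∑ a ∈ s, f a z) := by
  classical
  induction s using Finset.induction_on with
  | empty => simpa using good_const 0
  | insert a s ha ih =>
    simp only [Finset.sum_insert ha]
    exact (h a (by simp)).add (ih fun b hb => h b (by simp [hb]))

/-- The values are squeezed between the minimum and the maximum of the two candidates. Meant for
upwind values, where the choice may oscillate from piece to piece and with m. -/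
theorem Good.either {r : ℕ → ι → ℝ} (h : D.Good l q f) (h' : D.Good l q' f)
    (hr : ∀ m, ∀ k ∈ D.idx m, r m k = q m k ∨ r m k = q' m k) : D.Good l r f := by
  obtain ⟨⟨C, hC⟩, hl⟩ := h
  obtain ⟨⟨C', hC'⟩, hl'⟩ := h'
  refine ⟨⟨max C C', fun m k hk => ?_⟩, ?_⟩
  · rcases hr m k hk with e | e <;> rw [e]
    · exact (hC m k hk).trans (le_max_left _ _)
    · exact (hC' m k hk).trans (le_max_right _ _)
  filter_upwards [hl, hl', D.ae_forall_mem] with z hz hz' hk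
  have e : ∀ m, D.recon r m z = D.recon q m z ∨ D.recon r m z = D.recon q' m z := fun m => by
    obtain ⟨k, hk, hzk⟩ := hk m
    rw [D.recon_eq _ hk hzk, D.recon_eq _ hk hzk, D.recon_eq _ hk hzk]
    exact hr m k hk
  refine tendsto_of_tendsto_of_tendsto_of_le_of_le (by simpa using hz.min hz')
    (by simpa using hz.max hz') (fun m => ?_) (fun m => ?_)
  · rcases e m with e | e <;> rw [e]
    · exact min_le_left _ _
    · exact min_le_right _ _
  · rcases e m with e | e <;> rw [e]
    · exact le_max_left _ _
    · exact le_max_right _ _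

theorem good_of_uniform (hl : l ≤ atTop) {b : ℕ → ℝ} (hb : Tendsto b atTop (𝓝 0))
    (hbd : ∃ C, ∀ m, ∀ k ∈ D.idx m, |q m k| ≤ C)
    (h : ∀ m, ∀ k ∈ D.idx m, ∀ z ∈ D.piece m k, |q m k - f z| ≤ b m) : D.Good l q f := by
  refine ⟨hbd, ?_⟩
  filter_upwards [D.ae_forall_mem] with z hz
  rw [tendsto_iff_dist_tendsto_zero]
  refine squeeze_zero (fun _ => dist_nonneg) (fun m => ?_) (hb.mono_left hl)
  obtain ⟨k, hk, hzk⟩ := hz m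
  rw [D.recon_eq _ hk hzk, Real.dist_eq]
  exact h m k hk z hzk

theorem Good.mono {l' : Filter ℕ} (h : D.Good l q f) (hl : l' ≤ l) : D.Good l' q f :=
  ⟨h.1, h.2.mono fun _ hz => hz.mono_left hl⟩

/-- Dominated convergence, with the uniform bound as a constant majorant on a finite measure space.
-/
theorem Good.tendsto_sum [IsFiniteMeasure μ] [l.IsCountablyGenerated] (h : D.Good l q f) :
    Tendsto (fun m => ∑ k ∈ D.idx m, μ.real (D.piece m k) * q m k) l (𝓝 (∫ z, f z ∂μ)) := by
  obtain ⟨⟨C, hC⟩, hl⟩ := h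
  simp only [← D.integral_recon]
  refine tendsto_integral_filter_of_dominated_convergence (fun _ => C)
    (.of_forall fun m => (D.measurable_recon q m).aestronglyMeasurable) (.of_forall fun m => ?_)
    (integrable_const _) hl
  filter_upwards [D.cover m] with z hz
  obtain ⟨k, hk, hzk⟩ := hz
  rw [D.recon_eq _ hk hzk]
  exact hC m k hk

/-- L¹ convergence implies convergence in measure, hence almost everywhere along a subsequence. The
subsequence is kept as a finer filter, so that repeated extraction is only a chain of inequalities
between filters. -/
theorem Lconv.exists_good [IsFiniteMeasure μ] (h : D.Lconv q f) (hf : Integrable f μ)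
    (hb : ∃ C, ∀ m, ∀ k ∈ D.idx m, |q m k| ≤ C) (hl : l ≤ atTop) [l.NeBot]
    [l.IsCountablyGenerated] :
    ∃ l' ≤ l, l'.NeBot ∧ l'.IsCountablyGenerated ∧ D.Good l' q f := by
  have hm : TendstoInMeasure μ (D.recon q) l f := by
    refine tendstoInMeasure_of_tendsto_eLpNorm one_ne_zero
      (fun m => (D.measurable_recon q m).aestronglyMeasurable) hf.aestronglyMeasurable ?_
    have e : ∀ m, eLpNorm (D.recon q m - f) 1 μ =
        ENNReal.ofReal (∫ z, |D.recon q m z - f z| ∂μ) := fun m => by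
      rw [eLpNorm_one_eq_lintegral_enorm, ← ofReal_integral_norm_eq_lintegral_enorm
        ((D.integrable_recon q m).sub hf)]
      rfl
    simp only [e]
    simpa using ENNReal.tendsto_ofReal (h.mono_left hl)
  obtain ⟨ns, hns, hae⟩ := hm.exists_seq_tendsto_ae'
  exact ⟨map ns atTop, hns, inferInstance, inferInstance, hb, hae⟩

theorem exists_good_family [IsFiniteMeasure μ] {A : Type*} [Finite A] {q : A → ℕ → ι → ℝ}
    {f : A → X → ℝ} (h : ∀ a, D.Lconv (q a) (f a)) (hf : ∀ a, Integrable (f a) μ)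
    (hb : ∀ a, ∃ C, ∀ m, ∀ k ∈ D.idx m, |q a m k| ≤ C) (hl : l ≤ atTop) [hl' : l.NeBot]
    [hl'' : l.IsCountablyGenerated] :
    ∃ l' ≤ l, l'.NeBot ∧ l'.IsCountablyGenerated ∧ ∀ a, D.Good l' (q a) (f a) := by
  classical
  have := Fintype.ofFinite A
  suffices H : ∀ s : Finset A, ∃ l' ≤ l, l'.NeBot ∧ l'.IsCountablyGenerated ∧
      ∀ a ∈ s, D.Good l' (q a) (f a) by
    obtain ⟨l', h1, h2, h3, h4⟩ := H Finset.univ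
    exact ⟨l', h1, h2, h3, fun a => h4 a (Finset.mem_univ a)⟩
  intro s
  induction s using Finset.induction_on with
  | empty => exact ⟨l, le_rfl, hl', hl'', by simp⟩
  | insert a s ha ih =>
    obtain ⟨l', h1, h2, h3, h4⟩ := ih
    obtain ⟨l'', g1, g2, g3, g4⟩ := (h a).exists_good (hf a) (hb a) (h1.trans hl)
    refine ⟨l'', g1.trans h1, g2, g3, fun b hb => ?_⟩
    rcases Finset.mem_insert.1 hb with rfl | hb
    · exact g4
    · exact (h4 b hb).mono g1

end Pieces

/-! ### Combinatorics of the grid: faces, neighbours, dual volumes. -/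

namespace MAC

variable {d : ℕ} {Ω : Set (Fin d → ℝ)}

/-- The length of `K` in the direction `i`. -/
def Box.len (K : Box d) (i : Fin d) : ℝ := K.hi i - K.lo i

/-- The `i`-th coordinate of the face `K.face i s`. -/
def Box.side (K : Box d) (i : Fin d) (s : Bool) : ℝ := if s then K.hi i else K.lo i

theorem Box.face_eq_iff {K L : Box d} {i : Fin d} {s t : Bool} :
    K.face i s = L.face i t ↔
      K.side i s = L.side i t ∧ ∀ j, j ≠ i → K.lo j = L.lo j ∧ K.hi j = L.hi j := by
  constructor
  · intro h
    have hlo : Function.update K.lo i (K.side i s) = Function.update L.lo i (L.side i t) :=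
      congrArg Face.lo h
    have hhi : Function.update K.hi i (K.side i s) = Function.update L.hi i (L.side i t) :=
      congrArg Face.hi h
    refine ⟨by simpa using congrFun hlo i, fun j hj => ⟨?_, ?_⟩⟩
    · simpa [hj] using congrFun hlo j
    · simpa [hj] using congrFun hhi j
  · rintro ⟨h, h'⟩
    have hlo : Function.update K.lo i (K.side i s) = Function.update L.lo i (L.side i t) := by
      funext j
      by_cases hj : j = i
      · subst hj; simpa using h
      · simpa [hj] using (h' j hj).1
    have hhi : Function.update K.hi i (K.side i s) = Function.update L.hi i (L.side i t) := by
      funext j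
      by_cases hj : j = i
      · subst hj; simpa using h
      · simpa [hj] using (h' j hj).2
    exact congrArg₂ (Face.mk i) hlo hhi

theorem Box.dir_face (K : Box d) (i : Fin d) (s : Bool) : (K.face i s).dir = i := rfl

theorem Box.vol_pos {K : Box d} (h : ∀ i, K.lo i < K.hi i) : 0 < K.vol :=
  Finset.prod_pos fun i _ => sub_pos.2 (h i)

theorem Box.area_face (K : Box d) (i : Fin d) (s : Bool) :
    (K.face i s).area = ∏ j ∈ Finset.univ.erase i, K.len j := by
  refine Finset.prod_congr rfl fun j hj => ?_
  have hj : j ≠ i := Finset.ne_of_mem_erase hj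
  simp [Box.face, Box.len, hj]

theorem Box.area_mul_len (K : Box d) (i : Fin d) (s : Bool) :
    (K.face i s).area * K.len i = K.vol := by
  rw [K.area_face, mul_comm]
  exact Finset.mul_prod_erase _ _ (Finset.mem_univ i)

namespace Mesh

variable (M : Mesh d Ω)

variable {M} in
theorem len_pos {K : Box d} (hK : K ∈ M.cells) (i : Fin d) : 0 < K.len i :=
  sub_pos.2 (M.lo_lt_hi K hK i)

variable {M} in
theorem vol_pos {K : Box d} (hK : K ∈ M.cells) : 0 < K.vol := Box.vol_pos (M.lo_lt_hi K hK)

variable {M} in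
theorem area_pos {K : Box d} (hK : K ∈ M.cells) (i : Fin d) (s : Bool) :
    0 < (K.face i s).area := by
  rw [K.area_face]
  exact Finset.prod_pos fun j _ => len_pos hK j

theorem face_mem {K : Box d} (hK : K ∈ M.cells) (i : Fin d) (s : Bool) :
    K.face i s ∈ M.faces := by
  classical
  unfold faces
  simp only [Finset.mem_biUnion, Finset.mem_image]
  exact ⟨K, hK, (i, s), Finset.mem_univ _, rfl⟩

theorem eq_of_overlap {K L : Box d} (hK : K ∈ M.cells) (hL : L ∈ M.cells)
    (h : ∀ i, max (K.lo i) (L.lo i) < min (K.hi i) (L.hi i)) : K = L := by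
  by_contra hne
  choose x hx using fun i => exists_between (h i)
  have h1 : x ∈ K.openSet := fun i _ =>
    ⟨(le_max_left _ _).trans_lt (hx i).1, (hx i).2.trans_le (min_le_left _ _)⟩
  have h2 : x ∈ L.openSet := fun i _ =>
    ⟨(le_max_right _ _).trans_lt (hx i).1, (hx i).2.trans_le (min_le_right _ _)⟩
  exact Set.disjoint_left.1 (M.disjoint K hK L hL hne) h1 h2

/-- Two cells on the same side of a face overlap next to it. Hence a face belongs to at most two
cells and the choice made in `Mesh.nbr` is unique. -/
theorem eq_of_face_eq {K L : Box d} (hK : K ∈ M.cells) (hL : L ∈ M.cells) {i : Fin d} {s : Bool}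
    (h : K.face i s = L.face i s) : K = L := by
  obtain ⟨h1, h2⟩ := Box.face_eq_iff.1 h
  refine M.eq_of_overlap hK hL fun j => ?_
  by_cases hj : j = i
  · subst hj
    have hK' := M.lo_lt_hi K hK j
    have hL' := M.lo_lt_hi L hL j
    cases s <;> simp only [Box.side, if_true, if_false, Bool.false_eq_true] at h1
    · rw [h1, max_self, lt_min_iff]
      exact ⟨h1 ▸ hK', hL'⟩
    · rw [h1, min_self, max_lt_iff]
      exact ⟨h1 ▸ hK', hL'⟩
  · rw [(h2 j hj).1, (h2 j hj).2, max_self, min_self]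
    exact M.lo_lt_hi L hL j

theorem face_ne_face_not {K : Box d} (hK : K ∈ M.cells) (i : Fin d) (s : Bool) :
    K.face i (!s) ≠ K.face i s := by
  intro h
  have h1 := (Box.face_eq_iff.1 h).1
  have := M.lo_lt_hi K hK i
  cases s <;> simp [Box.side] at h1 <;> linarith

theorem nbr_spec {K : Box d} {i : Fin d} {s : Bool} (h : M.IsInternal K i s) :
    M.nbr K i s ∈ M.cells ∧ (M.nbr K i s).face i (!s) = K.face i s := by
  unfold nbr
  rw [dif_pos h]
  exact h.choose_spec

theorem nbr_of_not_isInternal {K : Box d} {i : Fin d} {s : Bool} (h : ¬ M.IsInternal K i s) :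
    M.nbr K i s = K := by
  unfold nbr
  rw [dif_neg h]

theorem nbr_mem {K : Box d} (hK : K ∈ M.cells) (i : Fin d) (s : Bool) :
    M.nbr K i s ∈ M.cells := by
  by_cases h : M.IsInternal K i s
  · exact (M.nbr_spec h).1
  · rwa [M.nbr_of_not_isInternal h]

theorem nbr_eq {K L : Box d} (hL : L ∈ M.cells) {i : Fin d} {s : Bool}
    (h : L.face i (!s) = K.face i s) : M.nbr K i s = L := by
  have h' := M.nbr_spec ⟨L, hL, h⟩
  exact M.eq_of_face_eq h'.1 hL (h'.2.trans h.symm)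

theorem isInternal_nbr {K : Box d} (hK : K ∈ M.cells) {i : Fin d} {s : Bool}
    (h : M.IsInternal K i s) : M.IsInternal (M.nbr K i s) i (!s) :=
  ⟨K, hK, by rw [Bool.not_not, (M.nbr_spec h).2]⟩

theorem nbr_nbr {K : Box d} (hK : K ∈ M.cells) {i : Fin d} {s : Bool}
    (h : M.IsInternal K i s) : M.nbr (M.nbr K i s) i (!s) = K :=
  M.nbr_eq hK (by rw [Bool.not_not, (M.nbr_spec h).2])

theorem nbr_coords {K : Box d} {i : Fin d} {s : Bool} (h : M.IsInternal K i s) :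
    (M.nbr K i s).side i (!s) = K.side i s ∧
      ∀ j, j ≠ i → (M.nbr K i s).lo j = K.lo j ∧ (M.nbr K i s).hi j = K.hi j :=
  Box.face_eq_iff.1 (M.nbr_spec h).2

open Classical in
/-- Exchanging the two cells that share an internal face does not change a sum over all pairs of a
cell and a side. -/
theorem sum_nbr (i : Fin d) (f : Box d → Bool → ℝ) :
    ∑ K ∈ M.cells, ∑ s : Bool, (if M.IsInternal K i s then f (M.nbr K i s) (!s) else 0) =
      ∑ K ∈ M.cells, ∑ s : Bool, if M.IsInternal K i s then f K s else 0 := by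
  rw [← Finset.sum_product', ← Finset.sum_product', ← Finset.sum_filter, ← Finset.sum_filter]
  -- Crossing the face is an involution of the pairs of a cell and an internal side.
  refine Finset.sum_bij' (fun p _ => (M.nbr p.1 i p.2, !p.2)) (fun p _ => (M.nbr p.1 i p.2, !p.2))
    ?_ ?_ ?_ ?_ ?_
  · rintro ⟨K, s⟩ hp
    simp only [Finset.mem_filter, Finset.mem_product, Finset.mem_univ, and_true] at hp ⊢
    exact ⟨M.nbr_mem hp.1 _ _, M.isInternal_nbr hp.1 hp.2⟩
  · rintro ⟨K, s⟩ hp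
    simp only [Finset.mem_filter, Finset.mem_product, Finset.mem_univ, and_true] at hp ⊢
    exact ⟨M.nbr_mem hp.1 _ _, M.isInternal_nbr hp.1 hp.2⟩
  · rintro ⟨K, s⟩ hp
    simp only [Finset.mem_filter, Finset.mem_product, Finset.mem_univ, and_true] at hp ⊢
    simp [M.nbr_nbr hp.1 hp.2]
  · rintro ⟨K, s⟩ hp
    simp only [Finset.mem_filter, Finset.mem_product, Finset.mem_univ, and_true] at hp ⊢
    simp [M.nbr_nbr hp.1 hp.2]
  · intro p hp
    rfl

theorem face_eq_of_touch {A B : Box d} (hA : A ∈ M.cells) (hB : B ∈ M.cells) {j : Fin d} {s : Bool}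
    (h : A.side j s = B.side j (!s))
    (ho : ∀ k, k ≠ j → max (A.lo k) (B.lo k) < min (A.hi k) (B.hi k)) :
    B.face j (!s) = A.face j s := by
  cases s
  · refine M.conforming B hB A hA j ?_ fun k hk => ?_
    · simpa [Box.side] using h.symm
    · rw [max_comm, min_comm]; exact ho k hk
  · refine (M.conforming A hA B hB j ?_ fun k hk => ?_).symm
    · simpa [Box.side] using h
    · exact ho k hk

/-- Four cells around an edge. -/
theorem nbr_face_eq {K : Box d} (hK : K ∈ M.cells) {i j : Fin d} (hij : j ≠ i) {r s : Bool}
    (hi : M.IsInternal K i r) (hj : M.IsInternal K j s)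
    (hj' : M.IsInternal (M.nbr K i r) j s) :
    (M.nbr (M.nbr K i r) j s).face i (!r) = (M.nbr K j s).face i r := by
  have c1 := M.nbr_coords hi
  have c2 := M.nbr_coords hj
  have c3 := M.nbr_coords hj'
  have m2 := M.nbr_mem hK j s
  have m3 := M.nbr_mem (M.nbr_mem hK i r) j s
  refine M.face_eq_of_touch m2 m3 ?_ fun k hk => ?_
  · have e1 : (M.nbr K j s).side i r = K.side i r := by
      simp only [Box.side, (c2.2 i hij.symm).1, (c2.2 i hij.symm).2]
    have e2 : (M.nbr (M.nbr K i r) j s).side i (!r) = (M.nbr K i r).side i (!r) := by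
      simp only [Box.side, (c3.2 i hij.symm).1, (c3.2 i hij.symm).2]
    rw [e1, e2, c1.1]
  · by_cases hkj : k = j
    · subst hkj
      have h2 := c2.1
      have h3 := c3.1
      have l2 := M.lo_lt_hi _ m2 k
      have l3 := M.lo_lt_hi _ m3 k
      have e1 := c1.2 k hij
      -- In the direction j the two outer cells extend from the same coordinate to the same side.
      -- Their intervals therefore overlap although their lengths are not yet known to agree, and
      -- this is all that conformity asks for.
      cases s <;> simp [Box.side] at h2 h3 <;> rw [max_lt_iff, lt_min_iff, lt_min_iff] <;>
        refine ⟨⟨?_, ?_⟩, ?_, ?_⟩ <;> linarith [e1.1, e1.2]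
    · rw [(c2.2 k hkj).1, (c2.2 k hkj).2, (c3.2 k hkj).1, (c3.2 k hkj).2, (c1.2 k hk).1,
        (c1.2 k hk).2, max_self, min_self]
      exact M.lo_lt_hi K hK k

/-- If three of the four cells around an edge that lie around a neighbour of `K` exist, then so does
the fourth one. -/
theorem isInternal_of_corner {K : Box d} (hK : K ∈ M.cells) {i j : Fin d} (hij : j ≠ i)
    {r s : Bool} (hi : M.IsInternal K i r) (hj' : M.IsInternal (M.nbr K i r) j s)
    (hi' : M.IsInternal (M.nbr (M.nbr K i r) j s) i (!r)) : M.IsInternal K j s := by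
  have hL := M.nbr_mem hK i r
  have h := M.nbr_face_eq hL hij.symm hj' (M.isInternal_nbr hK hi) hi'
  rw [M.nbr_nbr hK hi] at h
  exact ⟨_, M.nbr_mem (M.nbr_mem hL j s) i (!r), h⟩

open Classical in
/-- A sum over the cells that have a given face in common. -/
theorem sum_cells_of_face {K : Box d} (hK : K ∈ M.cells) (i : Fin d) (s : Bool)
    (g : Box d → ℝ) :
    ∑ L ∈ M.cells, ∑ t : Bool, (if L.face (K.face i s).dir t = K.face i s then g L else 0) =
      g K + if M.IsInternal K i s then g (M.nbr K i s) else 0 := by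
  have e : ∀ L, ∑ t : Bool, (if L.face (K.face i s).dir t = K.face i s then g L else 0) =
      (if L.face i s = K.face i s then g L else 0) +
        if L.face i (!s) = K.face i s then g L else 0 := fun L => by
    rw [Fintype.sum_bool, Box.dir_face]
    cases s
    · rw [add_comm]; rfl
    · rfl
  rw [Finset.sum_congr rfl fun L _ => e L, Finset.sum_add_distrib]
  congr 1
  · rw [Finset.sum_eq_single K, if_pos rfl]
    · exact fun L hL hne => if_neg fun h => hne (M.eq_of_face_eq hL hK h)
    · exact fun h => absurd hK h
  · split_ifs with h
    · rw [Finset.sum_eq_single (M.nbr K i s), if_pos (M.nbr_spec h).2]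
      · exact fun L hL hne => if_neg fun h => hne (M.nbr_eq hL h).symm
      · exact fun h => absurd (M.nbr_mem hK i s) h
    · exact Finset.sum_eq_zero fun L hL => if_neg fun h' => h ⟨L, hL, h'⟩

open Classical in
theorem dualVol_eq {K : Box d} (hK : K ∈ M.cells) (i : Fin d) (s : Bool) :
    M.dualVol (K.face i s) =
      K.vol / 2 + if M.IsInternal K i s then (M.nbr K i s).vol / 2 else 0 :=
  M.sum_cells_of_face hK i s fun L => L.vol / 2

theorem dualVol_of_isInternal {K : Box d} (hK : K ∈ M.cells) {i : Fin d} {s : Bool}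
    (h : M.IsInternal K i s) :
    M.dualVol (K.face i s) = K.vol / 2 + (M.nbr K i s).vol / 2 := by
  rw [M.dualVol_eq hK, if_pos h]

theorem half_vol_le_dualVol {K : Box d} (hK : K ∈ M.cells) (i : Fin d) (s : Bool) :
    K.vol / 2 ≤ M.dualVol (K.face i s) := by
  rw [M.dualVol_eq hK]
  have := vol_pos (M.nbr_mem hK i s)
  split_ifs <;> linarith

theorem dualVol_pos {K : Box d} (hK : K ∈ M.cells) (i : Fin d) (s : Bool) :
    0 < M.dualVol (K.face i s) :=
  (half_pos (vol_pos hK)).trans_le (M.half_vol_le_dualVol hK i s)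

theorem dualVol_mul_dualAvg {K : Box d} (hK : K ∈ M.cells) {i : Fin d} {s : Bool}
    (h : M.IsInternal K i s) (q : Box d → ℝ) :
    M.dualVol (K.face i s) * M.dualAvg q (K.face i s) =
      K.vol / 2 * q K + (M.nbr K i s).vol / 2 * q (M.nbr K i s) := by
  unfold dualAvg
  rw [mul_div_cancel₀ _ (M.dualVol_pos hK i s).ne']
  have := M.sum_cells_of_face hK i s fun L => L.vol / 2 * q L
  rwa [if_pos h] at this

open Classical in
/-- A weighted sum over the faces as a sum over all cells and their faces. -/
theorem sum_faces_dualVol (g : Face d → ℝ) :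
    ∑ σ ∈ M.faces, M.dualVol σ * g σ =
      ∑ K ∈ M.cells, ∑ i, ∑ s : Bool, K.vol / 2 * g (K.face i s) := by
  unfold dualVol
  simp only [Finset.sum_mul]
  rw [Finset.sum_comm]
  refine Finset.sum_congr rfl fun K hK => ?_
  have hr : ∑ i, ∑ s : Bool, K.vol / 2 * g (K.face i s) =
      ∑ p : Fin d × Bool, K.vol / 2 * g (K.face p.1 p.2) :=
    (Fintype.sum_prod_type' fun i s => K.vol / 2 * g (K.face i s)).symm
  have hinj : Set.InjOn (fun p : Fin d × Bool => K.face p.1 p.2)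
      ((Finset.univ : Finset (Fin d × Bool)) : Set (Fin d × Bool)) := by
    rintro ⟨i, s⟩ - ⟨j, t⟩ - h
    have hij : i = j := congrArg Face.dir h
    subst hij
    have : s = t := by
      by_contra hst
      obtain rfl : t = !s := by cases s <;> cases t <;> simp_all
      exact M.face_ne_face_not hK i s h.symm
    rw [this]
  rw [hr, ← Finset.sum_image (f := fun σ => K.vol / 2 * g σ) hinj]
  symm
  refine Finset.sum_subset_zero_on_sdiff ?_ ?_ ?_
  · intro σ hσ
    obtain ⟨p, -, rfl⟩ := Finset.mem_image.1 hσ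
    exact M.face_mem hK _ _
  · intro σ hσ
    refine Finset.sum_eq_zero fun s _ => ?_
    rw [if_neg, zero_mul]
    intro h
    exact (Finset.mem_sdiff.1 hσ).2 (Finset.mem_image.2 ⟨(σ.dir, s), Finset.mem_univ _, h⟩)
  · intro σ hσ
    obtain ⟨⟨i, s⟩, -, rfl⟩ := Finset.mem_image.1 hσ
    rw [Fintype.sum_bool]
    simp only [Box.dir_face]
    have := M.face_ne_face_not hK i s
    cases s
    · simp only [Bool.not_false] at this
      simp [this]
    · simp only [Bool.not_true] at this
      simp [this]

end Mesh
end MAC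

/-! ### The Helmholtz function and the relative internal energy. -/

namespace MAC

theorem hasDerivAt_helmholtz (γ : ℝ) {a : ℝ} (ha : 0 < a) :
    HasDerivAt (helmholtz γ)
      (if γ = 1 then Real.log a + 1 else γ * a ^ (γ - 1) / (γ - 1)) a := by
  by_cases h : γ = 1
  · have e : helmholtz γ = fun r => r * Real.log r := funext fun r => by simp [helmholtz, h]
    rw [e, if_pos h]
    exact Real.hasDerivAt_mul_log ha.ne'
  · have e : helmholtz γ = fun r => r ^ γ / (γ - 1) := funext fun r => by simp [helmholtz, h]
    rw [e, if_neg h]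
    exact (Real.hasDerivAt_rpow_const (Or.inl ha.ne')).div_const _

theorem continuous_helmholtz {γ : ℝ} (hγ : 1 ≤ γ) : Continuous (helmholtz γ) := by
  by_cases h : γ = 1
  · have e : helmholtz γ = fun r => r * Real.log r := funext fun r => by simp [helmholtz, h]
    rw [e]
    exact Real.continuous_mul_log
  · have e : helmholtz γ = fun r => r ^ γ / (γ - 1) := funext fun r => by simp [helmholtz, h]
    rw [e]
    exact (Real.continuous_rpow_const (by linarith)).div_const _

theorem continuous_pressure {γ : ℝ} (hγ : 1 ≤ γ) : Continuous (pressure γ) :=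
  Real.continuous_rpow_const (by linarith)

theorem continuous_relEnergy {γ : ℝ} (hγ : 1 ≤ γ) : Continuous (relEnergy γ) := by
  have := continuous_helmholtz hγ
  unfold relEnergy
  fun_prop

theorem convexOn_helmholtz {γ : ℝ} (hγ : 1 ≤ γ) : ConvexOn ℝ (Set.Ici 0) (helmholtz γ) := by
  by_cases h : γ = 1
  · have e : helmholtz γ = fun r => r * Real.log r := funext fun r => by simp [helmholtz, h]
    rw [e]
    exact Real.convexOn_mul_log
  · have e : helmholtz γ = fun r => (γ - 1)⁻¹ • r ^ γ := funext fun r => by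
      simp [helmholtz, h, div_eq_inv_mul]
    rw [e]
    exact (convexOn_rpow hγ).smul (inv_nonneg.2 (by linarith))

/-- The derivative of `Π_γ`. -/
noncomputable def relEnergyDeriv (γ r : ℝ) : ℝ := deriv (helmholtz γ) r - deriv (helmholtz γ) 1

/-- A convex function lies above its tangents; the slopes of the secants are compared on either side
of a. -/
theorem helmholtz_tangent {γ : ℝ} (hγ : 1 ≤ γ) {a b : ℝ} (ha : 0 < a) (hb : 0 ≤ b) :
    helmholtz γ a + deriv (helmholtz γ) a * (b - a) ≤ helmholtz γ b := by
  have hd := (hasDerivAt_helmholtz γ ha).differentiableAt.hasDerivAt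
  rcases lt_trichotomy a b with h | rfl | h
  · have := (convexOn_helmholtz hγ).le_slope_of_hasDerivAt ha.le hb h hd
    rw [slope_def_field, le_div_iff₀ (sub_pos.2 h)] at this
    linarith
  · simp
  · have := (convexOn_helmholtz hγ).slope_le_of_hasDerivAt hb ha.le h hd
    rw [slope_def_field, div_le_iff₀ (sub_pos.2 h)] at this
    linarith

theorem relEnergy_tangent {γ : ℝ} (hγ : 1 ≤ γ) {a b : ℝ} (ha : 0 < a) (hb : 0 ≤ b) :
    relEnergy γ a + relEnergyDeriv γ a * (b - a) ≤ relEnergy γ b := by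
  have := helmholtz_tangent hγ ha hb
  unfold relEnergy relEnergyDeriv
  linarith

theorem mul_deriv_helmholtz (γ : ℝ) {a : ℝ} (ha : 0 < a) :
    a * deriv (helmholtz γ) a - helmholtz γ a = pressure γ a := by
  rw [(hasDerivAt_helmholtz γ ha).deriv]
  unfold helmholtz pressure
  split_ifs with h
  · rw [h, Real.rpow_one]; ring
  · have h' : γ - 1 ≠ 0 := sub_ne_zero.2 h
    have : a ^ γ = a * a ^ (γ - 1) := by
      rw [Real.rpow_sub_one ha.ne']; field_simp
    rw [this]
    field_simp

theorem deriv_helmholtz_one (γ : ℝ) : deriv (helmholtz γ) 1 = helmholtz γ 1 + 1 := by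
  have := mul_deriv_helmholtz γ one_pos
  have h : pressure γ 1 = 1 := Real.one_rpow γ
  linarith

/-- Subtracting the tangent of ψ_γ at 1 changes the pressure only by the constant p(1) = 1. This
identity converts the flux of Π_γ'(ρ)ρ into the flux of Π_γ and the work of the pressure. -/
theorem mul_relEnergyDeriv (γ : ℝ) {a : ℝ} (ha : 0 < a) :
    a * relEnergyDeriv γ a - relEnergy γ a = pressure γ a - 1 := by
  have h1 := mul_deriv_helmholtz γ ha
  have h2 := deriv_helmholtz_one γ
  unfold relEnergy relEnergyDeriv
  linarith

/-- The constants match because ψ_γ'(1) = ψ_γ(1) + 1. The right-hand side is the form in which the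
flux comes out of the discrete balance. -/
theorem entropyFlux_eq {d : ℕ} (γ ε r : ℝ) (v : Fin d → ℝ) :
    entropyFlux γ ε r v =
      1 / 2 * r * ∑ i, v i ^ 2 + 1 / ε ^ 2 * (relEnergy γ r + (pressure γ r - 1)) := by
  have h := deriv_helmholtz_one γ
  unfold entropyFlux relEnergy
  rw [h]
  ring

end MAC

/-! ### Upwind fluxes and the discrete internal energy balance. -/

namespace MAC

theorem pos_neg (a : ℝ) : pos (-a) = -neg a := by unfold pos neg; rw [abs_neg]; ring
theorem neg_neg (a : ℝ) : neg (-a) = -pos a := by unfold pos neg; rw [abs_neg]; ring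
theorem pos_add_neg (a : ℝ) : pos a + neg a = a := by unfold pos neg; ring
theorem pos_nonneg (a : ℝ) : 0 ≤ pos a := by unfold pos; linarith [neg_abs_le a]
theorem neg_nonpos (a : ℝ) : neg a ≤ 0 := by unfold neg; linarith [le_abs_self a]
theorem pos_zero : pos 0 = 0 := by simp [pos]
theorem neg_zero : neg 0 = 0 := by simp [neg]
theorem sgn_not (s : Bool) : sgn (!s) = -sgn s := by cases s <;> simp [sgn]
theorem sgn_mul_sgn (s : Bool) : sgn s * sgn s = 1 := by cases s <;> simp [sgn]

theorem upwind_neg (F a b : ℝ) : upwind (-F) b a = -upwind F a b := by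
  unfold upwind
  rcases lt_trichotomy F 0 with h | h | h
  · rw [if_pos (by linarith), if_neg (by linarith)]; ring
  · simp [h]
  · rw [if_neg (by linarith), if_pos h.le]; ring

/-- Nothing can flow in from a face where the velocity vanishes. This gives the sign of the terms
that the boundary of the domain leaves uncancelled. -/
theorem upwind_zero_right_nonneg (F : ℝ) {a : ℝ} (ha : 0 ≤ a) : 0 ≤ upwind F a 0 := by
  unfold upwind
  split_ifs with h
  · positivity
  · simp

theorem upwind_zero_left_nonpos (F : ℝ) {b : ℝ} (hb : 0 ≤ b) : upwind F 0 b ≤ 0 := by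
  unfold upwind
  split_ifs with h
  · simp
  · exact mul_nonpos_of_nonpos_of_nonneg (by linarith) hb

/-- The difference of the two sides is zero for an outgoing flux and |F|(a - b)²/2 for an incoming
one: upwinding dissipates kinetic energy. -/
theorem upwind_energy (F a b : ℝ) :
    1 / 2 * upwind F (a ^ 2) (b ^ 2) + 1 / 2 * a ^ 2 * F ≤ a * upwind F a b := by
  unfold upwind
  split_ifs with h
  · linarith [mul_comm F a, mul_comm (a ^ 2) F, show a * (F * a) = F * a ^ 2 by ring]
  · have : F * (a - b) ^ 2 ≤ 0 := mul_nonpos_of_nonpos_of_nonneg (by linarith) (sq_nonneg _)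
    nlinarith

variable {d : ℕ} {Ω : Set (Fin d → ℝ)}

namespace Mesh

variable (M : Mesh d Ω)

/-- The nonnegative part `u⁺ - δu⁻` of the stabilised velocity. -/
noncomputable def vPlus (γ ε δt : ℝ) (η : Face d → ℝ) (ρ : Box d → ℝ) (u : Face d → ℝ)
    (K : Box d) (i : Fin d) (s : Bool) : ℝ :=
  pos (u (K.face i s) * sgn s) - neg (M.shift γ ε δt η ρ K i s)

/-- The nonpositive part `u⁻ - δu⁺` of the stabilised velocity. -/
noncomputable def vMinus (γ ε δt : ℝ) (η : Face d → ℝ) (ρ : Box d → ℝ) (u : Face d → ℝ)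
    (K : Box d) (i : Fin d) (s : Bool) : ℝ :=
  neg (u (K.face i s) * sgn s) - pos (M.shift γ ε δt η ρ K i s)

/-- A family of numbers attached to the faces of the cells is conservative if it is antisymmetric
at internal faces and vanishes at external ones. -/
def Conservative (i : Fin d) (F : Box d → Bool → ℝ) : Prop :=
  ∀ K ∈ M.cells, ∀ s, (M.IsInternal K i s → F (M.nbr K i s) (!s) = -F K s) ∧
    (¬ M.IsInternal K i s → F K s = 0)

variable {M}

/-- Exchanging the two cells at every internal face turns the sum into its own negative. -/
theorem Conservative.sum_eq_zero {i : Fin d} {F : Box d → Bool → ℝ} (h : M.Conservative i F) :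
    ∑ K ∈ M.cells, ∑ s : Bool, F K s = 0 := by
  classical
  have h1 : ∑ K ∈ M.cells, ∑ s : Bool, F K s =
      ∑ K ∈ M.cells, ∑ s : Bool, if M.IsInternal K i s then F K s else 0 :=
    Finset.sum_congr rfl fun K hK => Finset.sum_congr rfl fun s _ => by
      split_ifs with hi
      · rfl
      · exact (h K hK s).2 hi
  have h2 : ∑ K ∈ M.cells, ∑ s : Bool, (if M.IsInternal K i s then F K s else 0) =
      -∑ K ∈ M.cells, ∑ s : Bool, if M.IsInternal K i s then F K s else 0 := by
    conv_lhs => rw [← M.sum_nbr]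
    rw [← Finset.sum_neg_distrib]
    refine Finset.sum_congr rfl fun K hK => ?_
    rw [← Finset.sum_neg_distrib]
    refine Finset.sum_congr rfl fun s _ => ?_
    split_ifs with hi
    · exact (h K hK s).1 hi
    · simp
  rw [h1]
  linarith

variable (M)

open Classical in
-- Passes to a sum in which each internal face is counted once, from its lower cell, as in the
-- momentum equation.
theorem sum_internal (i : Fin d) (f : Box d → Bool → ℝ) :
    ∑ K ∈ M.cells, (if M.IsInternal K i true then f K true + f (M.nbr K i true) false else 0) =
      ∑ K ∈ M.cells, ∑ s : Bool, if M.IsInternal K i s then f K s else 0 := by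
  have h := M.sum_nbr i fun K s => if s = false then f K s else 0
  simp only [Fintype.sum_bool, Bool.not_true, Bool.not_false, if_false, ite_self,
    Bool.true_eq_false, add_zero, zero_add, if_pos] at h ⊢
  rw [Finset.sum_add_distrib, ← h, ← Finset.sum_add_distrib]
  refine Finset.sum_congr rfl fun K _ => ?_
  split_ifs <;> simp

section Flux

variable {γ ε δt : ℝ} {η : Face d → ℝ} {ρ : Box d → ℝ} {u : Face d → ℝ}

theorem massFlux_eq (K : Box d) (i : Fin d) (s : Bool) :
    M.massFlux γ ε δt η ρ u K i s = (K.face i s).area *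
      (ρ K * M.vPlus γ ε δt η ρ u K i s + ρ (M.nbr K i s) * M.vMinus γ ε δt η ρ u K i s) := rfl

theorem grad_nbr {K : Box d} (hK : K ∈ M.cells) {i : Fin d} {s : Bool} (h : M.IsInternal K i s)
    (q : Box d → ℝ) : M.grad q (M.nbr K i s) i (!s) = M.grad q K i s := by
  unfold grad
  rw [M.nbr_nbr hK h, (M.nbr_spec h).2, sgn_not]
  ring

theorem shift_nbr {K : Box d} (hK : K ∈ M.cells) {i : Fin d} {s : Bool} (h : M.IsInternal K i s) :
    M.shift γ ε δt η ρ (M.nbr K i s) i (!s) = -M.shift γ ε δt η ρ K i s := by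
  unfold shift
  rw [M.grad_nbr hK h, (M.nbr_spec h).2, sgn_not]
  ring

theorem shift_of_not_isInternal {K : Box d} {i : Fin d} {s : Bool} (h : ¬ M.IsInternal K i s) :
    M.shift γ ε δt η ρ K i s = 0 := by
  unfold shift grad
  rw [M.nbr_of_not_isInternal h]
  ring

/-- Seen from the other cell, the velocity and the shift change sign, which exchanges positive and
negative parts. -/
theorem vPlus_nbr {K : Box d} (hK : K ∈ M.cells) {i : Fin d} {s : Bool} (h : M.IsInternal K i s) :
    M.vPlus γ ε δt η ρ u (M.nbr K i s) i (!s) = -M.vMinus γ ε δt η ρ u K i s := by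
  unfold vPlus vMinus
  rw [M.shift_nbr hK h, (M.nbr_spec h).2, sgn_not, mul_neg, pos_neg, neg_neg]
  ring

theorem vMinus_nbr {K : Box d} (hK : K ∈ M.cells) {i : Fin d} {s : Bool}
    (h : M.IsInternal K i s) :
    M.vMinus γ ε δt η ρ u (M.nbr K i s) i (!s) = -M.vPlus γ ε δt η ρ u K i s := by
  unfold vPlus vMinus
  rw [M.shift_nbr hK h, (M.nbr_spec h).2, sgn_not, mul_neg, pos_neg, neg_neg]
  ring

theorem vMinus_nonpos (K : Box d) (i : Fin d) (s : Bool) : M.vMinus γ ε δt η ρ u K i s ≤ 0 :=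
  sub_nonpos.2 ((neg_nonpos _).trans (pos_nonneg _))

theorem vPlus_add_vMinus (K : Box d) (i : Fin d) (s : Bool) :
    M.vPlus γ ε δt η ρ u K i s + M.vMinus γ ε δt η ρ u K i s =
      u (K.face i s) * sgn s - M.shift γ ε δt η ρ K i s := by
  have h1 := pos_add_neg (u (K.face i s) * sgn s)
  have h2 := pos_add_neg (M.shift γ ε δt η ρ K i s)
  unfold vPlus vMinus
  linarith

theorem vPlus_of_not_isInternal {K : Box d} {i : Fin d} {s : Bool} (h : ¬ M.IsInternal K i s)
    (hu : u (K.face i s) = 0) : M.vPlus γ ε δt η ρ u K i s = 0 := by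
  unfold vPlus
  rw [M.shift_of_not_isInternal h, hu, zero_mul, pos_zero, neg_zero, sub_zero]

theorem vMinus_of_not_isInternal {K : Box d} {i : Fin d} {s : Bool} (h : ¬ M.IsInternal K i s)
    (hu : u (K.face i s) = 0) : M.vMinus γ ε δt η ρ u K i s = 0 := by
  unfold vMinus
  rw [M.shift_of_not_isInternal h, hu, zero_mul, pos_zero, neg_zero, sub_zero]

/-- The upwind fluxes of any cell function are conservative, also if weighted by numbers that are
attached to the faces. -/
theorem conservative_upwind (hu : ∀ K ∈ M.cells, ∀ i s, ¬ M.IsInternal K i s → u (K.face i s) = 0)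
    (i : Fin d) (G : Box d → ℝ) (φ : Face d → ℝ) :
    M.Conservative i fun K s => φ (K.face i s) * ((K.face i s).area *
      (G K * M.vPlus γ ε δt η ρ u K i s + G (M.nbr K i s) * M.vMinus γ ε δt η ρ u K i s)) := by
  refine fun K hK s => ⟨fun h => ?_, fun h => ?_⟩
  · simp only [M.vPlus_nbr hK h, M.vMinus_nbr hK h, M.nbr_nbr hK h, (M.nbr_spec h).2]
    ring
  · simp only [M.vPlus_of_not_isInternal h (hu K hK i s h),
      M.vMinus_of_not_isInternal h (hu K hK i s h)]
    ring

theorem conservative_massFlux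
    (hu : ∀ K ∈ M.cells, ∀ i s, ¬ M.IsInternal K i s → u (K.face i s) = 0) (i : Fin d) :
    M.Conservative i fun K s => M.massFlux γ ε δt η ρ u K i s := by
  simpa only [one_mul, ← massFlux_eq] using
    M.conservative_upwind (γ := γ) (ε := ε) (δt := δt) (η := η) (ρ := ρ) hu i ρ fun _ => 1

/-- The local internal energy balance. -/
theorem internal_energy_cell (hγ : 1 ≤ γ) {ρ' : Box d → ℝ} (hδt : 0 < δt) {K : Box d}
    (hK : K ∈ M.cells) (hρ : ∀ K ∈ M.cells, 0 < ρ K) (hρ' : ∀ K ∈ M.cells, 0 < ρ' K)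
    (hmass : (ρ K - ρ' K) / δt + (∑ i, ∑ s, M.massFlux γ ε δt η ρ u K i s) / K.vol = 0) :
    K.vol * (relEnergy γ (ρ K) - relEnergy γ (ρ' K)) +
      δt * ∑ i, ∑ s, (K.face i s).area *
        (relEnergy γ (ρ K) * M.vPlus γ ε δt η ρ u K i s +
          relEnergy γ (ρ (M.nbr K i s)) * M.vMinus γ ε δt η ρ u K i s +
          (pressure γ (ρ K) - 1) *
            (M.vPlus γ ε δt η ρ u K i s + M.vMinus γ ε δt η ρ u K i s)) ≤ 0 := by
  have hv := vol_pos hK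
  set S := ∑ i, ∑ s, M.massFlux γ ε δt η ρ u K i s with hS
  have hm : K.vol * (ρ K - ρ' K) = -(δt * S) := by
    field_simp at hmass
    linarith
  -- The tangent is taken at the new density, the one in the fluxes, so that the remainder of the
  -- time difference can be dropped.
  have h1 := relEnergy_tangent hγ (hρ K hK) (hρ' K hK).le
  have h2 : K.vol * (relEnergy γ (ρ K) - relEnergy γ (ρ' K)) ≤
      -(δt * (relEnergyDeriv γ (ρ K) * S)) := by
    have : relEnergy γ (ρ K) - relEnergy γ (ρ' K) ≤ relEnergyDeriv γ (ρ K) * (ρ K - ρ' K) := by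
      linarith
    calc _ ≤ K.vol * (relEnergyDeriv γ (ρ K) * (ρ K - ρ' K)) := mul_le_mul_of_nonneg_left this hv.le
      _ = relEnergyDeriv γ (ρ K) * (K.vol * (ρ K - ρ' K)) := by ring
      _ = _ := by rw [hm]; ring
  have h3 : ∑ i, ∑ s, (K.face i s).area *
        (relEnergy γ (ρ K) * M.vPlus γ ε δt η ρ u K i s +
          relEnergy γ (ρ (M.nbr K i s)) * M.vMinus γ ε δt η ρ u K i s +
          (pressure γ (ρ K) - 1) *
            (M.vPlus γ ε δt η ρ u K i s + M.vMinus γ ε δt η ρ u K i s)) ≤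
      relEnergyDeriv γ (ρ K) * S := by
    rw [hS, Finset.mul_sum]
    refine Finset.sum_le_sum fun i _ => ?_
    rw [Finset.mul_sum]
    refine Finset.sum_le_sum fun s _ => ?_
    rw [massFlux_eq, mul_left_comm]
    refine mul_le_mul_of_nonneg_left ?_ (area_pos hK i s).le
    have hL := M.nbr_mem hK i s
    -- Convexity is needed only for the inflow from the neighbour, whose velocity is nonpositive and
    -- reverses the tangent inequality; the outflow is exact.
    have h4 := relEnergy_tangent hγ (hρ K hK) (hρ _ hL).le
    have h5 := mul_relEnergyDeriv γ (hρ K hK)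
    have h6 := mul_le_mul_of_nonpos_right h4
      (M.vMinus_nonpos (γ := γ) (ε := ε) (δt := δt) (η := η) (ρ := ρ) (u := u) K i s)
    rw [← h5]
    linarith
  have := mul_le_mul_of_nonneg_left h3 hδt.le
  linarith

theorem shift_eq (K : Box d) (i : Fin d) (s : Bool) :
    M.shift γ ε δt η ρ K i s = η (K.face i s) * δt / ε ^ 2 *
      ((K.face i s).area / M.dualVol (K.face i s)) *
        (pressure γ (ρ (M.nbr K i s)) - pressure γ (ρ K)) := by
  have := sgn_mul_sgn s
  unfold shift grad
  linear_combination (η (K.face i s) * δt / ε ^ 2 *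
      ((K.face i s).area / M.dualVol (K.face i s)) *
        (pressure γ (ρ (M.nbr K i s)) - pressure γ (ρ K))) * this

/-- The stabilisation term dissipates energy. -/
theorem sum_shift_nonpos (hδt : 0 < δt) (hη : ∀ σ ∈ M.faces, 0 ≤ η σ) {φ : Face d → ℝ}
    (hφ : ∀ σ ∈ M.faces, 0 ≤ φ σ) (i : Fin d) :
    ∑ K ∈ M.cells, ∑ s : Bool, φ (K.face i s) * ((K.face i s).area *
      ((pressure γ (ρ K) - 1) * M.shift γ ε δt η ρ K i s)) ≤ 0 := by
  classical
  set f : Box d → Bool → ℝ := fun K s => φ (K.face i s) * ((K.face i s).area *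
      ((pressure γ (ρ K) - 1) * M.shift γ ε δt η ρ K i s)) with hf
  have h1 : ∑ K ∈ M.cells, ∑ s : Bool, f K s =
      ∑ K ∈ M.cells, ∑ s : Bool, if M.IsInternal K i s then f K s else 0 :=
    Finset.sum_congr rfl fun K hK => Finset.sum_congr rfl fun s _ => by
      split_ifs with hi
      · rfl
      · simp only [hf, M.shift_of_not_isInternal hi, mul_zero]
  have h2 := M.sum_nbr i f
  -- This is twice the sum. The shift is a nonnegative multiple of the outward jump of the pressure,
  -- so the two cells of a face together contribute minus a multiple of the squared jump.
  have h3 : ∑ K ∈ M.cells, ∑ s : Bool,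
      (if M.IsInternal K i s then f (M.nbr K i s) (!s) else 0) +
      ∑ K ∈ M.cells, ∑ s : Bool, (if M.IsInternal K i s then f K s else 0) ≤ 0 := by
    rw [← Finset.sum_add_distrib]
    refine Finset.sum_nonpos fun K hK => ?_
    rw [← Finset.sum_add_distrib]
    refine Finset.sum_nonpos fun s _ => ?_
    split_ifs with hi
    · simp only [hf, M.shift_nbr hK hi, (M.nbr_spec hi).2]
      have hm := M.face_mem hK i s
      have h4 : 0 ≤ φ (K.face i s) * ((K.face i s).area * (η (K.face i s) * δt / ε ^ 2 *
          ((K.face i s).area / M.dualVol (K.face i s)))) := by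
        have := hφ _ hm
        have := hη _ hm
        have := area_pos hK i s
        have := M.dualVol_pos hK i s
        positivity
      have h5 := mul_nonneg h4
        (sq_nonneg (pressure γ (ρ (M.nbr K i s)) - pressure γ (ρ K)))
      rw [M.shift_eq]
      linarith
    · simp
  linarith

end Flux

end Mesh
end MAC

/-! ### The discrete kinetic energy balance on dual cells. -/

namespace MAC
variable {d : ℕ} {Ω : Set (Fin d → ℝ)}
namespace Mesh
variable (M : Mesh d Ω)

section Kinetic

variable {δt ε : ℝ} {F : Box d → Fin d → Bool → ℝ}

/-- The local kinetic energy balance on the dual cell of an internal face. -/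
theorem kinetic_energy_face (hδt : 0 < δt) {K : Box d} (hK : K ∈ M.cells) {i : Fin d}
    (hi : M.IsInternal K i true) (hF : ∀ i, M.Conservative i fun K s => F K i s)
    {r r' : Box d → ℝ} {v v' : Face d → ℝ} {g : ℝ}
    (hmass : ∀ K ∈ M.cells, (r K - r' K) / δt + (∑ i, ∑ s, F K i s) / K.vol = 0)
    (hmom : (M.dualAvg r (K.face i true) * v (K.face i true) -
        M.dualAvg r' (K.face i true) * v' (K.face i true)) / δt +
      M.momFlux F v' K i / M.dualVol (K.face i true) + g = 0) :
    (K.vol / 4 * (r K * v (K.face i true) ^ 2 - r' K * v' (K.face i true) ^ 2) +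
      (M.nbr K i true).vol / 4 * (r (M.nbr K i true) * v (K.face i true) ^ 2 -
        r' (M.nbr K i true) * v' (K.face i true) ^ 2)) +
      δt * (1 / 2 * M.momFlux F (fun σ => v' σ ^ 2) K i) +
      δt * (M.dualVol (K.face i true) * g * v' (K.face i true)) ≤
    K.vol / 4 * (r K * (v (K.face i true) - v' (K.face i true)) ^ 2) +
      (M.nbr K i true).vol / 4 *
        (r (M.nbr K i true) * (v (K.face i true) - v' (K.face i true)) ^ 2) := by
  have hD := M.dualVol_pos hK i true
  have hL := M.nbr_mem hK i true
  have hA := M.dualVol_mul_dualAvg hK hi r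
  have hA' := M.dualVol_mul_dualAvg hK hi r'
  set σ := K.face i true
  set L := M.nbr K i true with hLdef
  have hm1 : K.vol * (r K - r' K) = -(δt * ∑ i, ∑ s, F K i s) := by
    have h := hmass K hK
    have hv := vol_pos hK
    field_simp at h
    linarith
  have hm2 : L.vol * (r L - r' L) = -(δt * ∑ i, ∑ s, F L i s) := by
    have h := hmass L hL
    have hv := vol_pos hL
    field_simp at h
    linarith
  have hmom' : (M.dualVol σ * M.dualAvg r σ) * v σ - (M.dualVol σ * M.dualAvg r' σ) * v' σ +
      δt * M.momFlux F v' K i + δt * (M.dualVol σ * g) = 0 := by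
    field_simp at hmom
    linarith
  rw [hA, hA'] at hmom'
  have hanti : F L i false = -F K i true := ((hF i) K hK true).1 hi
  -- Mass balance on D_σ: its dual fluxes add up to half the primal fluxes out of K and L, the flux
  -- through σ itself cancelling.
  have hS : (F K i false - F K i true) / 2 + (F L i true - F L i false) / 2 +
      ∑ j ∈ Finset.univ.erase i, ∑ s : Bool, (F K j s + F L j s) / 2 =
      1 / 2 * (∑ i, ∑ s, F K i s) + 1 / 2 * ∑ i, ∑ s, F L i s := by
    rw [← Finset.add_sum_erase Finset.univ (fun i => ∑ s, F K i s) (Finset.mem_univ i),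
      ← Finset.add_sum_erase Finset.univ (fun i => ∑ s, F L i s) (Finset.mem_univ i)]
    simp only [← Finset.sum_div, Finset.sum_add_distrib, Fintype.sum_bool, hanti]
    ring
  have hen : 1 / 2 * M.momFlux F (fun σ => v' σ ^ 2) K i + 1 / 2 * v' σ ^ 2 *
      ((F K i false - F K i true) / 2 + (F L i true - F L i false) / 2 +
      ∑ j ∈ Finset.univ.erase i, ∑ s : Bool, (F K j s + F L j s) / 2) ≤
      v' σ * M.momFlux F v' K i := by
    unfold momFlux
    simp only [mul_add, Finset.mul_sum]
    have e1 := upwind_energy ((F K i false - F K i true) / 2) (v' σ) (v' (K.face i false))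
    have e2 := upwind_energy ((F L i true - F L i false) / 2) (v' σ) (v' (L.face i true))
    have e3 : ∑ j ∈ Finset.univ.erase i, ∑ s : Bool, (1 / 2 * upwind ((F K j s + F L j s) / 2)
        (v' σ ^ 2) (v' (M.transFace K i j s) ^ 2) + 1 / 2 * v' σ ^ 2 * ((F K j s + F L j s) / 2)) ≤
        ∑ j ∈ Finset.univ.erase i, ∑ s : Bool, v' σ * upwind ((F K j s + F L j s) / 2)
          (v' σ) (v' (M.transFace K i j s)) :=
      Finset.sum_le_sum fun j _ => Finset.sum_le_sum fun s _ => upwind_energy _ _ _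
    simp only [Finset.sum_add_distrib] at e3
    linarith
  rw [hS] at hen
  have h1 := mul_le_mul_of_nonneg_left hen hδt.le
  have h2 : v' σ * (δt * M.momFlux F v' K i) = v' σ * (-(δt * (M.dualVol σ * g)) -
    ((K.vol / 2 * r K + L.vol / 2 * r L) * v σ - (K.vol / 2 * r' K + L.vol / 2 * r' L) * v' σ)) := by
    congr 1; linarith
  have h3 : v' σ ^ 2 * (K.vol * (r K - r' K)) = v' σ ^ 2 * (-(δt * ∑ i, ∑ s, F K i s)) := by
    rw [hm1]
  have h4 : v' σ ^ 2 * (L.vol * (r L - r' L)) = v' σ ^ 2 * (-(δt * ∑ i, ∑ s, F L i s)) := by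
    rw [hm2]
  -- On each half of D_σ one uses r v² - r' v'² - r (v - v')² = 2 v' (r v - r' v') - v'² (r - r'):
  -- the first term is given by the momentum balance `h2`, the second by the mass balances `h3` and
  -- `h4`.
  nlinarith

/-- The energy flux between the two halves of the cell `K`. -/
noncomputable def axialFlux (F : Box d → Fin d → Bool → ℝ) (w : Face d → ℝ) (K : Box d)
    (i : Fin d) : ℝ :=
  upwind ((F K i false - F K i true) / 2) (w (K.face i true)) (w (K.face i false))

open Classical in
/-- The upwind value at the part contained in `K` of the side in direction `j` of the dual cell of
`K.face i r`. -/
noncomputable def transValue (F : Box d → Fin d → Bool → ℝ) (w : Face d → ℝ) (K : Box d)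
    (i : Fin d) (r : Bool) (j : Fin d) (s : Bool) : ℝ :=
  if M.IsInternal K i r ∧ F K j s + F (M.nbr K i r) j s < 0 then w ((M.nbr K j s).face i r)
  else w (K.face i r)

variable {w : Face d → ℝ}

open Classical in
-- The flux between the halves of a cell enters the balances of its two faces with opposite signs,
-- so the weights appear through their difference. External faces have no balance on the right, but
-- there w = 0 and the surplus term on the left is nonpositive.
theorem axialFlux_le (hF : ∀ i, M.Conservative i fun K s => F K i s) (hw : ∀ σ, 0 ≤ w σ)
    (hw0 : ∀ K ∈ M.cells, ∀ i s, ¬ M.IsInternal K i s → w (K.face i s) = 0)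
    {φ : Face d → ℝ} (hφ : ∀ σ ∈ M.faces, 0 ≤ φ σ) (i : Fin d) :
    ∑ K ∈ M.cells, (φ (K.face i true) - φ (K.face i false)) * axialFlux F w K i ≤
      ∑ K ∈ M.cells, if M.IsInternal K i true then φ (K.face i true) *
        (axialFlux F w K i + upwind ((F (M.nbr K i true) i true - F (M.nbr K i true) i false) / 2)
          (w (K.face i true)) (w ((M.nbr K i true).face i true))) else 0 := by
  have h := M.sum_internal i fun K s => sgn s * φ (K.face i s) * axialFlux F w K i
  have e : ∑ K ∈ M.cells, (if M.IsInternal K i true then φ (K.face i true) *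
        (axialFlux F w K i + upwind ((F (M.nbr K i true) i true - F (M.nbr K i true) i false) / 2)
          (w (K.face i true)) (w ((M.nbr K i true).face i true))) else 0) =
      ∑ K ∈ M.cells, if M.IsInternal K i true then sgn true * φ (K.face i true) *
        axialFlux F w K i + sgn false * φ ((M.nbr K i true).face i false) *
          axialFlux F w (M.nbr K i true) i else 0 := by
    refine Finset.sum_congr rfl fun K hK => ?_
    split_ifs with hi
    · have h1 := (M.nbr_spec hi).2
      simp only [Bool.not_true] at h1
      have h2 := upwind_neg ((F (M.nbr K i true) i false - F (M.nbr K i true) i true) / 2)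
        (w ((M.nbr K i true).face i true)) (w ((M.nbr K i true).face i false))
      rw [← h1]
      have h3 : -((F (M.nbr K i true) i false - F (M.nbr K i true) i true) / 2) =
        (F (M.nbr K i true) i true - F (M.nbr K i true) i false) / 2 := by ring
      rw [h3] at h2
      rw [h2]
      simp only [axialFlux, sgn, if_true, if_false, Bool.false_eq_true]
      ring
    · rfl
  rw [e, h]
  refine Finset.sum_le_sum fun K hK => ?_
  have : (φ (K.face i true) - φ (K.face i false)) * axialFlux F w K i =
      ∑ s : Bool, sgn s * φ (K.face i s) * axialFlux F w K i := by
    rw [Fintype.sum_bool]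
    simp only [sgn, if_true, if_false, Bool.false_eq_true]
    ring
  rw [this]
  refine Finset.sum_le_sum fun s _ => ?_
  split_ifs with hi
  · exact le_rfl
  · have h0 := hw0 K hK i s hi
    have h1 := ((hF i) K hK s).2 hi
    have hp := hφ _ (M.face_mem hK i s)
    cases s
    · have := upwind_zero_right_nonneg ((F K i false - F K i true) / 2) (hw (K.face i true))
      simp only [axialFlux, h0, sgn, if_false, Bool.false_eq_true]
      nlinarith [mul_nonneg hp this]
    · have := upwind_zero_left_nonpos ((F K i false - F K i true) / 2) (hw (K.face i false))
      simp only [axialFlux, h0, sgn, if_true]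
      nlinarith [mul_nonneg hp (neg_nonneg.2 this)]

/-- The weights `χ` are attached to the edges orthogonal to the directions `i` and `j`. -/
def EdgeWeight (i j : Fin d) (χ : Box d → Bool → Bool → ℝ) : Prop :=
  ∀ K ∈ M.cells, ∀ r s, 0 ≤ χ K r s ∧
    (M.IsInternal K i r → χ (M.nbr K i r) (!r) s = χ K r s) ∧
    (M.IsInternal K j s → χ (M.nbr K j s) r (!s) = χ K r s)

open Classical in
-- Weights shared by all cells around an edge make the fluxes between adjacent dual cells of
-- internal faces cancel; what remains flows towards faces with w = 0 and can only be outflow.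
-- Subtracting this sum brings edge values of the test function into the balance.
theorem sum_edge_nonneg (hF : ∀ i, M.Conservative i fun K s => F K i s) (hw : ∀ σ, 0 ≤ w σ)
    (hw0 : ∀ K ∈ M.cells, ∀ i s, ¬ M.IsInternal K i s → w (K.face i s) = 0) {i j : Fin d}
    (hij : j ≠ i) {χ : Box d → Bool → Bool → ℝ} (hχ : M.EdgeWeight i j χ) :
    0 ≤ ∑ K ∈ M.cells, ∑ s : Bool, if M.IsInternal K i true then
      χ K true s * upwind ((F K j s + F (M.nbr K i true) j s) / 2)
        (w (K.face i true)) (w (M.transFace K i j s)) else 0 := by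
  set g : Box d → Bool → ℝ := fun K s => χ K true s *
    upwind ((F K j s + F (M.nbr K i true) j s) / 2)
        (w (K.face i true)) (w (M.transFace K i j s)) with hg
  set G : Box d → Bool → ℝ := fun K s => if M.IsInternal K i true ∧ M.IsInternal K j s ∧
    M.IsInternal (M.nbr K j s) i true then g K s else 0 with hG
  -- G keeps the sides between dual cells of two internal faces. There all four cells around the
  -- edge exist, and both dual cells see the same two primal fluxes with opposite signs.
  have hcons : M.Conservative j G := by
    refine fun K hK s => ⟨fun h => ?_, fun h => ?_⟩
    · have hb := M.nbr_nbr hK h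
      have hb' := M.isInternal_nbr hK h
      by_cases hc : M.IsInternal K i true ∧ M.IsInternal (M.nbr K j s) i true
      · have c1 : G K s = g K s := if_pos ⟨hc.1, h, hc.2⟩
        have c2 : G (M.nbr K j s) (!s) = g (M.nbr K j s) (!s) :=
          if_pos ⟨hc.2, hb', by rw [hb]; exact hc.1⟩
        rw [c1, c2]
        have hK' := M.nbr_mem hK j s
        have hL := M.nbr_mem hK i true
        have hL' := M.nbr_mem hK' i true
        have hf := M.nbr_face_eq hK' hij.symm hb' hc.2 (by rw [hb]; exact hc.1)
        rw [hb, Bool.not_not] at hf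
        have hLL : M.nbr (M.nbr (M.nbr K j s) i true) j (!s) = M.nbr K i true :=
          M.nbr_eq hL (by rw [Bool.not_not]; exact hf)
        have hLi : M.IsInternal (M.nbr K i true) j s := ⟨_, hL', hf.symm⟩
        have hLL' : M.nbr (M.nbr K i true) j s = M.nbr (M.nbr K j s) i true :=
          M.nbr_eq hL' hf.symm
        have f1 := ((hF j) K hK s).1 h
        have f2 := ((hF j) _ hL s).1 hLi
        beta_reduce at f1 f2
        rw [hLL'] at f2
        have t1 : M.transFace K i j s = (M.nbr K j s).face i true := if_pos h
        have t2 : M.transFace (M.nbr K j s) i j (!s) = K.face i true := by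
          unfold transFace; rw [if_pos hb', hb]
        simp only [hg]
        rw [t1, t2, f1, f2, ((hχ K hK true s).2.2 h)]
        have : (-F K j s + -F (M.nbr K i true) j s) / 2 =
          -((F K j s + F (M.nbr K i true) j s) / 2) := by ring
        rw [this, upwind_neg]
        ring
      · have c1 : G K s = 0 := if_neg fun h' => hc ⟨h'.1, h'.2.2⟩
        have c2 : G (M.nbr K j s) (!s) = 0 := if_neg fun h' => hc ⟨by
          have := h'.2.2
          rwa [hb] at this, h'.1⟩
        rw [c1, c2, _root_.neg_zero]
    · exact if_neg fun h' => h h'.2.1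
  refine hcons.sum_eq_zero.ge.trans (Finset.sum_le_sum fun K hK => Finset.sum_le_sum fun s _ => ?_)
  by_cases hi : M.IsInternal K i true
  · rw [if_pos hi]
    by_cases hc : M.IsInternal K j s ∧ M.IsInternal (M.nbr K j s) i true
    · simp only [hG]
      rw [if_pos ⟨hi, hc⟩]
    · have hz : G K s = 0 := if_neg fun h => hc h.2
      rw [hz]
      -- Sides at the boundary, including re-entrant corners where only one of the two cells K, L
      -- continues across the side: either the value beyond is zero or both primal fluxes vanish.
      refine mul_nonneg (hχ K hK true s).1 ?_
      by_cases hj : M.IsInternal K j s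
      · have h0 := hw0 _ (M.nbr_mem hK j s) i true fun h => hc ⟨hj, h⟩
        have t1 : M.transFace K i j s = (M.nbr K j s).face i true := if_pos hj
        rw [t1, h0]
        exact upwind_zero_right_nonneg _ (hw _)
      · have hL := M.nbr_mem hK i true
        have t1 : M.transFace K i j s = (M.nbr (M.nbr K i true) j s).face i false := if_neg hj
        by_cases hj' : M.IsInternal (M.nbr K i true) j s
        · have h0 := hw0 _ (M.nbr_mem hL j s) i false fun h =>
            hj (M.isInternal_of_corner hK hij hi hj' h)
          rw [t1, h0]
          exact upwind_zero_right_nonneg _ (hw _)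
        · have f1 := ((hF j) K hK s).2 hj
          have f2 := ((hF j) _ hL s).2 hj'
          beta_reduce at f1 f2
          rw [f1, f2]
          simp [upwind]
  · rw [if_neg hi]
    simp only [hG]
    rw [if_neg fun h => hi h.1]

open Classical in
-- Each transverse dual flux is split into the parts carried by the two cells of the face, so that
-- afterwards every term is attached to one cell. The edge weights are inserted at the cost of
-- `sum_edge_nonneg`.
theorem transFlux_le (hF : ∀ i, M.Conservative i fun K s => F K i s) (hw : ∀ σ, 0 ≤ w σ)
    (hw0 : ∀ K ∈ M.cells, ∀ i s, ¬ M.IsInternal K i s → w (K.face i s) = 0) {i j : Fin d}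
    (hij : j ≠ i) {χ : Box d → Bool → Bool → ℝ} (hχ : M.EdgeWeight i j χ) (φ : Face d → ℝ) :
    ∑ K ∈ M.cells, ∑ r : Bool, ∑ s : Bool, (φ (K.face i r) - χ K r s) *
      (1 / 2 * F K j s * M.transValue F w K i r j s) ≤
    ∑ K ∈ M.cells, if M.IsInternal K i true then φ (K.face i true) *
      ∑ s : Bool, upwind ((F K j s + F (M.nbr K i true) j s) / 2)
        (w (K.face i true)) (w (M.transFace K i j s)) else 0 := by
  set f : Box d → Bool → ℝ := fun K r => ∑ s : Bool, (φ (K.face i r) - χ K r s) *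
      (1 / 2 * F K j s * M.transValue F w K i r j s) with hf
  have h1 : ∑ K ∈ M.cells, ∑ r : Bool, f K r =
      ∑ K ∈ M.cells, ∑ r : Bool, if M.IsInternal K i r then f K r else 0 := by
    refine Finset.sum_congr rfl fun K hK => Finset.sum_congr rfl fun r _ => ?_
    split_ifs with hi
    · rfl
    · have : ∀ s, M.transValue F w K i r j s = 0 := fun s => by
        unfold transValue
        rw [if_neg fun h => hi h.1, hw0 K hK i r hi]
      simp [hf, this]
  have h2 := M.sum_internal i f
  have h3 := M.sum_edge_nonneg hF hw hw0 hij hχ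
  change ∑ K ∈ M.cells, ∑ r : Bool, f K r ≤ _
  rw [h1, ← h2]
  refine (le_add_of_nonneg_right h3).trans_eq ?_
  rw [← Finset.sum_add_distrib]
  refine Finset.sum_congr rfl fun K hK => ?_
  split_ifs with hi
  · simp only [hf]
    rw [Finset.mul_sum, ← Finset.sum_add_distrib, ← Finset.sum_add_distrib]
    refine Finset.sum_congr rfl fun s _ => ?_
    have hL := M.nbr_mem hK i true
    have hs := (M.nbr_spec hi).2
    have hb := M.nbr_nbr hK hi
    have hb' := M.isInternal_nbr hK hi
    simp only [Bool.not_true] at hs hb hb'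
    have hc := (hχ K hK true s).2.1 hi
    simp only [Bool.not_true] at hc
    -- Both parts follow the sign of the total flux, not of their own. The upwind faces seen from K
    -- and from L coincide when all four cells exist; otherwise the part with a different value
    -- carries no flux.
    have key : 1 / 2 * F K j s * M.transValue F w K i true j s +
        1 / 2 * F (M.nbr K i true) j s * M.transValue F w (M.nbr K i true) i false j s =
        upwind ((F K j s + F (M.nbr K i true) j s) / 2)
        (w (K.face i true)) (w (M.transFace K i j s)) := by
      unfold transValue upwind
      rw [hb, hs]
      by_cases hsgn : F K j s + F (M.nbr K i true) j s < 0
      · rw [if_pos ⟨hi, hsgn⟩, if_pos ⟨hb', by linarith⟩, if_neg (by linarith)]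
        by_cases hj : M.IsInternal K j s
        · have t1 : M.transFace K i j s = (M.nbr K j s).face i true := if_pos hj
          rw [t1]
          by_cases hj' : M.IsInternal (M.nbr K i true) j s
          · have hq := M.nbr_face_eq hK hij hi hj hj'
            simp only [Bool.not_true] at hq
            rw [hq]
            ring
          · have f2 := ((hF j) _ hL s).2 hj'
            beta_reduce at f2
            rw [f2]
            ring
        · have t1 : M.transFace K i j s = (M.nbr (M.nbr K i true) j s).face i false := if_neg hj
          have f1 := ((hF j) K hK s).2 hj
          beta_reduce at f1
          rw [t1, f1]
          ring
      · rw [if_neg fun h => hsgn h.2, if_neg fun h => hsgn (by linarith [h.2]),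
          if_pos (by linarith)]
        ring
    rw [← key, hc, hs]
    ring
  · simp

end Kinetic
end Mesh
end MAC

/-! ### The total energy inequality for one time step. -/

namespace MAC
variable {d : ℕ} {Ω : Set (Fin d → ℝ)}
namespace Mesh
variable (M : Mesh d Ω)

section Step

/-- The contribution of the cell `K` to the entropy fluxes tested with the weights `φ` of the cells,
`φ'` of the faces and `χ` of the edges. -/
noncomputable def stepFlux (γ ε δt : ℝ) (η : Face d → ℝ) (r : Box d → ℝ) (v : Face d → ℝ)
    (φ : Box d → ℝ) (φ' : Face d → ℝ) (χ : Fin d → Fin d → Box d → Bool → Bool → ℝ)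
    (K : Box d) : ℝ :=
  1 / ε ^ 2 * ∑ i, ∑ s : Bool, (φ K - φ' (K.face i s)) * ((K.face i s).area *
      (relEnergy γ (r K) * M.vPlus γ ε δt η r v K i s +
        relEnergy γ (r (M.nbr K i s)) * M.vMinus γ ε δt η r v K i s +
        (pressure γ (r K) - 1) * (M.vPlus γ ε δt η r v K i s + M.vMinus γ ε δt η r v K i s))) +
  ∑ i, (φ' (K.face i true) - φ' (K.face i false)) *
    (1 / 2 * axialFlux (M.massFlux γ ε δt η r v) (fun σ => v σ ^ 2) K i) +
  ∑ i, ∑ j ∈ Finset.univ.erase i, ∑ a : Bool, ∑ s : Bool, (φ' (K.face i a) - χ i j K a s) *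
    (1 / 4 * M.massFlux γ ε δt η r v K j s *
      M.transValue (M.massFlux γ ε δt η r v) (fun σ => v σ ^ 2) K i a j s)

variable {γ ε δt : ℝ} {η : Face d → ℝ} {r r' : Box d → ℝ} {v v' : Face d → ℝ}
  {φ : Box d → ℝ} {φ' : Face d → ℝ} {χ : Fin d → Fin d → Box d → Bool → Bool → ℝ}

/-- The cell weight is split into its difference from the face weight and the face weight. With face
weights the flux of Π_γ is conservative and disappears, the shift dissipates, and only the work of
the pressure against the unshifted velocity is left. -/
theorem internal_energy_step (hγ : 1 ≤ γ) (hδt : 0 < δt) (hη : ∀ σ ∈ M.faces, 0 ≤ η σ)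
    (hr : ∀ K ∈ M.cells, 0 < r K) (hr' : ∀ K ∈ M.cells, 0 < r' K)
    (hv' : ∀ K ∈ M.cells, ∀ i s, ¬ M.IsInternal K i s → v' (K.face i s) = 0)
    (hmass : ∀ K ∈ M.cells,
      (r K - r' K) / δt + (∑ i, ∑ s, M.massFlux γ ε δt η r v' K i s) / K.vol = 0)
    (hφ : ∀ K ∈ M.cells, 0 ≤ φ K) (hφ' : ∀ σ ∈ M.faces, 0 ≤ φ' σ) :
    ∑ K ∈ M.cells, φ K * (K.vol * (relEnergy γ (r K) - relEnergy γ (r' K))) +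
      δt * (∑ K ∈ M.cells, ∑ i, ∑ s : Bool, (φ K - φ' (K.face i s)) * ((K.face i s).area *
        (relEnergy γ (r K) * M.vPlus γ ε δt η r v' K i s +
          relEnergy γ (r (M.nbr K i s)) * M.vMinus γ ε δt η r v' K i s +
          (pressure γ (r K) - 1) *
            (M.vPlus γ ε δt η r v' K i s + M.vMinus γ ε δt η r v' K i s))) +
        ∑ i, ∑ K ∈ M.cells, ∑ s : Bool, φ' (K.face i s) * ((K.face i s).area *
          ((pressure γ (r K) - 1) * (v' (K.face i s) * sgn s)))) ≤ 0 := by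
  have h1 : ∑ K ∈ M.cells, φ K * (K.vol * (relEnergy γ (r K) - relEnergy γ (r' K)) +
      δt * ∑ i, ∑ s, (K.face i s).area *
        (relEnergy γ (r K) * M.vPlus γ ε δt η r v' K i s +
          relEnergy γ (r (M.nbr K i s)) * M.vMinus γ ε δt η r v' K i s +
          (pressure γ (r K) - 1) *
            (M.vPlus γ ε δt η r v' K i s + M.vMinus γ ε δt η r v' K i s))) ≤ 0 :=
    Finset.sum_nonpos fun K hK => mul_nonpos_of_nonneg_of_nonpos (hφ K hK)
      (M.internal_energy_cell hγ hδt hK hr hr' (hmass K hK))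
  refine le_trans ?_ h1
  simp only [mul_add (φ _), Finset.sum_add_distrib]
  refine add_le_add le_rfl ?_
  have h2 : ∑ K ∈ M.cells, φ K * (δt * ∑ i, ∑ s, (K.face i s).area *
        (relEnergy γ (r K) * M.vPlus γ ε δt η r v' K i s +
          relEnergy γ (r (M.nbr K i s)) * M.vMinus γ ε δt η r v' K i s +
          (pressure γ (r K) - 1) *
            (M.vPlus γ ε δt η r v' K i s + M.vMinus γ ε δt η r v' K i s))) =
      δt * (∑ K ∈ M.cells, ∑ i, ∑ s : Bool, φ K * ((K.face i s).area *
        (relEnergy γ (r K) * M.vPlus γ ε δt η r v' K i s +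
          relEnergy γ (r (M.nbr K i s)) * M.vMinus γ ε δt η r v' K i s +
          (pressure γ (r K) - 1) *
            (M.vPlus γ ε δt η r v' K i s + M.vMinus γ ε δt η r v' K i s)))) := by
    rw [Finset.mul_sum]
    refine Finset.sum_congr rfl fun K _ => ?_
    rw [mul_left_comm, Finset.mul_sum]
    simp only [Finset.mul_sum]
  rw [h2]
  refine mul_le_mul_of_nonneg_left ?_ hδt.le
  rw [Finset.sum_comm (s := (Finset.univ : Finset (Fin d))), ← Finset.sum_add_distrib]
  simp only [← Finset.sum_add_distrib]
  rw [← sub_nonneg, ← Finset.sum_sub_distrib]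
  simp only [← Finset.sum_sub_distrib]
  rw [Finset.sum_comm]
  refine Finset.sum_nonneg fun i _ => ?_
  have h3 := (M.conservative_upwind (γ := γ) (ε := ε) (δt := δt) (η := η) (ρ := r) hv' i
    (fun K => relEnergy γ (r K)) φ').sum_eq_zero
  have h4 := M.sum_shift_nonpos (γ := γ) (ε := ε) (ρ := r) hδt hη hφ' i
  refine (sub_nonneg.2 (h4.trans h3.ge)).trans_eq ?_
  rw [← Finset.sum_sub_distrib]
  refine Finset.sum_congr rfl fun K _ => ?_
  rw [← Finset.sum_sub_distrib]
  refine Finset.sum_congr rfl fun s _ => ?_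
  rw [M.vPlus_add_vMinus]
  ring

open Classical in
-- Sums the local balances over the internal faces and redistributes them to the cells. A cell holds
-- half of its volume for each of its faces, and the kinetic energy carries another 1/2, whence the
-- factors 1/4.
theorem kinetic_energy_step (hδt : 0 < δt) {F : Box d → Fin d → Bool → ℝ}
    (hF : ∀ i, M.Conservative i fun K s => F K i s) {p : Box d → ℝ}
    (hv : ∀ K ∈ M.cells, ∀ i s, ¬ M.IsInternal K i s → v (K.face i s) = 0)
    (hv' : ∀ K ∈ M.cells, ∀ i s, ¬ M.IsInternal K i s → v' (K.face i s) = 0)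
    (hmass : ∀ K ∈ M.cells, (r K - r' K) / δt + (∑ i, ∑ s, F K i s) / K.vol = 0)
    (hmom : ∀ K ∈ M.cells, ∀ i, M.IsInternal K i true →
      (M.dualAvg r (K.face i true) * v (K.face i true) -
        M.dualAvg r' (K.face i true) * v' (K.face i true)) / δt +
      M.momFlux F v' K i / M.dualVol (K.face i true) + 1 / ε ^ 2 * M.grad p K i true = 0)
    (hφ' : ∀ σ ∈ M.faces, 0 ≤ φ' σ)
    (hχ : ∀ i j, j ≠ i → M.EdgeWeight i j (χ i j)) (i : Fin d) :
    ∑ K ∈ M.cells, ∑ s : Bool, φ' (K.face i s) * (K.vol / 4 *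
      (r K * v (K.face i s) ^ 2 - r' K * v' (K.face i s) ^ 2)) +
    δt * (∑ K ∈ M.cells, (φ' (K.face i true) - φ' (K.face i false)) *
        (1 / 2 * axialFlux F (fun σ => v' σ ^ 2) K i) +
      ∑ j ∈ Finset.univ.erase i, ∑ K ∈ M.cells, ∑ a : Bool, ∑ s : Bool,
        (φ' (K.face i a) - χ i j K a s) *
          (1 / 4 * F K j s * M.transValue F (fun σ => v' σ ^ 2) K i a j s) -
      1 / ε ^ 2 * ∑ K ∈ M.cells, ∑ s : Bool, φ' (K.face i s) * ((K.face i s).area *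
          ((p K - 1) * (v' (K.face i s) * sgn s)))) ≤
    ∑ K ∈ M.cells, ∑ s : Bool, φ' (K.face i s) * (K.vol / 4 *
      (r K * (v (K.face i s) - v' (K.face i s)) ^ 2)) := by
  set w : Face d → ℝ := fun σ => v' σ ^ 2 with hw
  have hw0 : ∀ K ∈ M.cells, ∀ i s, ¬ M.IsInternal K i s → w (K.face i s) = 0 :=
    fun K hK i s h => by simp [hw, hv' K hK i s h]
  have hwn : ∀ σ, 0 ≤ w σ := fun σ => sq_nonneg _
  have hint : ∀ f : Box d → Bool → ℝ, (∀ K ∈ M.cells, ∀ s, ¬ M.IsInternal K i s → f K s = 0) →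
      ∑ K ∈ M.cells, ∑ s : Bool, f K s = ∑ K ∈ M.cells,
        if M.IsInternal K i true then f K true + f (M.nbr K i true) false else 0 := by
    intro f hf
    rw [M.sum_internal]
    refine Finset.sum_congr rfl fun K hK => Finset.sum_congr rfl fun s _ => ?_
    split_ifs with h
    · rfl
    · exact hf K hK s h
  have hext : ∀ K ∈ M.cells, ∀ s, ¬ M.IsInternal K i s → v (K.face i s) = 0 ∧
    v' (K.face i s) = 0 := fun K hK s h => ⟨hv K hK i s h, hv' K hK i s h⟩
  rw [hint (fun K s => φ' (K.face i s) * (K.vol / 4 *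
      (r K * v (K.face i s) ^ 2 - r' K * v' (K.face i s) ^ 2)))
      fun K hK s h => by simp [hext K hK s h],
    hint (fun K s => φ' (K.face i s) * (K.vol / 4 *
      (r K * (v (K.face i s) - v' (K.face i s)) ^ 2))) fun K hK s h => by simp [hext K hK s h],
    hint (fun K s => φ' (K.face i s) * ((K.face i s).area *
          ((p K - 1) * (v' (K.face i s) * sgn s)))) fun K hK s h => by simp [hext K hK s h]]
  have hax := M.axialFlux_le hF hwn hw0 hφ' i
  have htr := Finset.sum_le_sum fun j (hj : j ∈ Finset.univ.erase i) =>
    M.transFlux_le hF hwn hw0 (Finset.ne_of_mem_erase hj) (hχ i j (Finset.ne_of_mem_erase hj)) φ'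
  rw [Finset.sum_comm (s := Finset.univ.erase i) (t := M.cells) (f := fun j K => if
    M.IsInternal K i true then φ' (K.face i true) *
      ∑ s : Bool, upwind ((F K j s + F (M.nbr K i true) j s) / 2)
        (w (K.face i true)) (w (M.transFace K i j s)) else 0)] at htr
  have e1 : ∑ K ∈ M.cells, (φ' (K.face i true) - φ' (K.face i false)) *
        (1 / 2 * axialFlux F w K i) = 1 / 2 * ∑ K ∈ M.cells,
        (φ' (K.face i true) - φ' (K.face i false)) * axialFlux F w K i := by
    rw [Finset.mul_sum]
    exact Finset.sum_congr rfl fun K _ => by ring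
  have e2 : ∑ j ∈ Finset.univ.erase i, ∑ K ∈ M.cells, ∑ a : Bool, ∑ s : Bool,
        (φ' (K.face i a) - χ i j K a s) * (1 / 4 * F K j s * M.transValue F w K i a j s) =
      1 / 2 * ∑ j ∈ Finset.univ.erase i, ∑ K ∈ M.cells, ∑ a : Bool, ∑ s : Bool,
        (φ' (K.face i a) - χ i j K a s) * (1 / 2 * F K j s * M.transValue F w K i a j s) := by
    simp only [Finset.mul_sum]
    refine Finset.sum_congr rfl fun j _ => Finset.sum_congr rfl fun K _ =>
      Finset.sum_congr rfl fun a _ => Finset.sum_congr rfl fun s _ => by ring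
  rw [e1, e2]
  have hmain : ∑ K ∈ M.cells, (if M.IsInternal K i true then
        φ' (K.face i true) * (K.vol / 4 * (r K * v (K.face i true) ^ 2 -
          r' K * v' (K.face i true) ^ 2)) +
        φ' ((M.nbr K i true).face i false) * ((M.nbr K i true).vol / 4 *
          (r (M.nbr K i true) * v ((M.nbr K i true).face i false) ^ 2 -
          r' (M.nbr K i true) * v' ((M.nbr K i true).face i false) ^ 2)) else 0) +
      δt * (1 / 2 * ∑ K ∈ M.cells, (if M.IsInternal K i true then φ' (K.face i true) *
        (axialFlux F w K i + upwind ((F (M.nbr K i true) i true - F (M.nbr K i true) i false) / 2)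
          (w (K.face i true)) (w ((M.nbr K i true).face i true))) else 0) +
        1 / 2 * (∑ K ∈ M.cells, ∑ j ∈ Finset.univ.erase i, if M.IsInternal K i true then
          φ' (K.face i true) * ∑ s : Bool, upwind ((F K j s + F (M.nbr K i true) j s) / 2)
            (w (K.face i true)) (w (M.transFace K i j s)) else 0) -
        1 / ε ^ 2 * ∑ K ∈ M.cells, (if M.IsInternal K i true then
          φ' (K.face i true) * ((K.face i true).area *
            ((p K - 1) * (v' (K.face i true) * sgn true))) +
          φ' ((M.nbr K i true).face i false) * (((M.nbr K i true).face i false).area *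
            ((p (M.nbr K i true) - 1) * (v' ((M.nbr K i true).face i false) * sgn false)))
          else 0)) ≤
      ∑ K ∈ M.cells, (if M.IsInternal K i true then
        φ' (K.face i true) * (K.vol / 4 * (r K * (v (K.face i true) - v' (K.face i true)) ^ 2)) +
        φ' ((M.nbr K i true).face i false) * ((M.nbr K i true).vol / 4 *
          (r (M.nbr K i true) * (v ((M.nbr K i true).face i false) -
            v' ((M.nbr K i true).face i false)) ^ 2)) else 0) := by
    rw [Finset.mul_sum, Finset.mul_sum, Finset.mul_sum, ← Finset.sum_add_distrib,
      ← Finset.sum_sub_distrib, Finset.mul_sum, ← Finset.sum_add_distrib]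
    refine Finset.sum_le_sum fun K hK => ?_
    by_cases hi : M.IsInternal K i true
    · simp only [if_pos hi]
      have hs := (M.nbr_spec hi).2
      simp only [Bool.not_true] at hs
      rw [hs]
      have h1 := mul_le_mul_of_nonneg_left (M.kinetic_energy_face hδt hK hi hF hmass (hmom K hK i hi))
        (hφ' _ (M.face_mem hK i true))
      -- Discrete gradient and divergence are dual to each other. The two cells of the face see
      -- opposite normals, so the constant 1 subtracted from the pressure cancels.
      have h2 : M.dualVol (K.face i true) * (1 / ε ^ 2 * M.grad p K i true) =
          1 / ε ^ 2 * ((K.face i true).area * (p (M.nbr K i true) - p K)) := by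
        have := (M.dualVol_pos hK i true).ne'
        unfold grad
        simp only [sgn, if_true]
        field_simp
      rw [h2] at h1
      have h3 : M.momFlux F w K i = axialFlux F w K i +
          upwind ((F (M.nbr K i true) i true - F (M.nbr K i true) i false) / 2)
            (w (K.face i true)) (w ((M.nbr K i true).face i true)) +
          ∑ j ∈ Finset.univ.erase i, ∑ s : Bool,
            upwind ((F K j s + F (M.nbr K i true) j s) / 2)
              (w (K.face i true)) (w (M.transFace K i j s)) := rfl
      rw [h3] at h1
      rw [← Finset.mul_sum]
      simp only [sgn, if_true, if_false, Bool.false_eq_true]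
      linarith
    · simp only [if_neg hi]
      simp
  have hmono := mul_le_mul_of_nonneg_left (add_le_add hax htr) hδt.le
  linarith

/-- After multiplication of the internal energy by 1/ε², the work of the pressure occurs in both
balances with opposite signs and the same face weights, and it cancels exactly. -/
theorem sum_energy_step (hγ : 1 ≤ γ) (hδt : 0 < δt) (hη : ∀ σ ∈ M.faces, 0 ≤ η σ)
    (hr : ∀ K ∈ M.cells, 0 < r K) (hr' : ∀ K ∈ M.cells, 0 < r' K)
    (hv : ∀ K ∈ M.cells, ∀ i s, ¬ M.IsInternal K i s → v (K.face i s) = 0)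
    (hv' : ∀ K ∈ M.cells, ∀ i s, ¬ M.IsInternal K i s → v' (K.face i s) = 0)
    (hmass : ∀ K ∈ M.cells,
      (r K - r' K) / δt + (∑ i, ∑ s, M.massFlux γ ε δt η r v' K i s) / K.vol = 0)
    (hmom : ∀ K ∈ M.cells, ∀ i, M.IsInternal K i true →
      (M.dualAvg r (K.face i true) * v (K.face i true) -
        M.dualAvg r' (K.face i true) * v' (K.face i true)) / δt +
      M.momFlux (M.massFlux γ ε δt η r v') v' K i / M.dualVol (K.face i true) +
        1 / ε ^ 2 * M.grad (fun L => pressure γ (r L)) K i true = 0)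
    (hφ : ∀ K ∈ M.cells, 0 ≤ φ K) (hφ' : ∀ σ ∈ M.faces, 0 ≤ φ' σ)
    (hχ : ∀ i j, j ≠ i → M.EdgeWeight i j (χ i j)) :
    ∑ K ∈ M.cells, (1 / ε ^ 2 * (φ K * (K.vol * (relEnergy γ (r K) - relEnergy γ (r' K)))) +
      ∑ i, ∑ s : Bool, φ' (K.face i s) * (K.vol / 4 *
        (r K * v (K.face i s) ^ 2 - r' K * v' (K.face i s) ^ 2)) +
      δt * M.stepFlux γ ε δt η r v' φ φ' χ K) ≤
    ∑ K ∈ M.cells, ∑ i, ∑ s : Bool, φ' (K.face i s) * (K.vol / 4 *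
      (r K * (v (K.face i s) - v' (K.face i s)) ^ 2)) := by
  have h1 := mul_le_mul_of_nonneg_left
    (M.internal_energy_step hγ hδt hη hr hr' hv' hmass hφ hφ') (by positivity : 0 ≤ 1 / ε ^ 2)
  have h2 := Finset.sum_le_sum fun i (_ : i ∈ (Finset.univ : Finset (Fin d))) =>
    M.kinetic_energy_step hδt (M.conservative_massFlux hv') hv hv' hmass hmom hφ' hχ i
  rw [Finset.sum_add_distrib, ← Finset.mul_sum, Finset.sum_sub_distrib, Finset.sum_add_distrib,
    ← Finset.mul_sum] at h2
  have hc : ∀ f : Box d → Fin d → ℝ,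
    ∑ K ∈ M.cells, ∑ i, f K i = ∑ i, ∑ K ∈ M.cells, f K i := fun f => Finset.sum_comm
  have hc' : ∀ (i : Fin d) (f : Box d → Fin d → ℝ), ∑ K ∈ M.cells, ∑ j ∈ Finset.univ.erase i, f K j =
    ∑ j ∈ Finset.univ.erase i, ∑ K ∈ M.cells, f K j := fun i f => Finset.sum_comm
  rw [Finset.sum_add_distrib, Finset.sum_add_distrib, ← Finset.mul_sum, ← Finset.mul_sum]
  simp only [stepFlux]
  rw [Finset.sum_add_distrib, Finset.sum_add_distrib, ← Finset.mul_sum]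
  simp only [hc, hc'] at h1 ⊢
  linarith

end Step
end Mesh
end MAC

/-! ### Cells and dual cells as sets; partitions of space and of space-time. -/

namespace MAC

variable {d : ℕ} {Ω : Set (Fin d → ℝ)}

theorem Box.isOpen_openSet (K : Box d) : IsOpen K.openSet :=
  isOpen_set_pi Set.finite_univ fun _ _ => isOpen_Ioo

theorem Box.openSet_subset_toSet (K : Box d) : K.openSet ⊆ K.toSet := fun _ hx =>
  ⟨fun i => (hx i trivial).1.le, fun i => (hx i trivial).2.le⟩

theorem Box.openSet_ae_eq (K : Box d) : K.openSet =ᵐ[volume] K.toSet :=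
  Measure.univ_pi_Ioo_ae_eq_Icc

theorem Box.volume_openSet {K : Box d} (h : ∀ i, K.lo i < K.hi i) :
    volume.real K.openSet = K.vol :=
  Real.volume_pi_Ioo_toReal fun i => (h i).le

theorem Box.mem_toSet_iff {K : Box d} {x : Fin d → ℝ} :
    x ∈ K.toSet ↔ ∀ i, K.lo i ≤ x i ∧ x i ≤ K.hi i :=
  ⟨fun h i => ⟨h.1 i, h.2 i⟩, fun h => ⟨fun i => (h i).1, fun i => (h i).2⟩⟩

/-- The half of `K` adjacent to `K.face i s`, as a box. -/
noncomputable def Box.halfBox (K : Box d) (i : Fin d) (s : Bool) : Box d where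
  lo := if s then Function.update K.lo i ((K.lo i + K.hi i) / 2) else K.lo
  hi := if s then K.hi else Function.update K.hi i ((K.lo i + K.hi i) / 2)

theorem Box.halfBox_lt {K : Box d} (h : ∀ i, K.lo i < K.hi i) (i : Fin d) (s : Bool) (j : Fin d) :
    (K.halfBox i s).lo j < (K.halfBox i s).hi j := by
  have hi := h i
  have hj := h j
  by_cases hij : j = i
  · subst hij
    cases s <;> simp [halfBox] <;> linarith
  · cases s <;> simp [halfBox, hij, hj]

theorem Box.vol_halfBox (K : Box d) (i : Fin d) (s : Bool) :
    (K.halfBox i s).vol = K.vol / 2 := by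
  unfold vol
  rw [← Finset.mul_prod_erase Finset.univ (fun j => (K.halfBox i s).hi j - (K.halfBox i s).lo j)
      (Finset.mem_univ i),
    ← Finset.mul_prod_erase Finset.univ (fun i => K.hi i - K.lo i) (Finset.mem_univ i)]
  have : ∏ j ∈ Finset.univ.erase i, ((K.halfBox i s).hi j - (K.halfBox i s).lo j) =
      ∏ j ∈ Finset.univ.erase i, (K.hi j - K.lo j) := by
    refine Finset.prod_congr rfl fun j hj => ?_
    have hj := Finset.ne_of_mem_erase hj
    cases s <;> simp [halfBox, hj]
  rw [this]
  cases s <;> simp [halfBox] <;> ring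

theorem Box.halfBox_openSet_subset {K : Box d} (h : ∀ i, K.lo i < K.hi i) (i : Fin d) (s : Bool) :
    (K.halfBox i s).openSet ⊆ K.openSet := by
  intro x hx j _
  have := hx j trivial
  have hi := h i
  by_cases hij : j = i
  · subst hij
    cases s <;> simp [halfBox] at this ⊢ <;> constructor <;> linarith [this.1, this.2]
  · cases s <;> simpa [halfBox, hij] using this

theorem Box.mem_half_iff {K : Box d} (h : ∀ i, K.lo i < K.hi i) {i : Fin d} {s : Bool}
    {x : Fin d → ℝ} (hx : x ∈ (K.halfBox i s).openSet) (t : Bool) :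
    x ∈ K.half i t ↔ t = s := by
  have h1 := K.openSet_subset_toSet (Box.halfBox_openSet_subset h i s hx)
  have h2 := hx i trivial
  constructor
  · rintro ⟨-, h3⟩
    cases s <;> cases t <;> simp [halfBox] at h2 h3 ⊢ <;> linarith [h2.1, h2.2]
  · rintro rfl
    refine ⟨h1, ?_⟩
    cases t <;> simp [halfBox] at h2 ⊢ <;> linarith [h2.1, h2.2]

theorem Box.len_le_diam (K : Box d) (i : Fin d) : K.len i ≤ K.diam := by
  refine Real.le_sqrt_of_sq_le ?_
  exact Finset.single_le_sum (f := fun i => (K.hi i - K.lo i) ^ 2) (fun _ _ => sq_nonneg _)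
    (Finset.mem_univ i)

theorem Box.area_le (K : Box d) (hK : ∀ i, K.lo i < K.hi i) (i : Fin d) (s : Bool) :
    (K.face i s).area ≤ K.diam ^ (d - 1) := by
  rw [K.area_face]
  have h1 : (Finset.univ.erase i).card = d - 1 := by
    rw [Finset.card_erase_of_mem (Finset.mem_univ i), Finset.card_univ, Fintype.card_fin]
  rw [← h1]
  calc _ ≤ ∏ j ∈ Finset.univ.erase i, K.diam :=
        Finset.prod_le_prod (fun j _ => (sub_pos.2 (hK j)).le) fun j _ => K.len_le_diam j
    _ = _ := Finset.prod_const _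

namespace Mesh

variable (M : Mesh d Ω)

/-- A nondegenerate closed box that meets an open one also meets it in an open set, so interior
points of a cell lie in no other closed cell. -/
theorem eq_of_mem {K L : Box d} (hK : K ∈ M.cells) (hL : L ∈ M.cells) {x : Fin d → ℝ}
    (hxK : x ∈ K.openSet) (hxL : x ∈ L.toSet) : L = K := by
  refine M.eq_of_overlap hL hK fun i => ?_
  have h1 := hxK i trivial
  have h2 := Box.mem_toSet_iff.1 hxL i
  have h3 := M.lo_lt_hi K hK i
  have h4 := M.lo_lt_hi L hL i
  rw [max_lt_iff, lt_min_iff, lt_min_iff]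
  exact ⟨⟨h4, by linarith [h1.2]⟩, by linarith [h1.1], h3⟩

theorem toSet_subset {K : Box d} (hK : K ∈ M.cells) : K.toSet ⊆ closure Ω := by
  rw [← M.union_eq]
  exact fun x hx => Set.mem_biUnion hK hx

theorem ae_mem_openSet : ∀ᵐ x : Fin d → ℝ, x ∈ closure Ω → ∃ K ∈ M.cells, x ∈ K.openSet := by
  have : ∀ᵐ x : Fin d → ℝ, ∀ K ∈ M.cells, (x ∈ K.openSet ↔ x ∈ K.toSet) :=
    (ae_ball_iff M.cells.countable_toSet).2 fun K _ => K.openSet_ae_eq.mem_iff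
  filter_upwards [this] with x hx hxΩ
  rw [← M.union_eq] at hxΩ
  obtain ⟨K, hK, hxK⟩ := Set.mem_iUnion₂.1 hxΩ
  exact ⟨K, hK, (hx K hK).2 hxK⟩

theorem measurableSet_dualCell (σ : Face d) : MeasurableSet (M.dualCell σ) := by
  have h1 : M.dualCell σ = ⋃ K ∈ M.cells, ⋃ s : Bool, {x | K.face σ.dir s = σ ∧
      x ∈ K.half σ.dir s} := by
    ext x
    simp [dualCell]
  rw [h1]
  refine Finset.measurableSet_biUnion _ fun K _ => MeasurableSet.iUnion fun s => ?_
  refine (MeasurableSet.const _).inter ((measurableSet_Icc (a := K.lo) (b := K.hi)).inter ?_)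
  cases s
  · exact measurableSet_le (measurable_pi_apply _) measurable_const
  · exact measurableSet_le measurable_const (measurable_pi_apply _)

theorem diam_le_size {K : Box d} (hK : K ∈ M.cells) : K.diam ≤ M.size :=
  le_csSup (M.cells.finite_toSet.image _).bddAbove ⟨K, hK, rfl⟩

/-- The distance on `Fin d → ℝ` is that of the maximum norm, which the Euclidean diameter dominates.
-/
theorem dist_le {K : Box d} (hK : K ∈ M.cells) {x y : Fin d → ℝ} (hx : x ∈ K.toSet)
    (hy : y ∈ K.toSet) : dist x y ≤ M.size := by
  have h0 : 0 ≤ M.size := (Real.sqrt_nonneg _).trans (M.diam_le_size hK)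
  refine (dist_pi_le_iff h0).2 fun i => ?_
  have h1 := Box.mem_toSet_iff.1 hx i
  have h2 := Box.mem_toSet_iff.1 hy i
  have h3 := (K.len_le_diam i).trans (M.diam_le_size hK)
  unfold Box.len at h3
  rw [Real.dist_eq, abs_le]
  constructor <;> linarith

theorem dist_nbr_le {K : Box d} (hK : K ∈ M.cells) {i : Fin d} {s : Bool}
    (h : M.IsInternal K i s) {x y : Fin d → ℝ} (hx : x ∈ K.toSet)
    (hy : y ∈ (M.nbr K i s).toSet) : dist x y ≤ 2 * M.size := by
  have hc := M.nbr_coords h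
  -- A vertex of the common face, which belongs to both cells.
  set z : Fin d → ℝ := Function.update K.lo i (K.side i s) with hz
  have hzK : z ∈ K.toSet := Box.mem_toSet_iff.2 fun j => by
    have := M.lo_lt_hi K hK j
    by_cases hj : j = i
    · subst hj
      cases s <;> simp [hz, Box.side] <;> linarith
    · simp [hz, hj, this.le]
  have hzL : z ∈ (M.nbr K i s).toSet := Box.mem_toSet_iff.2 fun j => by
    have := M.lo_lt_hi _ (M.nbr_mem hK i s) j
    by_cases hj : j = i
    · subst hj
      rw [hz, ← hc.1]
      cases s <;> simp [Box.side] <;> linarith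
    · have hj' := hc.2 j hj
      rw [hj'.1, hj'.2] at this ⊢
      simp [hz, hj, this.le]
  linarith [dist_triangle x z y, M.dist_le hK hx hzK, M.dist_le (M.nbr_mem hK i s) hzL hy]

end Mesh

/-- A sequence of space-time discretisations of `(0,T) × Ω` with step sizes that tend to zero and
with cells that do not degenerate. -/
structure RegularSequence (M : ℕ → Mesh d Ω) (N : ℕ → ℕ) (δt : ℕ → ℝ) (T θ : ℝ) : Prop where
  two_le : 2 ≤ d
  bounded : Bornology.IsBounded Ω
  δt_pos : ∀ m, 0 < δt m
  mul_δt : ∀ m, N m * δt m = T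
  tendsto_δt : Tendsto δt atTop (𝓝 0)
  tendsto_size : Tendsto (fun m => (M m).size) atTop (𝓝 0)
  diam_le : ∀ m, ∀ K ∈ (M m).cells, ∀ i, K.diam ≤ θ * K.len i

/-- The cells as pieces of `Ω`. -/
def spacePieces (M : ℕ → Mesh d Ω) : Pieces (Fin d → ℝ) (Box d) (volume.restrict (closure Ω)) where
  idx m := (M m).cells
  piece _ K := K.openSet
  measurable _ K _ := K.isOpen_openSet.measurableSet
  disjoint m K hK L hL h := (M m).disjoint K hK L hL h
  cover m := by
    rw [ae_restrict_iff' isClosed_closure.measurableSet]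
    exact (M m).ae_mem_openSet

theorem measure_spacePieces (M : ℕ → Mesh d Ω) {m : ℕ} {K : Box d} (hK : K ∈ (M m).cells) :
    (volume.restrict (closure Ω)).real ((spacePieces M).piece m K) = K.vol := by
  rw [← Box.volume_openSet ((M m).lo_lt_hi K hK)]
  change (volume.restrict (closure Ω)).real K.openSet = _
  rw [measureReal_restrict_apply K.isOpen_openSet.measurableSet,
    Set.inter_eq_left.2 (K.openSet_subset_toSet.trans ((M m).toSet_subset hK))]

namespace RegularSequence

variable {M : ℕ → Mesh d Ω} {N : ℕ → ℕ} {δt : ℕ → ℝ} {T θ : ℝ}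

/-- The products of the time steps and the cells as pieces of `(0,T) × Ω`. -/
def pieces (h : RegularSequence M N δt T θ) :
    Pieces (ℝ × (Fin d → ℝ)) (ℕ × Box d) (volume.restrict (Set.Ioo 0 T ×ˢ closure Ω)) where
  idx m := Finset.range (N m) ×ˢ (M m).cells
  piece m k := Set.Ioo (k.1 * δt m) ((k.1 + 1) * δt m) ×ˢ k.2.openSet
  measurable m k _ := measurableSet_Ioo.prod k.2.isOpen_openSet.measurableSet
  disjoint m k hk k' hk' hne := by
    rw [Finset.mem_product] at hk hk'
    rw [Set.disjoint_left]
    rintro z ⟨hz1, hz2⟩ ⟨hz1', hz2'⟩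
    have e2 : k'.2 = k.2 := (M m).eq_of_mem hk.2 hk'.2 hz2 (k'.2.openSet_subset_toSet hz2')
    have hδ := h.δt_pos m
    have l1 := lt_of_mul_lt_mul_right (hz1.1.trans hz1'.2) hδ.le
    have l2 := lt_of_mul_lt_mul_right (hz1'.1.trans hz1.2) hδ.le
    have e1 : k.1 = k'.1 := by
      have l1' : k.1 < k'.1 + 1 := by exact_mod_cast l1
      have l2' : k'.1 < k.1 + 1 := by exact_mod_cast l2
      omega
    exact hne (Prod.ext e1 e2.symm)
  cover m := by
    rw [ae_restrict_iff' (measurableSet_Ioo.prod isClosed_closure.measurableSet)]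
    have h1 : ∀ᵐ t : ℝ, ∀ n : ℕ, t ≠ n * δt m := ae_all_iff.2 fun n => by
      simp [ae_iff]
    have h1' : ∀ᵐ z : ℝ × (Fin d → ℝ), ∀ n : ℕ, z.1 ≠ n * δt m :=
      Measure.quasiMeasurePreserving_fst.ae h1
    have h2 : ∀ᵐ z : ℝ × (Fin d → ℝ), z.2 ∈ closure Ω → ∃ K ∈ (M m).cells, z.2 ∈ K.openSet :=
      Measure.quasiMeasurePreserving_snd.ae (M m).ae_mem_openSet
    filter_upwards [h1', h2] with z hz1 hz2 hz
    obtain ⟨K, hK, hzK⟩ := hz2 hz.2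
    have hδ := h.δt_pos m
    have h0 : 0 ≤ z.1 / δt m := div_nonneg hz.1.1.le hδ.le
    have hl := Nat.floor_le h0
    have hr := Nat.lt_floor_add_one (z.1 / δt m)
    rw [le_div_iff₀ hδ] at hl
    rw [div_lt_iff₀ hδ] at hr
    refine ⟨(⌊z.1 / δt m⌋₊, K), Finset.mem_product.2 ⟨Finset.mem_range.2 ?_, hK⟩,
      ⟨lt_of_le_of_ne hl (hz1 _).symm, hr⟩, hzK⟩
    rw [Nat.floor_lt h0, div_lt_iff₀ hδ, h.mul_δt]
    exact hz.1.2

theorem mem_idx (h : RegularSequence M N δt T θ) {m : ℕ} {k : ℕ × Box d} :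
    k ∈ h.pieces.idx m ↔ k.1 < N m ∧ k.2 ∈ (M m).cells := by
  change k ∈ Finset.range (N m) ×ˢ (M m).cells ↔ _
  rw [Finset.mem_product, Finset.mem_range]

theorem slab_subset (h : RegularSequence M N δt T θ) {m n : ℕ} (hn : n < N m) :
    Set.Ioo (n * δt m) ((n + 1) * δt m) ⊆ Set.Ioo 0 T := by
  have hδ := h.δt_pos m
  refine Set.Ioo_subset_Ioo (by positivity) ?_
  rw [← h.mul_δt m]
  have : (n : ℝ) + 1 ≤ N m := by exact_mod_cast hn
  exact mul_le_mul_of_nonneg_right this hδ.le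

theorem floor_eq (h : RegularSequence M N δt T θ)
    {m n : ℕ} {t : ℝ} (ht : t ∈ Set.Ioo (n * δt m) ((n + 1) * δt m)) :
    ⌊t / δt m⌋₊ = n := by
  have hδ := h.δt_pos m
  rw [Nat.floor_eq_iff (div_nonneg ((by positivity : (0:ℝ) ≤ n * δt m).trans ht.1.le) hδ.le),
    le_div_iff₀ hδ, div_lt_iff₀ hδ]
  exact ⟨ht.1.le, ht.2⟩

theorem measure_slab_prod (h : RegularSequence M N δt T θ)
    {m n : ℕ} (hn : n < N m) {K : Box d} (hK : ∀ i, K.lo i < K.hi i)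
    (hsub : K.openSet ⊆ closure Ω) :
    (volume.restrict (Set.Ioo 0 T ×ˢ closure Ω)).real
      (Set.Ioo (n * δt m) ((n + 1) * δt m) ×ˢ K.openSet) = δt m * K.vol := by
  have hsub' : Set.Ioo (n * δt m) ((n + 1) * δt m) ×ˢ K.openSet ⊆ Set.Ioo 0 T ×ˢ closure Ω :=
    Set.prod_mono (h.slab_subset hn) hsub
  have hδ := h.δt_pos m
  rw [measureReal_restrict_apply (measurableSet_Ioo.prod K.isOpen_openSet.measurableSet),
    Set.inter_eq_left.2 hsub', Measure.volume_eq_prod, measureReal_prod_prod,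
    Box.volume_openSet hK, Real.volume_real_Ioo_of_le]
  · ring
  · linarith

theorem measure_piece (h : RegularSequence M N δt T θ)
    {m : ℕ} {k : ℕ × Box d} (hk : k ∈ h.pieces.idx m) :
    (volume.restrict (Set.Ioo 0 T ×ˢ closure Ω)).real (h.pieces.piece m k) = δt m * k.2.vol := by
  rw [mem_idx] at hk
  exact h.measure_slab_prod hk.1 ((M m).lo_lt_hi _ hk.2)
    (k.2.openSet_subset_toSet.trans ((M m).toSet_subset hk.2))

theorem isFiniteMeasure (h : RegularSequence M N δt T θ) :
    IsFiniteMeasure (volume.restrict (Set.Ioo 0 T ×ˢ closure Ω)) :=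
  ⟨by
    rw [Measure.restrict_apply_univ]
    exact ((Metric.isBounded_Ioo 0 T).prod h.bounded.closure).measure_lt_top⟩

/-- The sum over closed cells counts points on common faces several times; the open pieces avoid
them. -/
theorem density_eq (h : RegularSequence M N δt T θ) (q : ℕ → Box d → ℝ)
    {m : ℕ} {k : ℕ × Box d} (hk : k ∈ h.pieces.idx m)
    {z : ℝ × (Fin d → ℝ)} (hz : z ∈ h.pieces.piece m k) :
    (M m).density (δt m) q z = q k.1 k.2 := by
  rw [mem_idx] at hk
  unfold Mesh.density
  rw [h.floor_eq hz.1, Finset.sum_eq_single k.2]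
  · exact Set.indicator_of_mem (k.2.openSet_subset_toSet hz.2) _
  · exact fun L hL hne => Set.indicator_of_notMem
      (fun hx => hne ((M m).eq_of_mem hk.2 hL hz.2 hx)) _
  · exact fun hn => absurd hk.2 hn

/-- A point of an open half cell lies in the dual cell of exactly one face of the given direction.
-/
theorem velocity_eq (h : RegularSequence M N δt T θ) (u : ℕ → Face d → ℝ)
    {m : ℕ} {k : ℕ × Box d} (hk : k ∈ h.pieces.idx m)
    {i : Fin d} {s : Bool} {z : ℝ × (Fin d → ℝ)}
    (hz : z ∈ Set.Ioo (k.1 * δt m) ((k.1 + 1) * δt m) ×ˢ (k.2.halfBox i s).openSet) :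
    (M m).velocity (δt m) u z i = u k.1 (k.2.face i s) := by
  rw [mem_idx] at hk
  have hlt := (M m).lo_lt_hi _ hk.2
  have hzK := Box.halfBox_openSet_subset hlt i s hz.2
  unfold Mesh.velocity
  rw [h.floor_eq hz.1, Finset.sum_eq_single (k.2.face i s)]
  · refine Set.indicator_of_mem ?_ _
    exact ⟨k.2, hk.2, s, rfl, (Box.mem_half_iff hlt hz.2 s).2 rfl⟩
  · intro σ hσ hne
    refine Set.indicator_of_notMem ?_ _
    rintro ⟨L, hL, t, hLt, hzL⟩
    obtain rfl := (M m).eq_of_mem hk.2 hL hzK hzL.1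
    have hdir := (Finset.mem_filter.1 hσ).2
    rw [hdir] at hLt hzL
    rw [(Box.mem_half_iff hlt hz.2 t).1 hzL] at hLt
    exact hne hLt.symm
  · intro hn
    exact (hn (Finset.mem_filter.2 ⟨(M m).face_mem hk.2 i s, (rfl : (k.2.face i s).dir = i)⟩)).elim

theorem measurable_velocity (u : ℕ → Face d → ℝ) (m : ℕ) (i : Fin d) :
    Measurable fun z => (M m).velocity (δt m) u z i := by
  unfold Mesh.velocity
  refine Finset.measurable_sum _ fun σ _ => ?_
  have h1 : MeasurableSet {z : ℝ × (Fin d → ℝ) | z.2 ∈ (M m).dualCell σ} :=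
    measurable_snd ((M m).measurableSet_dualCell σ)
  exact ((measurable_from_nat (f := fun n => u n σ)).comp
    (Nat.measurable_floor.comp (measurable_fst.div_const _))).indicator h1

/-- Neighbours share their extent in a transverse direction, which exists as d ≥ 2, and shape
regularity compares it with the normal extents of both cells: one factor θ for each. The 1 in the
maximum covers external faces, where the neighbour is K itself. -/
theorem vol_le_nbr (h : RegularSequence M N δt T θ) (hθ : 0 ≤ θ)
    {m : ℕ} {K : Box d} (hK : K ∈ (M m).cells) (i : Fin d) (s : Bool) :
    K.vol ≤ max 1 (θ ^ 2) * ((M m).nbr K i s).vol := by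
  have hL := (M m).nbr_mem hK i s
  have hv := Mesh.vol_pos hL
  by_cases hi : (M m).IsInternal K i s
  swap
  · rw [(M m).nbr_of_not_isInternal hi]
    exact le_mul_of_one_le_left (Mesh.vol_pos hK).le (le_max_left _ _)
  have hc := (M m).nbr_coords hi
  have hs := (M m).nbr_spec hi
  have hd := h.two_le
  obtain ⟨j, hj⟩ : ∃ j : Fin d, j ≠ i := by
    have : Nontrivial (Fin d) := Fin.nontrivial_iff_two_le.2 hd
    exact exists_ne i
  have e : K.len j = ((M m).nbr K i s).len j := by
    unfold Box.len
    rw [(hc.2 j hj).1, (hc.2 j hj).2]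
  have l1 : K.len i ≤ θ ^ 2 * ((M m).nbr K i s).len i := by
    have a1 := (K.len_le_diam i).trans (h.diam_le m K hK j)
    have a2 := (Box.len_le_diam _ j).trans (h.diam_le m _ hL i)
    rw [e] at a1
    nlinarith [mul_le_mul_of_nonneg_left a2 hθ]
  rw [← K.area_mul_len i s, ← Box.area_mul_len _ i (!s), hs.2]
  have ha := Mesh.area_pos hK i s
  have l2 := Mesh.len_pos hL i
  calc _ ≤ (K.face i s).area * (θ ^ 2 * ((M m).nbr K i s).len i) :=
        mul_le_mul_of_nonneg_left l1 ha.le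
    _ = θ ^ 2 * ((K.face i s).area * ((M m).nbr K i s).len i) := by ring
    _ ≤ _ := mul_le_mul_of_nonneg_right (le_max_right _ _) (by positivity)

end RegularSequence
end MAC

/-! ### Convergence of shifted densities and of face velocities. -/

namespace MAC

variable {d : ℕ} {Ω : Set (Fin d → ℝ)}

theorem tendsto_integral_abs_of_eLpNorm {X : Type*} [MeasurableSpace X] {μ : Measure X}
    {F : ℕ → X → ℝ} {f : X → ℝ} (hF : ∀ m, Integrable (F m) μ) (hf : Integrable f μ)
    (h : Tendsto (fun m => eLpNorm (fun z => F m z - f z) 1 μ) atTop (𝓝 0)) :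
    Tendsto (fun m => ∫ z, |F m z - f z| ∂μ) atTop (𝓝 0) := by
  have e : ∀ m, ∫ z, |F m z - f z| ∂μ = (eLpNorm (fun z => F m z - f z) 1 μ).toReal := fun m => by
    have hi : Integrable (fun z => F m z - f z) μ := (hF m).sub hf
    rw [eLpNorm_one_eq_lintegral_enorm, ← ofReal_integral_norm_eq_lintegral_enorm hi,
      ENNReal.toReal_ofReal (integral_nonneg fun z => norm_nonneg _)]
    rfl
  simp only [e]
  simpa [Function.comp_def] using (ENNReal.tendsto_toReal ENNReal.zero_ne_top).comp h

namespace RegularSequence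

variable {M : ℕ → Mesh d Ω} {N : ℕ → ℕ} {δt : ℕ → ℝ} {T θ : ℝ}

open Classical in
/-- Criterion for the convergence of piecewise constant functions whose values are averages over a
cell and over its neighbour in a given direction. -/
theorem lconv_of_average (h : RegularSequence M N δt T θ) {f : ℝ × (Fin d → ℝ) → ℝ}
    (hf : Integrable f (volume.restrict (Set.Ioo 0 T ×ˢ closure Ω)))
    {F : ℕ → ℝ × (Fin d → ℝ) → ℝ}
    (hFi : ∀ m, Integrable (F m) (volume.restrict (Set.Ioo 0 T ×ˢ closure Ω)))
    (hF : Tendsto (fun m => ∫ z in Set.Ioo 0 T ×ˢ closure Ω, |F m z - f z|) atTop (𝓝 0))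
    (i : Fin d) (s : Bool) {C : ℝ} (hC : 0 ≤ C) {a : ℕ → ℕ × Box d → ℝ}
    (ha : ∀ m, ∀ k ∈ h.pieces.idx m, ∀ c : ℝ, δt m * k.2.vol * |a m k - c| ≤
      C * (∫ z in h.pieces.piece m k, |F m z - c| ∂(volume.restrict (Set.Ioo 0 T ×ˢ closure Ω)) +
        if (M m).IsInternal k.2 i s then ∫ z in h.pieces.piece m (k.1, (M m).nbr k.2 i s),
          |F m z - c| ∂(volume.restrict (Set.Ioo 0 T ×ˢ closure Ω)) else 0)) :
    h.pieces.Lconv a f := by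
  have := h.isFiniteMeasure
  have hδ : Tendsto (fun m => δt m + 2 * (M m).size) atTop (𝓝 0) := by
    simpa using h.tendsto_δt.add (h.tendsto_size.const_mul 2)
  have htime : ∀ m (n : ℕ), ∀ x ∈ Set.Ioo (n * δt m) ((n + 1) * δt m),
      ∀ y ∈ Set.Ioo (n * δt m) ((n + 1) * δt m), dist x y ≤ δt m := by
    intro m n x hx y hy
    rw [Real.dist_eq, abs_le]
    constructor <;> linarith [hx.1, hx.2, hy.1, hy.2]
  have hsize : ∀ m, 0 ≤ (M m).size := fun m =>
    Real.sSup_nonneg (by rintro _ ⟨K, -, rfl⟩; exact Real.sqrt_nonneg _)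
  refine h.pieces.lconv_of_average hf hFi hF (fun m => {k | (M m).IsInternal k.2 i s})
    (fun m k => (k.1, (M m).nbr k.2 i s)) ?_ ?_ hδ ?_ ?_ hC ?_
  · intro m k hk _
    rw [h.mem_idx] at hk ⊢
    exact ⟨hk.1, (M m).nbr_mem hk.2 i s⟩
  · intro m k hk hk1 k' hk' hk1' he
    rw [h.mem_idx] at hk hk'
    have e1 : k.1 = k'.1 := (Prod.ext_iff.1 he).1
    have e2 : (M m).nbr k.2 i s = (M m).nbr k'.2 i s := (Prod.ext_iff.1 he).2
    refine Prod.ext e1 ?_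
    rw [← (M m).nbr_nbr hk.2 hk1, ← (M m).nbr_nbr hk'.2 hk1', e2]
  · intro m k hk x hx y hy
    rw [h.mem_idx] at hk
    refine max_le ((htime m k.1 _ hx.1 _ hy.1).trans (by linarith [hsize m])) ?_
    have := (M m).dist_le hk.2 (k.2.openSet_subset_toSet hx.2) (k.2.openSet_subset_toSet hy.2)
    linarith [hsize m, h.δt_pos m]
  · intro m k hk hk1 x hx y hy
    rw [h.mem_idx] at hk
    refine max_le ((htime m k.1 _ hx.1 _ hy.1).trans (by linarith [hsize m])) ?_
    have := (M m).dist_nbr_le hk.2 hk1 (k.2.openSet_subset_toSet hx.2)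
      (Box.openSet_subset_toSet _ hy.2)
    linarith [hsize m, h.δt_pos m]
  · intro m k hk c
    rw [h.measure_piece hk]
    exact ha m k hk c

/-- Values of neighbouring cells converge to the same limit. -/
theorem lconv_nbr (h : RegularSequence M N δt T θ) (hθ : 0 ≤ θ) {f : ℝ × (Fin d → ℝ) → ℝ}
    (hf : Integrable f (volume.restrict (Set.Ioo 0 T ×ˢ closure Ω))) {q : ℕ → ℕ × Box d → ℝ}
    (hq : h.pieces.Lconv q f) (i : Fin d) (s : Bool) :
    h.pieces.Lconv (fun m k => q m (k.1, (M m).nbr k.2 i s)) f := by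
  classical
  have := h.isFiniteMeasure
  refine h.lconv_of_average hf (fun m => h.pieces.integrable_recon q m) hq i s
    (le_trans zero_le_one (le_max_left 1 (θ ^ 2))) fun m k hk c => ?_
  have hk' := h.mem_idx.1 hk
  have hL : (k.1, (M m).nbr k.2 i s) ∈ h.pieces.idx m :=
    h.mem_idx.2 ⟨hk'.1, (M m).nbr_mem hk'.2 i s⟩
  have hint : ∀ k' ∈ h.pieces.idx m, ∫ z in h.pieces.piece m k', |h.pieces.recon q m z - c|
      ∂(volume.restrict (Set.Ioo 0 T ×ˢ closure Ω)) = δt m * k'.2.vol * |q m k' - c| := by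
    intro k' hk'
    rw [h.pieces.setIntegral_recon_comp q hk' fun a _ => |a - c|, ← h.measure_piece hk']
    simp
  have hv := h.vol_le_nbr hθ hk'.2 i s
  have hδ := h.δt_pos m
  -- The value of the neighbour, used on K, is charged to the piece of the neighbour itself; this
  -- needs comparable volumes.
  have hle : δt m * k.2.vol * |q m (k.1, (M m).nbr k.2 i s) - c| ≤ max 1 (θ ^ 2) *
      (δt m * ((M m).nbr k.2 i s).vol * |q m (k.1, (M m).nbr k.2 i s) - c|) := by
    have := mul_le_mul_of_nonneg_left hv
      (mul_nonneg hδ.le (abs_nonneg (q m (k.1, (M m).nbr k.2 i s) - c)))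
    linarith
  refine hle.trans (mul_le_mul_of_nonneg_left ?_ (le_trans zero_le_one (le_max_left 1 (θ ^ 2))))
  rw [hint k hk, hint _ hL]
  split_ifs with hi
  · exact le_add_of_nonneg_left (mul_nonneg (mul_nonneg hδ.le (Mesh.vol_pos hk'.2).le)
      (abs_nonneg _))
  · rw [(M m).nbr_of_not_isInternal hi, add_zero]

theorem integrable_density (h : RegularSequence M N δt T θ) (q : ℕ → ℕ → Box d → ℝ) (m : ℕ) :
    Integrable ((M m).density (δt m) (q m)) (volume.restrict (Set.Ioo 0 T ×ˢ closure Ω)) := by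
  have := h.isFiniteMeasure
  refine (h.pieces.integrable_recon (fun m k => q m k.1 k.2) m).congr ?_
  filter_upwards [h.pieces.cover m] with z hz
  obtain ⟨k, hk, hz⟩ := hz
  rw [h.pieces.recon_eq _ hk hz, h.density_eq (q m) hk hz]

theorem lconv_density (h : RegularSequence M N δt T θ) {f : ℝ × (Fin d → ℝ) → ℝ}
    (hf : Integrable f (volume.restrict (Set.Ioo 0 T ×ˢ closure Ω))) {q : ℕ → ℕ → Box d → ℝ}
    (hq : Tendsto (fun m => eLpNorm (fun z => (M m).density (δt m) (q m) z - f z) 1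
      (volume.restrict (Set.Ioo 0 T ×ˢ closure Ω))) atTop (𝓝 0)) :
    h.pieces.Lconv (fun m k => q m k.1 k.2) f := by
  refine (tendsto_integral_abs_of_eLpNorm (h.integrable_density q) hf hq).congr fun m => ?_
  refine integral_congr_ae ?_
  filter_upwards [h.pieces.cover m] with z hz
  obtain ⟨k, hk, hz⟩ := hz
  simp only [h.pieces.recon_eq _ hk hz, h.density_eq (q m) hk hz]

/-- A shift in time does not change the limit if the variation in time is bounded. -/
theorem lconv_succ (h : RegularSequence M N δt T θ) {f : ℝ × (Fin d → ℝ) → ℝ}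
    (hf : Integrable f (volume.restrict (Set.Ioo 0 T ×ˢ closure Ω))) {q : ℕ → ℕ → Box d → ℝ}
    (hq : h.pieces.Lconv (fun m k => q m k.1 k.2) f) {C : ℝ}
    (hC : ∀ m, ∑ n ∈ Finset.range (N m), ∑ K ∈ (M m).cells,
      K.vol * |q m (n + 1) K - q m n K| ≤ C) :
    h.pieces.Lconv (fun m k => q m (k.1 + 1) k.2) f := by
  have := h.isFiniteMeasure
  refine h.pieces.lconv_of_close hf
    (fun m => h.pieces.integrable_recon (fun m k => q m k.1 k.2) m) hq ?_
  -- Every level lasts a time δt, so the L¹ distance of the two reconstructions is δt times the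
  -- total variation in time.
  refine squeeze_zero (g := fun m => δt m * C) (fun m => integral_nonneg fun z => abs_nonneg _)
    (fun m => ?_) (by simpa using h.tendsto_δt.mul_const C)
  have hi : Integrable (fun z => |h.pieces.recon (fun m k => q m (k.1 + 1) k.2) m z -
      h.pieces.recon (fun m k => q m k.1 k.2) m z|)
      (volume.restrict (Set.Ioo 0 T ×ˢ closure Ω)) :=
    ((h.pieces.integrable_recon _ m).sub (h.pieces.integrable_recon _ m)).abs
  rw [h.pieces.integral_eq_sum hi m]
  refine le_trans (le_of_eq ?_) (mul_le_mul_of_nonneg_left (hC m) (h.δt_pos m).le)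
  rw [Finset.mul_sum]
  change ∑ k ∈ Finset.range (N m) ×ˢ (M m).cells, _ = _
  rw [Finset.sum_product]
  refine Finset.sum_congr rfl fun n hn => ?_
  rw [Finset.mul_sum]
  refine Finset.sum_congr rfl fun K hK => ?_
  have hk : (n, K) ∈ h.pieces.idx m := Finset.mem_product.2 ⟨hn, hK⟩
  rw [h.pieces.setIntegral_recon_comp _ hk
      fun a z => |a - h.pieces.recon (fun m k => q m k.1 k.2) m z|,
    h.pieces.setIntegral_recon_comp (fun m k => q m k.1 k.2) hk fun a z => |q m (n + 1) K - a|,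
    setIntegral_const, h.measure_piece hk, smul_eq_mul]
  ring

theorem integrable_velocity (h : RegularSequence M N δt T θ) (u : ℕ → Face d → ℝ) (m : ℕ)
    {C : ℝ} (hu : ∀ n ≤ N m, ∀ σ ∈ (M m).faces, |u n σ| ≤ C) (i : Fin d) :
    Integrable (fun z => (M m).velocity (δt m) u z i)
      (volume.restrict (Set.Ioo 0 T ×ˢ closure Ω)) := by
  have := h.isFiniteMeasure
  refine Integrable.of_bound (measurable_velocity (M := M) (δt := δt) u m i).aestronglyMeasurable
    (∑ σ ∈ (M m).faces with σ.dir = i, C) ?_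
  rw [ae_restrict_iff' (measurableSet_Ioo.prod isClosed_closure.measurableSet)]
  refine .of_forall fun z hz => ?_
  refine (norm_sum_le _ _).trans (Finset.sum_le_sum fun σ hσ => ?_)
  refine (norm_indicator_le_norm_self _ _).trans (hu _ ?_ σ (Finset.mem_filter.1 hσ).1)
  have hδ := h.δt_pos m
  refine Nat.floor_le_of_le ?_
  rw [div_le_iff₀ hδ, h.mul_δt]
  exact hz.1.2.le

/-- The face value is the velocity only on the adjacent half of the cell. As this half has half the
measure, the averaging criterion holds with the constant 2 and without help from the neighbour. -/
theorem lconv_velocity (h : RegularSequence M N δt T θ) {i : Fin d} {f : ℝ × (Fin d → ℝ) → ℝ}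
    (hf : Integrable f (volume.restrict (Set.Ioo 0 T ×ˢ closure Ω))) {u : ℕ → ℕ → Face d → ℝ}
    {C : ℝ} (hu : ∀ m, ∀ n ≤ N m, ∀ σ ∈ (M m).faces, |u m n σ| ≤ C)
    (hq : Tendsto (fun m => eLpNorm (fun z => (M m).velocity (δt m) (u m) z i - f z) 1
      (volume.restrict (Set.Ioo 0 T ×ˢ closure Ω))) atTop (𝓝 0)) (s : Bool) :
    h.pieces.Lconv (fun m k => u m k.1 (k.2.face i s)) f := by
  classical
  have hFi := fun m => h.integrable_velocity (u m) m (hu m) i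
  refine h.lconv_of_average hf hFi (tendsto_integral_abs_of_eLpNorm hFi hf hq) i s
    (C := 2) (by norm_num) fun m k hk c => ?_
  have := h.isFiniteMeasure
  have hk' := h.mem_idx.1 hk
  have hlt := (M m).lo_lt_hi _ hk'.2
  set H := Set.Ioo (k.1 * δt m) ((k.1 + 1) * δt m) ×ˢ (k.2.halfBox i s).openSet with hH
  have hHm : MeasurableSet H := measurableSet_Ioo.prod (Box.isOpen_openSet _).measurableSet
  have hHs : H ⊆ h.pieces.piece m k := Set.prod_mono le_rfl (Box.halfBox_openSet_subset hlt i s)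
  have hsub : (k.2.halfBox i s).openSet ⊆ closure Ω := (Box.halfBox_openSet_subset hlt i s).trans
    (k.2.openSet_subset_toSet.trans ((M m).toSet_subset hk'.2))
  have hμ := h.measure_slab_prod hk'.1 (Box.halfBox_lt hlt i s) hsub
  rw [Box.vol_halfBox] at hμ
  have hI : Integrable (fun z => |(M m).velocity (δt m) (u m) z i - c|)
    (volume.restrict (Set.Ioo 0 T ×ˢ closure Ω)) := ((hFi m).sub (integrable_const c)).abs
  have h1 : ∫ z in H, |(M m).velocity (δt m) (u m) z i - c|
      ∂(volume.restrict (Set.Ioo 0 T ×ˢ closure Ω)) =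
      δt m * (k.2.vol / 2) * |u m k.1 (k.2.face i s) - c| := by
    rw [setIntegral_congr_fun (g := fun _ => |u m k.1 (k.2.face i s) - c|) hHm
      fun z hz => by simp only [h.velocity_eq (u m) hk hz]]
    rw [setIntegral_const, hμ, smul_eq_mul]
  have h2 : ∫ z in H, |(M m).velocity (δt m) (u m) z i - c|
      ∂(volume.restrict (Set.Ioo 0 T ×ˢ closure Ω)) ≤
      ∫ z in h.pieces.piece m k, |(M m).velocity (δt m) (u m) z i - c|
      ∂(volume.restrict (Set.Ioo 0 T ×ˢ closure Ω)) :=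
    setIntegral_mono_set hI.integrableOn (.of_forall fun z => abs_nonneg _)
      (LE.le.eventuallyLE hHs)
  have h3 : 0 ≤ if (M m).IsInternal k.2 i s then ∫ z in h.pieces.piece m
      (k.1, (M m).nbr k.2 i s), |(M m).velocity (δt m) (u m) z i - c|
      ∂(volume.restrict (Set.Ioo 0 T ×ˢ closure Ω)) else 0 := by
    split_ifs
    · exact integral_nonneg fun z => abs_nonneg _
    · exact le_rfl
  rw [h1] at h2
  linarith

end RegularSequence

end MAC

/-! ### Averages of the initial data over cells and dual cells. -/

namespace MAC

variable {d : ℕ} {Ω : Set (Fin d → ℝ)}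

theorem Box.half_eq {K : Box d} (h : ∀ i, K.lo i < K.hi i) (i : Fin d) (s : Bool) :
    K.half i s = (K.halfBox i s).toSet := by
  ext x
  have hi := h i
  rw [Box.mem_toSet_iff]
  constructor
  · rintro ⟨h1, h2⟩ j
    have := Box.mem_toSet_iff.1 h1 j
    by_cases hj : j = i
    · subst hj
      cases s <;> simp [halfBox] at h2 ⊢ <;> constructor <;> linarith [this.1, this.2]
    · cases s <;> simpa [halfBox, hj] using this
  · intro h1
    have h2 : K.lo i ≤ x i ∧ x i ≤ K.hi i ∧
        (if s then (K.lo i + K.hi i) / 2 ≤ x i else x i ≤ (K.lo i + K.hi i) / 2) := by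
      have := h1 i
      cases s <;> simp [halfBox] at this ⊢ <;> refine ⟨?_, ?_, ?_⟩ <;> linarith [this.1, this.2]
    refine ⟨Box.mem_toSet_iff.2 fun j => ?_, h2.2.2⟩
    by_cases hj : j = i
    · subst hj
      exact ⟨h2.1, h2.2.1⟩
    · have := h1 j
      cases s <;> simpa [halfBox, hj] using this

namespace Mesh

variable (M : Mesh d Ω)

theorem dualCell_eq {K : Box d} (hK : K ∈ M.cells) {i : Fin d} {s : Bool}
    (hi : M.IsInternal K i s) :
    M.dualCell (K.face i s) = K.half i s ∪ (M.nbr K i s).half i (!s) := by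
  ext x
  constructor
  · rintro ⟨L, hL, t, ht, hx⟩
    rw [Box.dir_face] at ht hx
    by_cases hts : t = s
    · subst hts
      rw [M.eq_of_face_eq hL hK ht] at hx
      exact Or.inl hx
    · obtain rfl : t = !s := by cases s <;> cases t <;> simp_all
      rw [← M.nbr_eq hL ht] at hx
      exact Or.inr hx
  · rintro (hx | hx)
    · exact ⟨K, hK, s, rfl, hx⟩
    · exact ⟨_, M.nbr_mem hK i s, !s, (M.nbr_spec hi).2, hx⟩

theorem nbr_ne {K : Box d} (hK : K ∈ M.cells) {i : Fin d} {s : Bool}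
    (hi : M.IsInternal K i s) : M.nbr K i s ≠ K := fun h => by
  have := (M.nbr_spec hi).2
  rw [h] at this
  exact M.face_ne_face_not hK i s this

theorem setIntegral_dualCell {K : Box d} (hK : K ∈ M.cells) {i : Fin d} {s : Bool}
    (hi : M.IsInternal K i s) {f : (Fin d → ℝ) → ℝ} (hf : IntegrableOn f (closure Ω)) :
    ∫ x in M.dualCell (K.face i s), f x = (∫ x in (K.halfBox i s).openSet, f x) +
      ∫ x in ((M.nbr K i s).halfBox i (!s)).openSet, f x := by
  have hL := M.nbr_mem hK i s
  have lK := M.lo_lt_hi K hK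
  have lL := M.lo_lt_hi _ hL
  have sK := Box.halfBox_openSet_subset lK i s
  have sL := Box.halfBox_openSet_subset lL i (!s)
  rw [M.dualCell_eq hK hi, Box.half_eq lK, Box.half_eq lL, ← setIntegral_union]
  · refine setIntegral_congr_set ?_
    exact (Box.openSet_ae_eq _).symm.union (Box.openSet_ae_eq _).symm
  · exact (M.disjoint K hK _ hL (M.nbr_ne hK hi).symm).mono sK sL
  · exact (Box.isOpen_openSet _).measurableSet
  · exact hf.mono_set (sK.trans (K.openSet_subset_toSet.trans (M.toSet_subset hK)))
  · exact hf.mono_set (sL.trans ((Box.openSet_subset_toSet _).trans (M.toSet_subset hL)))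

/-- Up to the factor |D_σ|, the error is the integral of f - c over the two halves, which are
enlarged to whole cells to fit the averaging criterion. The 2 comes from |K| ≤ 2|D_σ|. -/
theorem abs_dualCell_average_sub_le {K : Box d} (hK : K ∈ M.cells) {i : Fin d} {s : Bool}
    (hi : M.IsInternal K i s) (hb : Bornology.IsBounded Ω) {f : (Fin d → ℝ) → ℝ}
    (hf : IntegrableOn f (closure Ω)) (c : ℝ) :
    K.vol * |(∫ x in M.dualCell (K.face i s), f x) / M.dualVol (K.face i s) - c| ≤
      2 * ((∫ x in K.openSet, |f x - c|) + ∫ x in (M.nbr K i s).openSet, |f x - c|) := by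
  have hL := M.nbr_mem hK i s
  have lK := M.lo_lt_hi K hK
  have lL := M.lo_lt_hi _ hL
  have sK := Box.halfBox_openSet_subset lK i s
  have sL := Box.halfBox_openSet_subset lL i (!s)
  have hD := M.dualVol_pos hK i s
  have hfin : volume (closure Ω) ≠ ⊤ := hb.closure.measure_lt_top.ne
  have hc : IntegrableOn (fun _ : Fin d → ℝ => c) (closure Ω) := integrableOn_const hfin
  have hfc : IntegrableOn (fun x => f x - c) (closure Ω) := hf.sub hc
  have e2 := M.setIntegral_dualCell hK hi hf
  have tK : K.openSet ⊆ closure Ω := K.openSet_subset_toSet.trans (M.toSet_subset hK)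
  have tL : (M.nbr K i s).openSet ⊆ closure Ω :=
    (Box.openSet_subset_toSet _).trans (M.toSet_subset hL)
  have e3 : ∫ x in (K.halfBox i s).openSet, (f x - c) =
      (∫ x in (K.halfBox i s).openSet, f x) - K.vol / 2 * c := by
    rw [integral_sub (hf.mono_set (sK.trans tK)) (hc.mono_set (sK.trans tK)), setIntegral_const,
      Box.volume_openSet (Box.halfBox_lt lK i s), Box.vol_halfBox, smul_eq_mul]
  have e4 : ∫ x in ((M.nbr K i s).halfBox i (!s)).openSet, (f x - c) =
      (∫ x in ((M.nbr K i s).halfBox i (!s)).openSet, f x) - (M.nbr K i s).vol / 2 * c := by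
    rw [integral_sub (hf.mono_set (sL.trans tL)) (hc.mono_set (sL.trans tL)), setIntegral_const,
      Box.volume_openSet (Box.halfBox_lt lL i (!s)), Box.vol_halfBox, smul_eq_mul]
  have e5 : M.dualVol (K.face i s) *
      ((∫ x in M.dualCell (K.face i s), f x) / M.dualVol (K.face i s) - c) =
      (∫ x in (K.halfBox i s).openSet, (f x - c)) +
        ∫ x in ((M.nbr K i s).halfBox i (!s)).openSet, (f x - c) := by
    rw [mul_sub, mul_div_cancel₀ _ hD.ne', e2, e3, e4, M.dualVol_of_isInternal hK hi]
    ring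
  have b : ∀ {H U : Set (Fin d → ℝ)}, H ⊆ U → U ⊆ closure Ω →
      |∫ x in H, (f x - c)| ≤ ∫ x in U, |f x - c| := fun hHU hU =>
    abs_integral_le_integral_abs.trans (setIntegral_mono_set (hfc.mono_set hU).abs
      (.of_forall fun z => abs_nonneg _) (LE.le.eventuallyLE hHU))
  have h1 : M.dualVol (K.face i s) *
      |(∫ x in M.dualCell (K.face i s), f x) / M.dualVol (K.face i s) - c| ≤
      (∫ x in K.openSet, |f x - c|) + ∫ x in (M.nbr K i s).openSet, |f x - c| := by
    rw [← abs_of_pos hD, ← abs_mul, abs_of_pos hD, e5]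
    exact (abs_add_le _ _).trans (add_le_add (b sK tK) (b sL tL))
  have h2 := mul_le_mul_of_nonneg_right (M.half_vol_le_dualVol hK i s)
    (abs_nonneg ((∫ x in M.dualCell (K.face i s), f x) / M.dualVol (K.face i s) - c))
  linarith

theorem abs_average_sub_le {K : Box d} (hK : K ∈ M.cells) (hb : Bornology.IsBounded Ω)
    {f : (Fin d → ℝ) → ℝ} (hf : IntegrableOn f (closure Ω)) (c : ℝ) :
    K.vol * |(∫ x in K.toSet, f x) / K.vol - c| ≤ ∫ x in K.openSet, |f x - c| := by
  have hv := vol_pos hK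
  have hfin : volume (closure Ω) ≠ ⊤ := hb.closure.measure_lt_top.ne
  have hc : IntegrableOn (fun _ : Fin d → ℝ => c) (closure Ω) := integrableOn_const hfin
  have tK : K.openSet ⊆ closure Ω := K.openSet_subset_toSet.trans (M.toSet_subset hK)
  have e : K.vol * ((∫ x in K.toSet, f x) / K.vol - c) = ∫ x in K.openSet, (f x - c) := by
    rw [integral_sub (hf.mono_set tK) (hc.mono_set tK), setIntegral_const,
      Box.volume_openSet (M.lo_lt_hi K hK), mul_sub, mul_div_cancel₀ _ hv.ne', smul_eq_mul,
      setIntegral_congr_set K.openSet_ae_eq]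
  calc _ = |K.vol * ((∫ x in K.toSet, f x) / K.vol - c)| := by rw [abs_mul, abs_of_pos hv]
    _ ≤ _ := by rw [e]; exact abs_integral_le_integral_abs

end Mesh

/-- Averages over the cells or over the dual cells converge. -/
theorem RegularSequence.lconv_average {M : ℕ → Mesh d Ω} {N : ℕ → ℕ} {δt : ℕ → ℝ} {T θ : ℝ}
    (h : RegularSequence M N δt T θ) {f : (Fin d → ℝ) → ℝ}
    (hf : Integrable f (volume.restrict (closure Ω))) (i : Fin d) (s : Bool)
    {a : ℕ → Box d → ℝ}
    (ha : ∀ m, ∀ K ∈ (M m).cells, a m K = (∫ x in K.toSet, f x) / K.vol ∨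
      (M m).IsInternal K i s ∧
        a m K = (∫ x in (M m).dualCell (K.face i s), f x) / (M m).dualVol (K.face i s)) :
    (spacePieces M).Lconv a f := by
  classical
  have : IsFiniteMeasure (volume.restrict (closure Ω)) := ⟨by
    rw [Measure.restrict_apply_univ]
    exact h.bounded.closure.measure_lt_top⟩
  have hδ : Tendsto (fun m => 2 * (M m).size) atTop (𝓝 0) := by
    simpa using h.tendsto_size.const_mul 2
  have hsize : ∀ m, 0 ≤ (M m).size := fun m =>
    Real.sSup_nonneg (by rintro _ ⟨K, -, rfl⟩; exact Real.sqrt_nonneg _)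
  refine (spacePieces M).lconv_of_average hf (F := fun _ => f) (fun _ => hf) (by simp)
    (fun m => {K | (M m).IsInternal K i s}) (fun m K => (M m).nbr K i s) ?_ ?_ hδ ?_ ?_
    (C := 2) (by norm_num) ?_
  · exact fun m K hK _ => (M m).nbr_mem hK i s
  · intro m K hK hi K' hK' hi' he
    rw [← (M m).nbr_nbr hK hi, ← (M m).nbr_nbr hK' hi', he]
  · intro m K hK x hx y hy
    have := (M m).dist_le hK (K.openSet_subset_toSet hx) (K.openSet_subset_toSet hy)
    linarith [hsize m]
  · intro m K hK hi x hx y hy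
    exact (M m).dist_nbr_le hK hi (K.openSet_subset_toSet hx) (Box.openSet_subset_toSet _ hy)
  · intro m K hK c
    have hK' : K ∈ (M m).cells := hK
    rw [measure_spacePieces M hK']
    have hp : ∀ L ∈ (M m).cells, ∫ x in (spacePieces M).piece m L, |f x - c|
        ∂(volume.restrict (closure Ω)) = ∫ x in L.openSet, |f x - c| := fun L hL => by
      change ∫ x in L.openSet, |f x - c| ∂(volume.restrict (closure Ω)) = _
      rw [Measure.restrict_restrict L.isOpen_openSet.measurableSet,
        Set.inter_eq_left.2 (L.openSet_subset_toSet.trans ((M m).toSet_subset hL))]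
    rw [hp K hK', hp _ ((M m).nbr_mem hK' i s)]
    have h0 : ∀ L : Box d, 0 ≤ ∫ x in L.openSet, |f x - c| := fun L =>
      integral_nonneg fun _ => abs_nonneg _
    rcases ha m K hK' with e | ⟨hi, e⟩
    · rw [e]
      have h1 := (M m).abs_average_sub_le hK' h.bounded hf c
      have h2 : 0 ≤ if K ∈ {K | (M m).IsInternal K i s} then
          ∫ x in ((M m).nbr K i s).openSet, |f x - c| else 0 := by
        split_ifs
        · exact h0 _
        · exact le_rfl
      linarith [h0 K]
    · have hm : K ∈ {K | (M m).IsInternal K i s} := hi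
      rw [e, if_pos hm]
      exact (M m).abs_dualCell_average_sub_le hK' hi h.bounded hf c

end MAC

/-! ### Centres of cells, faces and edges; difference quotients of the test function. -/

namespace MAC

theorem exists_lipschitz_bound {E F : Type*} [NormedAddCommGroup E] [NormedSpace ℝ E]
    [NormedAddCommGroup F] [NormedSpace ℝ F] {g : E → F} (hg : ContDiff ℝ 1 g) {S : Set E}
    (hS : IsCompact S) (hc : Convex ℝ S) :
    ∃ L, 0 ≤ L ∧ ∀ x ∈ S, ∀ y ∈ S, ‖g x - g y‖ ≤ L * ‖x - y‖ := by
  obtain ⟨L, hL⟩ := hS.exists_bound_of_continuousOn (hg.continuous_fderiv one_ne_zero).continuousOn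
  refine ⟨max L 0, le_max_right _ _, fun x hx y hy => ?_⟩
  exact hc.norm_image_sub_le_of_norm_fderiv_le
    (fun z _ => (hg.differentiable one_ne_zero) z)
    (fun z hz => (hL z hz).trans (le_max_left _ _)) hy hx

/-- Mean value inequality along the segment, which stays in S by convexity, for ψ minus its
linearisation at z; the derivative is Lipschitz on S. -/
theorem exists_quotient_bound {E : Type*} [NormedAddCommGroup E] [NormedSpace ℝ E] {ψ : E → ℝ}
    (hψ : ContDiff ℝ 2 ψ) {S : Set E} (hS : IsCompact S) (hc : Convex ℝ S) :
    ∃ L, 0 ≤ L ∧ ∀ e : E, ‖e‖ ≤ 1 → ∀ p ∈ S, ∀ h : ℝ, h ≠ 0 → p + h • e ∈ S → ∀ z ∈ S,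
      |(ψ (p + h • e) - ψ p) / h - fderiv ℝ ψ z e| ≤ L * (‖p - z‖ + |h|) := by
  have h1 : ContDiff ℝ 1 (fderiv ℝ ψ) := hψ.fderiv_right (by norm_num)
  obtain ⟨L, hL, hLip⟩ := exists_lipschitz_bound h1 hS hc
  refine ⟨L, hL, fun e he p hp h hh hph z hz => ?_⟩
  have hseg : segment ℝ p (p + h • e) ⊆ S := hc.segment_subset hp hph
  have hhe : ‖h • e‖ ≤ |h| := by
    rw [norm_smul, Real.norm_eq_abs]
    exact mul_le_of_le_one_right (abs_nonneg _) he
  have key := (convex_segment p (p + h • e)).norm_image_sub_le_of_norm_fderiv_le'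
    (f := ψ) (φ := fderiv ℝ ψ z) (C := L * (‖p - z‖ + |h|))
    (fun x _ => (hψ.differentiable two_ne_zero) x) (fun x hx => by
      refine (hLip x (hseg hx) z hz).trans (mul_le_mul_of_nonneg_left ?_ hL)
      have h3 : ‖x - p‖ ≤ ‖p + h • e - p‖ := by
        have := norm_sub_le_of_mem_segment hx
        exact this
      have h4 : x - z = (x - p) + (p - z) := by abel
      rw [h4]
      have := norm_add_le (x - p) (p - z)
      simp only [add_sub_cancel_left] at h3
      linarith) (left_mem_segment ℝ p (p + h • e)) (right_mem_segment ℝ p (p + h • e))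
  simp only [add_sub_cancel_left, map_smul, smul_eq_mul, Real.norm_eq_abs] at key
  have h5 : (ψ (p + h • e) - ψ p) / h - fderiv ℝ ψ z e =
      (ψ (p + h • e) - ψ p - h * fderiv ℝ ψ z e) / h := by field_simp
  rw [h5, abs_div, div_le_iff₀ (abs_pos.2 hh)]
  refine key.trans (mul_le_mul_of_nonneg_left (by simpa using hhe) ?_)
  positivity

variable {d : ℕ} {Ω : Set (Fin d → ℝ)}

/-- The centre of a cell. -/
noncomputable def Box.mid (K : Box d) : Fin d → ℝ := fun j => (K.lo j + K.hi j) / 2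

/-- The centre of a face. -/
noncomputable def Face.mid (σ : Face d) : Fin d → ℝ := fun j => (σ.lo j + σ.hi j) / 2

/-- The centre of the edge in which the faces `K.face i r` and `K.face j s` meet. -/
noncomputable def Box.edgeMid (K : Box d) (i j : Fin d) (r s : Bool) : Fin d → ℝ :=
  Function.update (Function.update K.mid i (K.side i r)) j (K.side j s)

theorem Box.mid_face (K : Box d) (i : Fin d) (s : Bool) :
    (K.face i s).mid = Function.update K.mid i (K.side i s) := by
  funext j
  by_cases hj : j = i
  · subst hj
    simp [Face.mid, face, side]
  · simp [Face.mid, face, hj, mid]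

theorem Box.side_eq (K : Box d) (i : Fin d) (s : Bool) :
    K.side i s = K.mid i + sgn s * K.len i / 2 := by
  cases s <;> simp [side, mid, len, sgn] <;> ring

theorem Box.mid_face_eq_add (K : Box d) (i : Fin d) (s : Bool) :
    (K.face i s).mid = K.mid + (sgn s * K.len i / 2) • Pi.single i (1 : ℝ) := by
  rw [K.mid_face]
  funext j
  by_cases hj : j = i
  · subst hj
    simp [K.side_eq]
  · simp [hj]

theorem Box.mid_face_true_eq_add (K : Box d) (i : Fin d) :
    (K.face i true).mid = (K.face i false).mid + K.len i • Pi.single i (1 : ℝ) := by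
  rw [K.mid_face_eq_add, K.mid_face_eq_add, add_assoc, ← add_smul]
  congr 2
  simp only [sgn, if_true, if_false, Bool.false_eq_true]
  ring

theorem Box.edgeMid_eq_add (K : Box d) {i j : Fin d} (hij : j ≠ i) (r s : Bool) :
    K.edgeMid i j r s = (K.face i r).mid + (sgn s * K.len j / 2) • Pi.single j (1 : ℝ) := by
  rw [K.mid_face]
  funext k
  unfold edgeMid
  by_cases hk : k = j
  · subst hk
    simp [hij, K.side_eq]
  · simp [hk]

theorem Box.update_side_mem {K : Box d} (h : ∀ i, K.lo i < K.hi i) {x : Fin d → ℝ}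
    (hx : x ∈ K.toSet) (i : Fin d) (s : Bool) : Function.update x i (K.side i s) ∈ K.toSet := by
  refine Box.mem_toSet_iff.2 fun j => ?_
  by_cases hj : j = i
  · subst hj
    have := h j
    cases s <;> simp [side] <;> linarith
  · simpa [hj] using Box.mem_toSet_iff.1 hx j

theorem Box.mid_mem {K : Box d} (h : ∀ i, K.lo i < K.hi i) : K.mid ∈ K.toSet :=
  Box.mem_toSet_iff.2 fun j => by
    have := h j
    unfold mid
    constructor <;> linarith

theorem Box.mid_face_mem {K : Box d} (h : ∀ i, K.lo i < K.hi i) (i : Fin d) (s : Bool) :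
    (K.face i s).mid ∈ K.toSet := by
  rw [K.mid_face]
  exact Box.update_side_mem h (Box.mid_mem h) i s

theorem Box.edgeMid_mem {K : Box d} (h : ∀ i, K.lo i < K.hi i) (i j : Fin d) (r s : Bool) :
    K.edgeMid i j r s ∈ K.toSet :=
  Box.update_side_mem h (Box.update_side_mem h (Box.mid_mem h) i r) j s

/-- Neighbours around the edge agree on its two fixed coordinates and on its extent in the other
directions, so they all compute the same centre. -/
theorem Mesh.edgeWeight (M : Mesh d Ω) {i j : Fin d} (hij : j ≠ i) {g : (Fin d → ℝ) → ℝ}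
    (hg : ∀ x ∈ closure Ω, 0 ≤ g x) :
    M.EdgeWeight i j fun K r s => g (K.edgeMid i j r s) := by
  refine fun K hK r s => ⟨hg _ (M.toSet_subset hK (Box.edgeMid_mem (M.lo_lt_hi K hK) i j r s)),
    fun h => ?_, fun h => ?_⟩
  · have hc := M.nbr_coords h
    have : (M.nbr K i r).edgeMid i j (!r) s = K.edgeMid i j r s := by
      funext k
      unfold Box.edgeMid
      by_cases hkj : k = j
      · subst hkj
        simp [Box.side, (hc.2 k hij).1, (hc.2 k hij).2]
      · by_cases hki : k = i
        · subst hki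
          simp [hij.symm, hc.1]
        · simp [hkj, hki, Box.mid, (hc.2 k hki).1, (hc.2 k hki).2]
    beta_reduce; rw [this]
  · have hc := M.nbr_coords h
    have : (M.nbr K j s).edgeMid i j r (!s) = K.edgeMid i j r s := by
      funext k
      unfold Box.edgeMid
      by_cases hkj : k = j
      · subst hkj
        simp [hc.1]
      · by_cases hki : k = i
        · subst hki
          simp [hij.symm, Box.side, (hc.2 k hkj).1, (hc.2 k hkj).2]
        · simp [hkj, hki, Box.mid, (hc.2 k hkj).1, (hc.2 k hkj).2]
    beta_reduce; rw [this]

namespace RegularSequence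

variable {M : ℕ → Mesh d Ω} {N : ℕ → ℕ} {δt : ℕ → ℝ} {T θ : ℝ}

/-- Difference quotients of a smooth function converge to its derivatives. -/
theorem good_quotient (h : RegularSequence M N δt T θ) {l : Filter ℕ} (hl : l ≤ atTop)
    {ψ : ℝ × (Fin d → ℝ) → ℝ} (hψ : ContDiff ℝ 2 ψ) {e : ℝ × (Fin d → ℝ)} (he : ‖e‖ = 1)
    {p : ℕ → ℕ × Box d → ℝ × (Fin d → ℝ)} {τ : ℕ → ℕ × Box d → ℝ}
    (hτ : ∀ m, ∀ k ∈ h.pieces.idx m, τ m k ≠ 0)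
    (hp : ∀ m, ∀ k ∈ h.pieces.idx m,
      p m k ∈ Set.Icc (k.1 * δt m) ((k.1 + 1) * δt m) ×ˢ k.2.toSet)
    (hp' : ∀ m, ∀ k ∈ h.pieces.idx m,
      p m k + τ m k • e ∈ Set.Icc (k.1 * δt m) ((k.1 + 1) * δt m) ×ˢ k.2.toSet) :
    h.pieces.Good l (fun m k => (ψ (p m k + τ m k • e) - ψ (p m k)) / τ m k)
      (fun z => fderiv ℝ ψ z e) := by
  obtain ⟨R, hR⟩ := h.bounded.closure.subset_closedBall 0
  -- The closure of Ω need not be convex. A large ball is, and ψ is smooth on the whole space.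
  set S : Set (ℝ × (Fin d → ℝ)) := Set.Icc 0 T ×ˢ Metric.closedBall 0 R with hS
  have hSc : IsCompact S := isCompact_Icc.prod (isCompact_closedBall 0 R)
  have hSx : Convex ℝ S := (convex_Icc 0 T).prod (convex_closedBall 0 R)
  obtain ⟨L, hL, hLb⟩ := exists_quotient_bound hψ hSc hSx
  obtain ⟨B, hB⟩ := hSc.exists_bound_of_continuousOn
    ((hψ.continuous_fderiv two_ne_zero).clm_apply (continuous_const (y := e))).continuousOn
  have hsub : ∀ m, ∀ k ∈ h.pieces.idx m,
      Set.Icc (k.1 * δt m) ((k.1 + 1) * δt m) ×ˢ k.2.toSet ⊆ S := by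
    intro m k hk
    have hk' := h.mem_idx.1 hk
    refine Set.prod_mono (Set.Icc_subset_Icc ?_ ?_) (((M m).toSet_subset hk'.2).trans hR)
    · have := h.δt_pos m
      positivity
    · rw [← h.mul_δt m]
      have : (k.1 : ℝ) + 1 ≤ N m := by exact_mod_cast hk'.1
      exact mul_le_mul_of_nonneg_right this (h.δt_pos m).le
  have hsize : ∀ m, 0 ≤ (M m).size := fun m =>
    Real.sSup_nonneg (by rintro _ ⟨K, -, rfl⟩; exact Real.sqrt_nonneg _)
  have hdist : ∀ m, ∀ k ∈ h.pieces.idx m,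
      ∀ x ∈ Set.Icc (k.1 * δt m) ((k.1 + 1) * δt m) ×ˢ k.2.toSet,
      ∀ y ∈ Set.Icc (k.1 * δt m) ((k.1 + 1) * δt m) ×ˢ k.2.toSet,
      ‖x - y‖ ≤ δt m + (M m).size := by
    intro m k hk x hx y hy
    have hδ := h.δt_pos m
    rw [← dist_eq_norm]
    refine max_le ?_ ?_
    · rw [Real.dist_eq, abs_le]
      constructor <;> linarith [hx.1.1, hx.1.2, hy.1.1, hy.1.2, hsize m]
    · linarith [(M m).dist_le (h.mem_idx.1 hk).2 hx.2 hy.2]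
  have hτle : ∀ m, ∀ k ∈ h.pieces.idx m, |τ m k| ≤ δt m + (M m).size := by
    intro m k hk
    have := hdist m k hk _ (hp' m k hk) _ (hp m k hk)
    rwa [add_sub_cancel_left, norm_smul, he, mul_one, Real.norm_eq_abs] at this
  have hb : Tendsto (fun m => L * ((δt m + (M m).size) + (δt m + (M m).size))) atTop (𝓝 0) := by
    have := h.tendsto_δt.add h.tendsto_size
    simpa using (this.add this).const_mul L
  obtain ⟨B', hB'⟩ := hb.bddAbove_range
  refine Pieces.good_of_uniform hl hb ⟨B + B', fun m k hk => ?_⟩ fun m k hk z hz => ?_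
  · have hpS := hsub m k hk (hp m k hk)
    have h1 := hLb e he.le _ hpS _ (hτ m k hk) (hsub m k hk (hp' m k hk)) _ hpS
    have h2 : |fderiv ℝ ψ (p m k) e| ≤ B := hB _ hpS
    have h3 : L * ((δt m + (M m).size) + (δt m + (M m).size)) ≤ B' :=
      hB' (Set.mem_range_self m)
    have h4 : L * (‖p m k - p m k‖ + |τ m k|) ≤
        L * ((δt m + (M m).size) + (δt m + (M m).size)) := by
      refine mul_le_mul_of_nonneg_left (add_le_add ?_ (hτle m k hk)) hL
      exact hdist m k hk _ (hp m k hk) _ (hp m k hk)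
    have h5 := abs_sub_abs_le_abs_sub ((ψ (p m k + τ m k • e) - ψ (p m k)) / τ m k)
      (fderiv ℝ ψ (p m k) e)
    linarith
  · have hz' : z ∈ Set.Icc (k.1 * δt m) ((k.1 + 1) * δt m) ×ˢ k.2.toSet :=
      ⟨Set.Ioo_subset_Icc_self hz.1, k.2.openSet_subset_toSet hz.2⟩
    refine (hLb e he.le _ (hsub m k hk (hp m k hk)) _ (hτ m k hk)
      (hsub m k hk (hp' m k hk)) z (hsub m k hk hz')).trans ?_
    exact mul_le_mul_of_nonneg_left (add_le_add (hdist m k hk _ (hp m k hk) z hz')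
      (hτle m k hk)) hL

end RegularSequence
end MAC

/-! ### Bounds on shifts, fluxes and velocity increments. -/

namespace MAC

/-- Exhibits the upwind flux as a continuous function of its arguments, despite the switch of the
upwind value at F = 0. -/
theorem upwind_eq (F a b : ℝ) : upwind F a b = pos F * a + neg F * b := by
  unfold upwind pos neg
  split_ifs with h
  · rw [abs_of_nonneg h]; ring
  · rw [abs_of_neg (not_le.1 h)]; ring

theorem upwind_mul {c : ℝ} (hc : 0 < c) (F a b : ℝ) : upwind (c * F) a b = c * upwind F a b := by
  unfold upwind
  simp only [mul_nonneg_iff_of_pos_left hc, mul_assoc]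

theorem abs_upwind_le {F a b C D : ℝ} (hF : |F| ≤ D) (ha : |a| ≤ C) (hb : |b| ≤ C) :
    |upwind F a b| ≤ D * C := by
  unfold upwind
  rw [abs_mul]
  refine mul_le_mul hF ?_ (abs_nonneg _) ((abs_nonneg _).trans hF)
  split_ifs <;> assumption

theorem abs_pos_le (a : ℝ) : |pos a| ≤ |a| := by
  unfold pos
  rw [abs_div, abs_two, div_le_iff₀ two_pos]
  exact (abs_add_le _ _).trans (by rw [abs_abs]; linarith)

theorem abs_neg_le (a : ℝ) : |neg a| ≤ |a| := by
  unfold neg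
  rw [abs_div, abs_two, div_le_iff₀ two_pos]
  exact (abs_sub _ _).trans (by rw [abs_abs]; linarith)

theorem continuous_pos : Continuous pos := by unfold pos; fun_prop

theorem continuous_neg_part : Continuous neg := by unfold neg; fun_prop

theorem abs_sgn (s : Bool) : |sgn s| = 1 := by cases s <;> simp [sgn]

variable {d : ℕ} {Ω : Set (Fin d → ℝ)}

namespace Mesh

variable (M : Mesh d Ω)

section Bounds

variable {γ ε δt κ P B S C : ℝ} {η : Face d → ℝ} {ρ ρ' : Box d → ℝ} {u u' : Face d → ℝ}

/-- The smallness of κ enters the estimates here: what crosses a face in one time step is small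
relative to the volume of the cell. -/
theorem step_mul_area_le (hκ : ∀ K ∈ M.cells, ∀ i, δt ≤ κ * K.len i) {K : Box d} (hK : K ∈ M.cells)
    (i : Fin d) (s : Bool) : δt * (K.face i s).area ≤ κ * K.vol := by
  rw [← K.area_mul_len i s]
  have := mul_le_mul_of_nonneg_right (hκ K hK i) (area_pos hK i s).le
  linarith

theorem step_mul_grad_le (hδt : 0 < δt) (hκ : ∀ K ∈ M.cells, ∀ i, δt ≤ κ * K.len i)
    {q : Box d → ℝ} (hq : ∀ K ∈ M.cells, |q K| ≤ P) {K : Box d} (hK : K ∈ M.cells)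
    (i : Fin d) (s : Bool) : δt * |M.grad q K i s| ≤ 4 * P * κ := by
  have hD := M.dualVol_pos hK i s
  have hv := M.half_vol_le_dualVol hK i s
  have ha := M.step_mul_area_le hκ hK i s
  have ha' := area_pos hK i s
  have hκ0 : 0 ≤ κ := by
    have := hδt.trans_le (hκ K hK i)
    exact (pos_of_mul_pos_left this (len_pos hK i).le).le
  have h1 : |q (M.nbr K i s) - q K| ≤ 2 * P := by
    have := abs_sub (q (M.nbr K i s)) (q K)
    linarith [hq K hK, hq _ (M.nbr_mem hK i s)]
  -- The factor 2 comes from |D_σ| ≥ |K|/2.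
  have h2 : δt * ((K.face i s).area / M.dualVol (K.face i s)) ≤ 2 * κ := by
    rw [← mul_div_assoc, div_le_iff₀ hD]
    nlinarith
  unfold grad
  rw [abs_mul, abs_mul, abs_sgn, mul_one, abs_of_pos (div_pos ha' hD), ← mul_assoc]
  calc _ ≤ 2 * κ * (2 * P) := mul_le_mul h2 h1 (abs_nonneg _) (by positivity)
    _ = _ := by ring

theorem abs_shift_le (hδt : 0 < δt) (hκ : ∀ K ∈ M.cells, ∀ i, δt ≤ κ * K.len i)
    (hη : ∀ σ ∈ M.faces, |η σ| ≤ S) (hp : ∀ K ∈ M.cells, |pressure γ (ρ K)| ≤ P)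
    {K : Box d} (hK : K ∈ M.cells) (i : Fin d) (s : Bool) :
    |M.shift γ ε δt η ρ K i s| ≤ S / ε ^ 2 * (4 * P * κ) := by
  have h1 := M.step_mul_grad_le hδt hκ hp hK i s
  have h2 := hη _ (M.face_mem hK i s)
  unfold shift
  rw [abs_mul, abs_mul, abs_sgn, mul_one, abs_div, abs_mul, abs_of_pos hδt,
    abs_of_nonneg (sq_nonneg ε)]
  calc _ = |η (K.face i s)| / ε ^ 2 * (δt * |M.grad (fun L => pressure γ (ρ L)) K i s|) := by ring
    _ ≤ _ := mul_le_mul (by gcongr) h1 (by positivity)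
        (div_nonneg ((abs_nonneg _).trans h2) (sq_nonneg _))

theorem abs_massFlux_le (hS : ∀ K ∈ M.cells, ∀ i s, |M.shift γ ε δt η ρ K i s| ≤ S)
    (hu : ∀ σ ∈ M.faces, |u σ| ≤ C) (hρ : ∀ K ∈ M.cells, |ρ K| ≤ B)
    {K : Box d} (hK : K ∈ M.cells) (i : Fin d) (s : Bool) :
    |M.massFlux γ ε δt η ρ u K i s| ≤ (K.face i s).area * (2 * B * (C + S)) := by
  have h1 : |u (K.face i s) * sgn s| ≤ C := by
    rw [abs_mul, abs_sgn, mul_one]; exact hu _ (M.face_mem hK i s)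
  have h2 := hS K hK i s
  have hp : |M.vPlus γ ε δt η ρ u K i s| ≤ C + S :=
    (abs_sub _ _).trans (add_le_add ((abs_pos_le _).trans h1) ((abs_neg_le _).trans h2))
  have hm : |M.vMinus γ ε δt η ρ u K i s| ≤ C + S :=
    (abs_sub _ _).trans (add_le_add ((abs_neg_le _).trans h1) ((abs_pos_le _).trans h2))
  have hB := (abs_nonneg _).trans (hρ K hK)
  rw [massFlux_eq, abs_mul, abs_of_pos (area_pos hK i s)]
  refine mul_le_mul_of_nonneg_left ((abs_add_le _ _).trans ?_) (area_pos hK i s).le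
  rw [abs_mul, abs_mul]
  have a1 := mul_le_mul (hρ K hK) hp (abs_nonneg _) hB
  have a2 := mul_le_mul (hρ _ (M.nbr_mem hK i s)) hm (abs_nonneg _) hB
  linarith

/-- The velocity changes little in one time step. -/
theorem abs_velocity_increment_le (hδt : 0 < δt) (hκ : ∀ K ∈ M.cells, ∀ i, δt ≤ κ * K.len i)
    {F : Box d → Fin d → Bool → ℝ} {p : Box d → ℝ} {b c : ℝ}
    (hF : ∀ K ∈ M.cells, ∀ i s, |F K i s| ≤ (K.face i s).area * B)
    (hp : ∀ K ∈ M.cells, |p K| ≤ P) (hu : ∀ σ ∈ M.faces, |u σ| ≤ C)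
    (hc : 0 < c) (hρ' : ∀ K ∈ M.cells, c ≤ ρ' K)
    (hmass : ∀ K ∈ M.cells, (ρ' K - ρ K) / δt + (∑ i, ∑ s, F K i s) / K.vol = 0)
    {K : Box d} (hK : K ∈ M.cells) {i : Fin d} (hi : M.IsInternal K i true)
    (hmom : (M.dualAvg ρ' (K.face i true) * u' (K.face i true) -
        M.dualAvg ρ (K.face i true) * u (K.face i true)) / δt +
      M.momFlux F u K i / M.dualVol (K.face i true) + b * M.grad p K i true = 0) :
    c * |u' (K.face i true) - u (K.face i true)| ≤ (8 * d * B * C + 4 * |b| * P) * κ := by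
  set L := M.nbr K i true with hLdef
  set D := M.dualVol (K.face i true) with hDdef
  have hL : L ∈ M.cells := M.nbr_mem hK i true
  have hD : 0 < D := M.dualVol_pos hK i true
  have hDeq : D = K.vol / 2 + L.vol / 2 := M.dualVol_of_isInternal hK hi
  have vK := vol_pos hK
  have vL := vol_pos hL
  have hC : 0 ≤ C := (abs_nonneg _).trans (hu _ (M.face_mem hK i true))
  have hB : 0 ≤ B := nonneg_of_mul_nonneg_right ((abs_nonneg _).trans (hF K hK i true))
    (area_pos hK i true)
  have hκ0 : 0 ≤ κ :=
    (pos_of_mul_pos_left (hδt.trans_le (hκ K hK i)) (len_pos hK i).le).le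
  have hFK : ∀ j s, δt * |F K j s| ≤ 2 * B * κ * D := fun j s => by
    have h1 := mul_le_mul_of_nonneg_left (hF K hK j s) hδt.le
    have h2 := mul_le_mul_of_nonneg_right (M.step_mul_area_le hκ hK j s) hB
    have h3 : κ * B * K.vol ≤ κ * B * (2 * D) :=
      mul_le_mul_of_nonneg_left (by linarith) (by positivity)
    linarith
  have hFL : ∀ j s, δt * |F L j s| ≤ 2 * B * κ * D := fun j s => by
    have h1 := mul_le_mul_of_nonneg_left (hF L hL j s) hδt.le
    have h2 := mul_le_mul_of_nonneg_right (M.step_mul_area_le hκ hL j s) hB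
    have h3 : κ * B * L.vol ≤ κ * B * (2 * D) :=
      mul_le_mul_of_nonneg_left (by linarith) (by positivity)
    linarith
  have hhalf : ∀ x y : ℝ, δt * |x| ≤ 2 * B * κ * D → δt * |y| ≤ 2 * B * κ * D →
      ∀ v w : ℝ, |v| ≤ C → |w| ≤ C → δt * |upwind ((x + y) / 2) v w| ≤ 2 * B * κ * D * C := by
    intro x y hx hy v w hv hw
    have h1 : |(x + y) / 2| ≤ 2 * B * κ * D / δt := by
      rw [le_div_iff₀ hδt, abs_div, abs_two]
      have := mul_le_mul_of_nonneg_right (abs_add_le x y) hδt.le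
      linarith
    have h2 := mul_le_mul_of_nonneg_left (abs_upwind_le h1 hv hw) hδt.le
    calc _ ≤ _ := h2
      _ = _ := by field_simp
  have hcard : (((Finset.univ.erase i).card : ℕ) : ℝ) = d - 1 := by
    rw [Finset.card_erase_of_mem (Finset.mem_univ i), Finset.card_univ, Fintype.card_fin,
      Nat.cast_sub (by have := i.2; omega), Nat.cast_one]
  -- One contribution for each of the 2d sides of a dual cell: two axial and 2(d - 1) transverse
  -- ones.
  have hmf : δt * |M.momFlux F u K i| ≤ 2 * d * (2 * B * κ * D * C) := by
    have huf : ∀ K' ∈ M.cells, ∀ j s, |u (K'.face j s)| ≤ C := fun K' hK' j s =>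
      hu _ (M.face_mem hK' j s)
    have h1 := hhalf (F K i false) (-F K i true) (hFK _ _) (by rw [abs_neg]; exact hFK _ _)
      (u (K.face i true)) (u (K.face i false)) (huf K hK _ _) (huf K hK _ _)
    have h2 := hhalf (F L i true) (-F L i false) (hFL _ _) (by rw [abs_neg]; exact hFL _ _)
      (u (K.face i true)) (u (L.face i true)) (huf K hK _ _) (huf L hL _ _)
    have h3 : ∀ j ∈ Finset.univ.erase i, δt * |∑ s : Bool, upwind ((F K j s + F L j s) / 2)
        (u (K.face i true)) (u (M.transFace K i j s))| ≤ 2 * (2 * B * κ * D * C) := by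
      intro j _
      have ht : ∀ s, |u (M.transFace K i j s)| ≤ C := fun s => by
        unfold transFace
        split_ifs
        · exact huf _ (M.nbr_mem hK _ _) _ _
        · exact huf _ (M.nbr_mem hL _ _) _ _
      have h4 := fun s => hhalf _ _ (hFK j s) (hFL j s) _ _ (huf K hK i true) (ht s)
      rw [Fintype.sum_bool]
      have := mul_le_mul_of_nonneg_left (abs_add_le
        (upwind ((F K j true + F L j true) / 2) (u (K.face i true)) (u (M.transFace K i j true)))
        (upwind ((F K j false + F L j false) / 2) (u (K.face i true))
          (u (M.transFace K i j false)))) hδt.le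
      linarith [h4 true, h4 false]
    have h4 : δt * |∑ j ∈ Finset.univ.erase i, ∑ s : Bool, upwind ((F K j s + F L j s) / 2)
        (u (K.face i true)) (u (M.transFace K i j s))| ≤ (d - 1) * (2 * (2 * B * κ * D * C)) := by
      refine (mul_le_mul_of_nonneg_left (Finset.abs_sum_le_sum_abs _ _) hδt.le).trans ?_
      rw [Finset.mul_sum]
      refine (Finset.sum_le_sum h3).trans ?_
      rw [Finset.sum_const, nsmul_eq_mul, hcard]
    rw [← sub_eq_add_neg] at h1 h2
    have h5 := mul_le_mul_of_nonneg_left (abs_add_three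
      (upwind ((F K i false - F K i true) / 2) (u (K.face i true)) (u (K.face i false)))
      (upwind ((F L i true - F L i false) / 2) (u (K.face i true)) (u (L.face i true)))
      (∑ j ∈ Finset.univ.erase i, ∑ s : Bool, upwind ((F K j s + F L j s) / 2)
        (u (K.face i true)) (u (M.transFace K i j s)))) hδt.le
    change δt * |M.momFlux F u K i| ≤ _ at h5
    linarith
  have hg : δt * |M.grad p K i true| ≤ 4 * P * κ := M.step_mul_grad_le hδt hκ hp hK i true
  have hsum : ∀ A : Box d, (∀ j s, δt * |F A j s| ≤ 2 * B * κ * D) →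
      δt * |∑ j, ∑ s, F A j s| ≤ 2 * d * (2 * B * κ * D) := by
    intro A hA
    refine (mul_le_mul_of_nonneg_left (Finset.abs_sum_le_sum_abs _ _) hδt.le).trans ?_
    rw [Finset.mul_sum]
    have : ∀ j ∈ (Finset.univ : Finset (Fin d)), δt * |∑ s, F A j s| ≤ 2 * (2 * B * κ * D) := by
      intro j _
      rw [Fintype.sum_bool]
      have := mul_le_mul_of_nonneg_left (abs_add_le (F A j true) (F A j false)) hδt.le
      linarith [hA j true, hA j false]
    refine (Finset.sum_le_sum this).trans ?_
    rw [Finset.sum_const, nsmul_eq_mul, Finset.card_univ, Fintype.card_fin]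
    linarith
  have hm : ∀ A ∈ M.cells, A.vol * (ρ' A - ρ A) = -(δt * ∑ j, ∑ s, F A j s) := fun A hA => by
    have h1 := hmass A hA
    have := vol_pos hA
    field_simp at h1
    linarith
  have a1 := M.dualVol_mul_dualAvg hK hi ρ'
  have a0 := M.dualVol_mul_dualAvg hK hi ρ
  -- Momentum balance minus u^n times the dual mass balance: the increment of the momentum becomes
  -- the new density times the increment of the velocity.
  have key : D * M.dualAvg ρ' (K.face i true) * (u' (K.face i true) - u (K.face i true)) =
      -(δt * M.momFlux F u K i) - b * D * (δt * M.grad p K i true) +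
      u (K.face i true) * ((δt * ∑ j, ∑ s, F K j s) / 2 + (δt * ∑ j, ∑ s, F L j s) / 2) := by
    have e1 := hm K hK
    have e2 := hm L hL
    have e3 : D * (M.dualAvg ρ' (K.face i true) - M.dualAvg ρ (K.face i true)) =
        -((δt * ∑ j, ∑ s, F K j s) / 2 + (δt * ∑ j, ∑ s, F L j s) / 2) := by
      rw [mul_sub, a1, a0]
      linarith
    field_simp at hmom
    linear_combination hmom - u (K.face i true) * e3
  have hRlow : c ≤ M.dualAvg ρ' (K.face i true) := by
    refine le_of_mul_le_mul_left ?_ hD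
    rw [a1, hDeq]
    have b1 := mul_le_mul_of_nonneg_left (hρ' K hK) vK.le
    have b2 := mul_le_mul_of_nonneg_left (hρ' L hL) vL.le
    linarith
  have hsK := hsum K hFK
  have hsL := hsum L hFL
  have hu0 := hu _ (M.face_mem hK i true)
  have habs : D * M.dualAvg ρ' (K.face i true) * |u' (K.face i true) - u (K.face i true)| ≤
      D * ((8 * d * B * C + 4 * |b| * P) * κ) := by
    have e : D * M.dualAvg ρ' (K.face i true) * |u' (K.face i true) - u (K.face i true)| =
        |D * M.dualAvg ρ' (K.face i true) * (u' (K.face i true) - u (K.face i true))| := by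
      rw [abs_mul, abs_of_pos (mul_pos hD (hc.trans_le hRlow))]
    rw [e, key]
    refine (abs_add_le _ _).trans ?_
    have t1 := abs_sub (-(δt * M.momFlux F u K i)) (b * D * (δt * M.grad p K i true))
    rw [abs_neg, abs_mul, abs_of_pos hδt, abs_mul (b * D), abs_mul δt, abs_of_pos hδt,
      abs_mul b, abs_of_pos hD] at t1
    have t2 : |u (K.face i true) * ((δt * ∑ j, ∑ s, F K j s) / 2 +
        (δt * ∑ j, ∑ s, F L j s) / 2)| ≤ C * (2 * d * (2 * B * κ * D)) := by
      rw [abs_mul]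
      refine mul_le_mul hu0 ?_ (abs_nonneg _) hC
      refine (abs_add_le _ _).trans ?_
      rw [abs_div, abs_div, abs_two, abs_mul, abs_mul, abs_of_pos hδt]
      linarith
    have t3 := mul_le_mul_of_nonneg_left hg (by positivity : 0 ≤ |b| * D)
    linarith
  rw [mul_assoc] at habs
  have := le_of_mul_le_mul_left habs hD
  exact (mul_le_mul_of_nonneg_right hRlow (abs_nonneg _)).trans this

end Bounds

end Mesh
end MAC

/-! ### Entropy fluxes per unit volume; uniform estimates for sequences of solutions. -/

namespace MAC

variable {d : ℕ} {Ω : Set (Fin d → ℝ)}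

namespace Mesh

variable (M : Mesh d Ω) {γ ε δt : ℝ} {η : Face d → ℝ} {r : Box d → ℝ} {v : Face d → ℝ}
  {φ : Box d → ℝ} {φ' : Face d → ℝ} {χ : Fin d → Fin d → Box d → Bool → Bool → ℝ}

variable (γ ε δt η r v) in
/-- The mass flux through a face per unit of area. -/
noncomputable def meanFlux (K : Box d) (i : Fin d) (s : Bool) : ℝ :=
  r K * M.vPlus γ ε δt η r v K i s + r (M.nbr K i s) * M.vMinus γ ε δt η r v K i s

/-- Since |σ| is |K| divided by the length across σ, every weight difference becomes a difference
quotient; positive homogeneity takes the area out of the upwind fluxes. -/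
theorem stepFlux_div_vol {K : Box d} (hK : K ∈ M.cells) :
    M.stepFlux γ ε δt η r v φ φ' χ K / K.vol =
      1 / ε ^ 2 * ∑ i, ∑ s : Bool, (φ K - φ' (K.face i s)) / K.len i *
        (relEnergy γ (r K) * M.vPlus γ ε δt η r v K i s +
          relEnergy γ (r (M.nbr K i s)) * M.vMinus γ ε δt η r v K i s +
          (pressure γ (r K) - 1) *
            (M.vPlus γ ε δt η r v K i s + M.vMinus γ ε δt η r v K i s)) +
      ∑ i, (φ' (K.face i true) - φ' (K.face i false)) / K.len i *
        (1 / 2 * upwind ((M.meanFlux γ ε δt η r v K i false - M.meanFlux γ ε δt η r v K i true) / 2)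
          (v (K.face i true) ^ 2) (v (K.face i false) ^ 2)) +
      ∑ i, ∑ j ∈ Finset.univ.erase i, ∑ a : Bool, ∑ s : Bool,
        (φ' (K.face i a) - χ i j K a s) / K.len j * (1 / 4 * M.meanFlux γ ε δt η r v K j s *
          M.transValue (M.massFlux γ ε δt η r v) (fun σ => v σ ^ 2) K i a j s) := by
  have hv := (vol_pos hK).ne'
  have ha : ∀ i s, (K.face i s).area = K.vol / K.len i := fun i s => by
    rw [eq_div_iff (len_pos hK i).ne', K.area_mul_len]
  have hF : ∀ i s, M.massFlux γ ε δt η r v K i s =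
      K.vol / K.len i * M.meanFlux γ ε δt η r v K i s := fun i s => by
    rw [massFlux_eq, ha]; rfl
  rw [div_eq_iff hv]
  unfold stepFlux
  rw [add_mul, add_mul]
  congr 1
  · congr 1
    · simp only [Finset.mul_sum, Finset.sum_mul]
      refine Finset.sum_congr rfl fun i _ => Finset.sum_congr rfl fun s _ => ?_
      rw [ha]
      ring
    · rw [Finset.sum_mul]
      refine Finset.sum_congr rfl fun i _ => ?_
      unfold axialFlux
      have e : (M.massFlux γ ε δt η r v K i false - M.massFlux γ ε δt η r v K i true) / 2 =
          K.vol / K.len i *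
            ((M.meanFlux γ ε δt η r v K i false - M.meanFlux γ ε δt η r v K i true) / 2) := by
        rw [hF, hF]; ring
      rw [e, upwind_mul (div_pos (vol_pos hK) (len_pos hK i))]
      ring
  · simp only [Finset.sum_mul]
    refine Finset.sum_congr rfl fun i _ => Finset.sum_congr rfl fun j _ =>
      Finset.sum_congr rfl fun a _ => Finset.sum_congr rfl fun s _ => ?_
    rw [hF]
    ring

end Mesh

theorem norm_zero_single (i : Fin d) :
    ‖((0 : ℝ), (Pi.single i (1 : ℝ) : Fin d → ℝ))‖ = 1 := by
  rw [Prod.norm_def, norm_zero, Pi.norm_single, norm_one]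
  exact max_eq_right zero_le_one

namespace RegularSequence

variable {M : ℕ → Mesh d Ω} {N : ℕ → ℕ} {δt : ℕ → ℝ} {T θ : ℝ}

section Quotients

variable (h : RegularSequence M N δt T θ) {l : Filter ℕ} (hl : l ≤ atTop)
  {ψ : ℝ × (Fin d → ℝ) → ℝ} (hψ : ContDiff ℝ 2 ψ)
include h hl hψ

/-- The points differ by the fraction c of the length while the division is by the full length: c =
±1/2 from a centre to a face or edge, c = 1 between opposite faces. -/
theorem good_space_quotient (i : Fin d) {x y : Box d → Fin d → ℝ} {c : ℝ} (hc : c ≠ 0)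
    (hx : ∀ m, ∀ K ∈ (M m).cells, x K ∈ K.toSet) (hy : ∀ m, ∀ K ∈ (M m).cells, y K ∈ K.toSet)
    (hxy : ∀ m, ∀ K ∈ (M m).cells, y K = x K + (c * K.len i) • Pi.single i (1 : ℝ)) :
    h.pieces.Good l (fun m k => (ψ ((k.1 + 1) * δt m, y k.2) - ψ ((k.1 + 1) * δt m, x k.2)) /
      k.2.len i) (fun z => c * dx ψ i z) := by
  have hδ := h.δt_pos
  have ht : ∀ (m n : ℕ), ((n : ℝ) + 1) * δt m ∈ Set.Icc (n * δt m) ((n + 1) * δt m) := fun m n =>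
    ⟨by nlinarith [hδ m], le_rfl⟩
  have e : ∀ m, ∀ k ∈ h.pieces.idx m, (((k.1 : ℝ) + 1) * δt m, x k.2) +
      (c * k.2.len i) • ((0 : ℝ), (Pi.single i (1 : ℝ) : Fin d → ℝ)) =
      (((k.1 : ℝ) + 1) * δt m, y k.2) := fun m k hk => by
    rw [hxy m _ (h.mem_idx.1 hk).2]
    ext <;> simp
  refine ((h.good_quotient hl hψ (norm_zero_single i) (p := fun m k => ((k.1 + 1) * δt m, x k.2))
    (τ := fun _ k => c * k.2.len i) (fun m k hk => ?_) (fun m k hk => ?_)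
    (fun m k hk => ?_)).const_mul c).congr (fun m k hk => ?_) fun z => rfl
  · exact mul_ne_zero hc (Mesh.len_pos (h.mem_idx.1 hk).2 i).ne'
  · exact ⟨ht m k.1, hx m _ (h.mem_idx.1 hk).2⟩
  · rw [e m k hk]
    exact ⟨ht m k.1, hy m _ (h.mem_idx.1 hk).2⟩
  · rw [e m k hk]
    have := (Mesh.len_pos (h.mem_idx.1 hk).2 i).ne'
    field_simp

theorem good_time_quotient {x : Box d → Fin d → ℝ} (hx : ∀ m, ∀ K ∈ (M m).cells, x K ∈ K.toSet) :
    h.pieces.Good l (fun m k => (ψ ((k.1 + 1) * δt m, x k.2) - ψ (k.1 * δt m, x k.2)) / δt m)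
      (dt ψ) := by
  have hδ := h.δt_pos
  have he : ‖((1 : ℝ), (0 : Fin d → ℝ))‖ = 1 := by
    rw [Prod.norm_def, norm_zero, norm_one]
    exact max_eq_left zero_le_one
  have e : ∀ (m : ℕ) (k : ℕ × Box d), ((k.1 : ℝ) * δt m, x k.2) + δt m • ((1 : ℝ), (0 : Fin d → ℝ)) =
      (((k.1 : ℝ) + 1) * δt m, x k.2) := fun m k => by
    ext <;> simp
    ring
  refine (h.good_quotient hl hψ he (p := fun m k => (k.1 * δt m, x k.2))
    (τ := fun m _ => δt m) (fun m _ _ => (hδ m).ne') (fun m k hk => ?_)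
    (fun m k hk => ?_)).congr (fun m k hk => ?_) fun z => rfl
  · exact ⟨⟨le_rfl, by nlinarith [hδ m]⟩, hx m _ (h.mem_idx.1 hk).2⟩
  · rw [e]
    exact ⟨⟨by nlinarith [hδ m], le_rfl⟩, hx m _ (h.mem_idx.1 hk).2⟩
  · rw [e]

theorem good_cell_face_quotient (i : Fin d) (s : Bool) :
    h.pieces.Good l (fun m k => (ψ ((k.1 + 1) * δt m, k.2.mid) -
      ψ ((k.1 + 1) * δt m, (k.2.face i s).mid)) / k.2.len i) (fun z => -(sgn s / 2 * dx ψ i z)) := by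
  refine (h.good_space_quotient hl hψ i (x := fun K => K.mid) (y := fun K => (K.face i s).mid)
    (c := sgn s / 2) (by cases s <;> simp [sgn]) (fun m K hK => Box.mid_mem ((M m).lo_lt_hi K hK))
    (fun m K hK => Box.mid_face_mem ((M m).lo_lt_hi K hK) i s) fun m K hK => ?_).neg.congr
    (fun m k hk => by ring) fun z => rfl
  rw [K.mid_face_eq_add]
  congr 2
  ring

theorem good_face_face_quotient (i : Fin d) :
    h.pieces.Good l (fun m k => (ψ ((k.1 + 1) * δt m, (k.2.face i true).mid) -
      ψ ((k.1 + 1) * δt m, (k.2.face i false).mid)) / k.2.len i) (dx ψ i) := by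
  refine (h.good_space_quotient hl hψ i (x := fun K => (K.face i false).mid)
    (y := fun K => (K.face i true).mid)
    (c := 1) one_ne_zero (fun m K hK => Box.mid_face_mem ((M m).lo_lt_hi K hK) i false)
    (fun m K hK => Box.mid_face_mem ((M m).lo_lt_hi K hK) i true) fun m K hK => ?_).congr
    (fun m k hk => rfl) fun z => one_mul _
  rw [K.mid_face_true_eq_add, one_mul]

theorem good_face_edge_quotient {i j : Fin d} (hij : j ≠ i) (a s : Bool) :
    h.pieces.Good l (fun m k => (ψ ((k.1 + 1) * δt m, (k.2.face i a).mid) -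
      ψ ((k.1 + 1) * δt m, k.2.edgeMid i j a s)) / k.2.len j)
      (fun z => -(sgn s / 2 * dx ψ j z)) := by
  refine (h.good_space_quotient hl hψ j (x := fun K => (K.face i a).mid)
    (y := fun K => K.edgeMid i j a s)
    (c := sgn s / 2) (by cases s <;> simp [sgn])
    (fun m K hK => Box.mid_face_mem ((M m).lo_lt_hi K hK) i a)
    (fun m K hK => Box.edgeMid_mem ((M m).lo_lt_hi K hK) i j a s) fun m K hK => ?_).neg.congr
    (fun m k hk => by ring) fun z => rfl
  rw [K.edgeMid_eq_add hij]
  congr 2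
  ring

end Quotients

end RegularSequence

/-- A sequence of discrete solutions with uniform bounds, for discretisations whose time step is
small compared with the lengths of the cells. -/
structure SolutionSequence (M : ℕ → Mesh d Ω) (N : ℕ → ℕ) (δt : ℕ → ℝ) (T θ γ ε : ℝ)
    (η : ℕ → ℕ → Face d → ℝ) (ρ₀ : (Fin d → ℝ) → ℝ) (u₀ : (Fin d → ℝ) → Fin d → ℝ)
    (ρ : ℕ → ℕ → Box d → ℝ) (u : ℕ → ℕ → Face d → ℝ) (κ : ℕ → ℝ) (c B : ℝ) : Prop
    extends RegularSequence M N δt T θ where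
  one_le_γ : 1 ≤ γ
  stabilisation : ∀ m, ∀ n < N m, ∀ σ ∈ (M m).faces, 0 ≤ η m n σ ∧ η m n σ ≤ B
  solution : ∀ m, IsSolution (M m) γ ε (δt m) (N m) (η m) ρ₀ u₀ (ρ m) (u m)
  c_pos : 0 < c
  density : ∀ m, ∀ n ≤ N m, ∀ K ∈ (M m).cells, c ≤ ρ m n K ∧ ρ m n K ≤ B
  velocity : ∀ m, ∀ n ≤ N m, ∀ σ ∈ (M m).faces, |u m n σ| ≤ B
  variation : ∀ m, ∑ n ∈ Finset.range (N m), ∑ σ ∈ (M m).faces,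
    (M m).dualVol σ * |u m (n + 1) σ - u m n σ| ≤ B
  tendsto_ratio : Tendsto κ atTop (𝓝 0)
  δt_le : ∀ m, ∀ K ∈ (M m).cells, ∀ i, δt m ≤ κ m * K.len i

namespace SolutionSequence

variable {M : ℕ → Mesh d Ω} {N : ℕ → ℕ} {δt : ℕ → ℝ} {T θ γ ε : ℝ}
  {η : ℕ → ℕ → Face d → ℝ} {ρ₀ : (Fin d → ℝ) → ℝ} {u₀ : (Fin d → ℝ) → Fin d → ℝ}
  {ρ : ℕ → ℕ → Box d → ℝ} {u : ℕ → ℕ → Face d → ℝ} {κ : ℕ → ℝ} {c B : ℝ}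
  (h : SolutionSequence M N δt T θ γ ε η ρ₀ u₀ ρ u κ c B)
include h

theorem abs_density_le {m n : ℕ} (hn : n ≤ N m) {K : Box d} (hK : K ∈ (M m).cells) :
    |ρ m n K| ≤ B := by
  have := h.density m n hn K hK
  rw [abs_of_pos (h.c_pos.trans_le this.1)]
  exact this.2

theorem exists_pressure_bound :
    ∃ P, 0 ≤ P ∧ ∀ m, ∀ n ≤ N m, ∀ K ∈ (M m).cells, |pressure γ (ρ m n K)| ≤ P := by
  obtain ⟨P, hP⟩ := (isCompact_Icc (a := c) (b := B)).exists_bound_of_continuousOn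
    (continuous_pressure h.one_le_γ).continuousOn
  exact ⟨max P 0, le_max_right _ _,
    fun m n hn K hK => (hP _ (h.density m n hn K hK)).trans (le_max_left _ _)⟩

theorem exists_shift_bound :
    ∃ A, ∀ m, ∀ n < N m, ∀ K ∈ (M m).cells, ∀ i s,
      |(M m).shift γ ε (δt m) (η m n) (ρ m (n + 1)) K i s| ≤ A * κ m := by
  obtain ⟨P, -, hP⟩ := h.exists_pressure_bound
  refine ⟨B / ε ^ 2 * (4 * P), fun m n hn K hK i s => ?_⟩
  refine ((M m).abs_shift_le (S := B) (h.δt_pos m) (h.δt_le m) (fun σ hσ => ?_) (hP m (n + 1) hn) hK i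
    s).trans_eq (by ring)
  have := h.stabilisation m n hn σ hσ
  rw [abs_of_nonneg this.1]
  exact this.2

theorem exists_flux_bound :
    ∃ A, ∀ m, ∀ n < N m, ∀ K ∈ (M m).cells, ∀ i s,
      |(M m).massFlux γ ε (δt m) (η m n) (ρ m (n + 1)) (u m n) K i s| ≤ (K.face i s).area * A := by
  obtain ⟨A, hA⟩ := h.exists_shift_bound
  obtain ⟨S, hS⟩ := (h.tendsto_ratio.const_mul A).bddAbove_range
  refine ⟨2 * B * (B + S), fun m n hn K hK i s => ?_⟩
  refine (M m).abs_massFlux_le (fun K hK i s => (hA m n hn K hK i s).trans ?_)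
    (h.velocity m n hn.le) (fun K hK => h.abs_density_le hn hK) hK i s
  exact hS (Set.mem_range_self m)

theorem ratio_nonneg {m : ℕ} {K : Box d} (hK : K ∈ (M m).cells) (i : Fin d) : 0 ≤ κ m :=
  (pos_of_mul_pos_left ((h.δt_pos m).trans_le (h.δt_le m K hK i)) (Mesh.len_pos hK i).le).le

theorem exists_increment_bound :
    ∃ A, ∀ m, ∀ n < N m, ∀ K ∈ (M m).cells, ∀ i s,
      |u m (n + 1) (K.face i s) - u m n (K.face i s)| ≤ A * κ m := by
  obtain ⟨P, hP0, hP⟩ := h.exists_pressure_bound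
  obtain ⟨F, hF⟩ := h.exists_flux_bound
  set A := (8 * d * F * B + 4 * |1 / ε ^ 2| * P) / c with hAdef
  have hc := h.c_pos
  have hint : ∀ m, ∀ n < N m, ∀ K ∈ (M m).cells, ∀ i, (M m).IsInternal K i true →
      |u m (n + 1) (K.face i true) - u m n (K.face i true)| ≤ A * κ m := by
    intro m n hn K hK i hi
    have h1 := (M m).abs_velocity_increment_le (h.δt_pos m) (h.δt_le m) (hF m n hn)
      (hP m (n + 1) hn) (h.velocity m n hn.le) hc (fun K hK => (h.density m (n + 1) hn K hK).1)
      ((h.solution m).mass n hn) hK hi ((h.solution m).momentum n hn K hK i hi)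
    rw [hAdef, div_mul_eq_mul_div, le_div_iff₀ hc]
    linarith
  refine ⟨max A 0, fun m n hn K hK i s => ?_⟩
  have hA : A * κ m ≤ max A 0 * κ m :=
    mul_le_mul_of_nonneg_right (le_max_left _ _) (h.ratio_nonneg hK i)
  -- The momentum equation is written from the lower cell, so a lower face is looked at from the
  -- neighbour; on external faces both velocities vanish.
  by_cases hi : (M m).IsInternal K i s
  · cases s
    · rw [← ((M m).nbr_spec hi).2]
      exact (hint m n hn _ ((M m).nbr_mem hK i _) i ((M m).isInternal_nbr hK hi)).trans hA
    · exact (hint m n hn K hK i hi).trans hA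
  · rw [(h.solution m).boundary (n + 1) hn K hK i s hi, (h.solution m).boundary n hn.le K hK i s hi,
      sub_zero, abs_zero]
    exact mul_nonneg (le_max_right _ _) (h.ratio_nonneg hK i)

/-- The quadratic residual of the kinetic energy balance vanishes in the limit. -/
theorem exists_residual_bound (W : ℝ) :
    ∃ A, ∀ m, ∀ φ : ℕ → Face d → ℝ,
      (∀ n < N m, ∀ σ ∈ (M m).faces, 0 ≤ φ n σ ∧ φ n σ ≤ W) →
      ∑ n ∈ Finset.range (N m), ∑ K ∈ (M m).cells, ∑ i, ∑ s : Bool, φ n (K.face i s) *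
        (K.vol / 4 * (ρ m (n + 1) K * (u m (n + 1) (K.face i s) - u m n (K.face i s)) ^ 2)) ≤
      A * |κ m| := by
  obtain ⟨A, hA⟩ := h.exists_increment_bound
  refine ⟨|W| * |B| * |A| / 2 * B, fun m φ hφ => ?_⟩
  set E := |W| * |B| * (|A| * |κ m|) / 2 with hE
  have hE0 : 0 ≤ E := by positivity
  have h1 : ∀ n ∈ Finset.range (N m), ∑ K ∈ (M m).cells, ∑ i, ∑ s : Bool, φ n (K.face i s) *
        (K.vol / 4 * (ρ m (n + 1) K * (u m (n + 1) (K.face i s) - u m n (K.face i s)) ^ 2)) ≤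
      E * ∑ σ ∈ (M m).faces, (M m).dualVol σ * |u m (n + 1) σ - u m n σ| := by
    intro n hn
    have hn := Finset.mem_range.1 hn
    rw [(M m).sum_faces_dualVol fun σ => |u m (n + 1) σ - u m n σ|]
    simp only [Finset.mul_sum]
    refine Finset.sum_le_sum fun K hK => Finset.sum_le_sum fun i _ =>
      Finset.sum_le_sum fun s _ => ?_
    have b1 := hφ n hn _ ((M m).face_mem hK i s)
    have b2 := (h.abs_density_le hn hK).trans (le_abs_self B)
    have b3 := hA m n hn K hK i s
    have b4 : |u m (n + 1) (K.face i s) - u m n (K.face i s)| ≤ |A| * |κ m| := by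
      rw [← abs_mul]; exact b3.trans (le_abs_self _)
    have b5 := Mesh.vol_pos hK
    have b6 := (h.density m (n + 1) hn K hK)
    have b7 := h.c_pos.trans_le b6.1
    have b8 : φ n (K.face i s) ≤ |W| := b1.2.trans (le_abs_self _)
    rw [← sq_abs]
    set x := |u m (n + 1) (K.face i s) - u m n (K.face i s)|
    have hx : 0 ≤ x := abs_nonneg _
    -- One factor of the squared increment is uniformly small, the other is left for the BV bound.
    calc _ = (φ n (K.face i s) * ρ m (n + 1) K * x) * (K.vol / 4 * x) := by ring
      _ ≤ (|W| * |B| * (|A| * |κ m|)) * (K.vol / 4 * x) := by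
          refine mul_le_mul_of_nonneg_right ?_ (by positivity)
          have := b1.1
          have := (le_abs_self _).trans b2
          gcongr
      _ = _ := by rw [hE]; ring
  refine (Finset.sum_le_sum h1).trans ?_
  rw [← Finset.mul_sum]
  refine (mul_le_mul_of_nonneg_left (h.variation m) hE0).trans_eq ?_
  rw [hE]
  ring

end SolutionSequence
end MAC

/-! ### Limits of the fluxes and the summed energy inequality. -/

namespace MAC

variable {d : ℕ} {Ω : Set (Fin d → ℝ)}

namespace SolutionSequence

variable {M : ℕ → Mesh d Ω} {N : ℕ → ℕ} {δt : ℕ → ℝ} {T θ γ ε : ℝ}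
  {η : ℕ → ℕ → Face d → ℝ} {ρ₀ : (Fin d → ℝ) → ℝ} {u₀ : (Fin d → ℝ) → Fin d → ℝ}
  {ρ : ℕ → ℕ → Box d → ℝ} {u : ℕ → ℕ → Face d → ℝ} {κ : ℕ → ℝ} {c B : ℝ}

/-- Almost everywhere convergence of the discrete unknowns, also of those of the next time level and
of the neighbouring cells, along the filter `l`. -/
structure Limit (h : SolutionSequence M N δt T θ γ ε η ρ₀ u₀ ρ u κ c B) (l : Filter ℕ)
    (r : ℝ × (Fin d → ℝ) → ℝ) (v : ℝ × (Fin d → ℝ) → Fin d → ℝ) : Prop where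
  density : h.pieces.Good l (fun m k => ρ m k.1 k.2) r
  density_succ : h.pieces.Good l (fun m k => ρ m (k.1 + 1) k.2) r
  density_nbr : ∀ i s, h.pieces.Good l (fun m k => ρ m (k.1 + 1) ((M m).nbr k.2 i s)) r
  velocity : ∀ i s, h.pieces.Good l (fun m k => u m k.1 (k.2.face i s)) (fun z => v z i)
  velocity_nbr : ∀ i a j s, h.pieces.Good l (fun m k => u m k.1 (((M m).nbr k.2 j s).face i a))
    (fun z => v z i)

/-- The stabilisation is of order κ uniformly, so it leaves no trace in the limit. -/
theorem good_shift (h : SolutionSequence M N δt T θ γ ε η ρ₀ u₀ ρ u κ c B) {l : Filter ℕ}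
    (hl : l ≤ atTop) (i : Fin d) (s : Bool) :
    h.pieces.Good l (fun m k => (M m).shift γ ε (δt m) (η m k.1) (ρ m (k.1 + 1)) k.2 i s)
      (fun _ => 0) := by
  obtain ⟨A, hA⟩ := h.exists_shift_bound
  have hb := h.tendsto_ratio.const_mul A
  rw [mul_zero] at hb
  obtain ⟨C, hC⟩ := hb.bddAbove_range
  refine Pieces.good_of_uniform hl hb ⟨C, fun m k hk => ?_⟩ fun m k hk z _ => ?_
  · exact (hA m k.1 (h.mem_idx.1 hk).1 _ (h.mem_idx.1 hk).2 i s).trans (hC (Set.mem_range_self m))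
  · rw [sub_zero]
    exact hA m k.1 (h.mem_idx.1 hk).1 _ (h.mem_idx.1 hk).2 i s

section

variable {h : SolutionSequence M N δt T θ γ ε η ρ₀ u₀ ρ u κ c B} {l : Filter ℕ}
  {r : ℝ × (Fin d → ℝ) → ℝ} {v : ℝ × (Fin d → ℝ) → Fin d → ℝ}
  (hlim : h.Limit l r v) (hl : l ≤ atTop)
include hlim hl

theorem Limit.good_vPlus (i : Fin d) (s : Bool) :
    h.pieces.Good l (fun m k => (M m).vPlus γ ε (δt m) (η m k.1) (ρ m (k.1 + 1)) (u m k.1) k.2 i s)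
      (fun z => pos (v z i * sgn s)) :=
  ((((hlim.velocity i s).mul (Pieces.good_const (sgn s))).comp continuous_pos).sub
    ((h.good_shift hl i s).comp continuous_neg_part)).congr (fun _ _ _ => rfl)
    fun z => by simp [neg]

theorem Limit.good_vMinus (i : Fin d) (s : Bool) :
    h.pieces.Good l (fun m k => (M m).vMinus γ ε (δt m) (η m k.1) (ρ m (k.1 + 1)) (u m k.1) k.2 i s)
      (fun z => neg (v z i * sgn s)) :=
  ((((hlim.velocity i s).mul (Pieces.good_const (sgn s))).comp continuous_neg_part).sub
    ((h.good_shift hl i s).comp continuous_pos)).congr (fun _ _ _ => rfl)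
    fun z => by simp [pos]

theorem Limit.good_meanFlux (i : Fin d) (s : Bool) :
    h.pieces.Good l (fun m k =>
      (M m).meanFlux γ ε (δt m) (η m k.1) (ρ m (k.1 + 1)) (u m k.1) k.2 i s)
      (fun z => r z * v z i * sgn s) :=
  ((hlim.density_succ.mul (hlim.good_vPlus hl i s)).add
    ((hlim.density_nbr i s).mul (hlim.good_vMinus hl i s))).congr (fun _ _ _ => rfl) fun z => by
      rw [← mul_add, pos_add_neg]; ring

theorem Limit.good_internal (i : Fin d) (s : Bool) :
    h.pieces.Good l (fun m k =>
      relEnergy γ (ρ m (k.1 + 1) k.2) *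
          (M m).vPlus γ ε (δt m) (η m k.1) (ρ m (k.1 + 1)) (u m k.1) k.2 i s +
        relEnergy γ (ρ m (k.1 + 1) ((M m).nbr k.2 i s)) *
          (M m).vMinus γ ε (δt m) (η m k.1) (ρ m (k.1 + 1)) (u m k.1) k.2 i s +
        (pressure γ (ρ m (k.1 + 1) k.2) - 1) *
          ((M m).vPlus γ ε (δt m) (η m k.1) (ρ m (k.1 + 1)) (u m k.1) k.2 i s +
            (M m).vMinus γ ε (δt m) (η m k.1) (ρ m (k.1 + 1)) (u m k.1) k.2 i s))
      (fun z => (relEnergy γ (r z) + (pressure γ (r z) - 1)) * (v z i * sgn s)) := by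
  have hG := continuous_relEnergy h.one_le_γ
  have hp := continuous_pressure h.one_le_γ
  refine (((hlim.density_succ.comp hG).mul (hlim.good_vPlus hl i s)).add
    (((hlim.density_nbr i s).comp hG).mul (hlim.good_vMinus hl i s)) |>.add
    (((hlim.density_succ.comp hp).sub (Pieces.good_const 1)).mul
      ((hlim.good_vPlus hl i s).add (hlim.good_vMinus hl i s)))).congr (fun _ _ _ => rfl)
    fun z => ?_
  rw [← mul_add, pos_add_neg]
  ring

/-- Outward fluxes through opposite faces tend to opposite limits, so half of their difference tends
to -r v_i; both candidates for the upwind value tend to v_i². -/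
theorem Limit.good_axial (i : Fin d) :
    h.pieces.Good l (fun m k => upwind
      (((M m).meanFlux γ ε (δt m) (η m k.1) (ρ m (k.1 + 1)) (u m k.1) k.2 i false -
        (M m).meanFlux γ ε (δt m) (η m k.1) (ρ m (k.1 + 1)) (u m k.1) k.2 i true) / 2)
      (u m k.1 (k.2.face i true) ^ 2) (u m k.1 (k.2.face i false) ^ 2))
      (fun z => -(r z * v z i * v z i ^ 2)) := by
  have hf := ((hlim.good_meanFlux hl i false).sub (hlim.good_meanFlux hl i true)).const_mul (1 / 2)
  have hsq : Continuous fun x : ℝ => x ^ 2 := by fun_prop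
  refine (((hf.comp continuous_pos).mul ((hlim.velocity i true).comp hsq)).add
    ((hf.comp continuous_neg_part).mul ((hlim.velocity i false).comp hsq))).congr
    (fun m k _ => ?_) fun z => ?_
  · rw [upwind_eq, one_div, inv_mul_eq_div]
  · rw [← add_mul, pos_add_neg]
    simp only [sgn, if_true, if_false, Bool.false_eq_true]
    ring

/-- The selected face may vary with m and with the cell, but both candidates have the same limit. -/
theorem Limit.good_transverse (i j : Fin d) (a s : Bool) :
    h.pieces.Good l (fun m k =>
      1 / 4 * (M m).meanFlux γ ε (δt m) (η m k.1) (ρ m (k.1 + 1)) (u m k.1) k.2 j s *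
        (M m).transValue ((M m).massFlux γ ε (δt m) (η m k.1) (ρ m (k.1 + 1)) (u m k.1))
          (fun σ => u m k.1 σ ^ 2) k.2 i a j s)
      (fun z => 1 / 4 * (r z * v z j * sgn s) * v z i ^ 2) := by
  have hsq : Continuous fun x : ℝ => x ^ 2 := by fun_prop
  refine ((hlim.good_meanFlux hl j s).const_mul (1 / 4)).mul
    (((hlim.velocity i a).comp hsq).either ((hlim.velocity_nbr i a j s).comp hsq)
      fun m k _ => ?_)
  unfold Mesh.transValue
  split_ifs
  · exact Or.inr rfl
  · exact Or.inl rfl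

/-- Every term is a convergent difference quotient times a convergent flux; the rest is the algebra
that assembles the limits into the entropy flux. -/
theorem Limit.good_stepFlux {ψ : ℝ × (Fin d → ℝ) → ℝ} (hψ : ContDiff ℝ 2 ψ) :
    h.pieces.Good l (fun m k => (M m).stepFlux γ ε (δt m) (η m k.1) (ρ m (k.1 + 1)) (u m k.1)
      (fun K => ψ ((k.1 + 1) * δt m, K.mid)) (fun σ => ψ ((k.1 + 1) * δt m, σ.mid))
      (fun i j K a s => ψ ((k.1 + 1) * δt m, K.edgeMid i j a s)) k.2 / k.2.vol)
      (fun z => -(entropyFlux γ ε (r z) (v z) * ∑ i, v z i * dx ψ i z)) := by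
  have g1 := (Pieces.Good.sum Finset.univ fun i _ => Pieces.Good.sum Finset.univ fun s _ =>
    (h.good_cell_face_quotient hl hψ i s).mul (hlim.good_internal hl i s)).const_mul (1 / ε ^ 2)
  have g2 := Pieces.Good.sum Finset.univ fun i _ => (h.good_face_face_quotient hl hψ i).mul
    ((hlim.good_axial hl i).const_mul (1 / 2))
  have g3 := Pieces.Good.sum Finset.univ fun i _ => Pieces.Good.sum (Finset.univ.erase i)
    fun j hj => Pieces.Good.sum Finset.univ fun a _ => Pieces.Good.sum Finset.univ fun s _ =>
      (h.good_face_edge_quotient hl hψ (Finset.ne_of_mem_erase hj) a s).mul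
        (hlim.good_transverse hl i j a s)
  refine ((g1.add g2).add g3).congr (fun m k hk => ?_) fun z => ?_
  · rw [(M m).stepFlux_div_vol (h.mem_idx.1 hk).2]
  rw [entropyFlux_eq]
  have e1 : ∀ i, ∑ s : Bool, -(sgn s / 2 * dx ψ i z) *
      ((relEnergy γ (r z) + (pressure γ (r z) - 1)) * (v z i * sgn s)) =
      -((relEnergy γ (r z) + (pressure γ (r z) - 1)) * (v z i * dx ψ i z)) := fun i => by
    simp only [Fintype.sum_bool, sgn, if_true, if_false, Bool.false_eq_true]
    ring
  -- The transverse terms give the transport of v_i² in the directions j ≠ i. The diagonal term,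
  -- added here to complete the sum over j, is removed by the axial part `e3`.
  have e2 : ∀ i, ∑ j ∈ Finset.univ.erase i, ∑ a : Bool, ∑ s : Bool,
      -(sgn s / 2 * dx ψ j z) * (1 / 4 * (r z * v z j * sgn s) * v z i ^ 2) =
      ∑ j, -(1 / 2 * r z * v z i ^ 2 * (v z j * dx ψ j z)) +
        1 / 2 * r z * v z i ^ 2 * (v z i * dx ψ i z) := fun i => by
    rw [← Finset.add_sum_erase Finset.univ _ (Finset.mem_univ i)]
    have : ∀ j ∈ Finset.univ.erase i, ∑ a : Bool, ∑ s : Bool,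
        -(sgn s / 2 * dx ψ j z) * (1 / 4 * (r z * v z j * sgn s) * v z i ^ 2) =
        -(1 / 2 * r z * v z i ^ 2 * (v z j * dx ψ j z)) := fun j _ => by
      simp only [Fintype.sum_bool, sgn, if_true, if_false, Bool.false_eq_true]
      ring
    rw [Finset.sum_congr rfl this]
    ring
  have e4 : ∑ i, (∑ j, -(1 / 2 * r z * v z i ^ 2 * (v z j * dx ψ j z)) +
      1 / 2 * r z * v z i ^ 2 * (v z i * dx ψ i z)) =
      -(1 / 2 * r z * (∑ i, v z i ^ 2) * ∑ j, v z j * dx ψ j z) +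
      ∑ i, 1 / 2 * r z * v z i ^ 2 * (v z i * dx ψ i z) := by
    rw [Finset.sum_add_distrib, Finset.mul_sum Finset.univ (fun i => v z i ^ 2), Finset.sum_mul,
      ← Finset.sum_neg_distrib]
    congr 1
    refine Finset.sum_congr rfl fun i _ => ?_
    rw [Finset.sum_neg_distrib, Finset.mul_sum]
  have e3 : ∑ i, dx ψ i z * (1 / 2 * -(r z * v z i * v z i ^ 2)) =
      -∑ i, 1 / 2 * r z * v z i ^ 2 * (v z i * dx ψ i z) := by
    rw [← Finset.sum_neg_distrib]
    exact Finset.sum_congr rfl fun i _ => by ring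
  rw [Finset.sum_congr rfl fun i _ => e1 i, Finset.sum_congr rfl fun i _ => e2 i, e3, e4,
    Finset.sum_neg_distrib, ← Finset.mul_sum]
  ring

/-- The limit of the time difference quotients of the weights. -/
theorem Limit.good_time {ψ : ℝ × (Fin d → ℝ) → ℝ} (hψ : ContDiff ℝ 2 ψ) :
    h.pieces.Good l (fun m k =>
      1 / ε ^ 2 * (relEnergy γ (ρ m k.1 k.2) *
        ((ψ ((k.1 + 1) * δt m, k.2.mid) - ψ (k.1 * δt m, k.2.mid)) / δt m)) +
      ∑ i, ∑ s : Bool, 1 / 4 * (ρ m k.1 k.2 * u m k.1 (k.2.face i s) ^ 2 *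
        ((ψ ((k.1 + 1) * δt m, (k.2.face i s).mid) - ψ (k.1 * δt m, (k.2.face i s).mid)) / δt m)))
      (fun z => entropy γ ε (r z) (v z) * dt ψ z) := by
  have hG := continuous_relEnergy h.one_le_γ
  have hsq : Continuous fun x : ℝ => x ^ 2 := by fun_prop
  refine ((((hlim.density.comp hG).mul (h.good_time_quotient hl hψ
      fun m K hK => Box.mid_mem ((M m).lo_lt_hi K hK))).const_mul (1 / ε ^ 2)).add
    (Pieces.Good.sum Finset.univ fun i _ => Pieces.Good.sum Finset.univ fun s _ =>
      ((hlim.density.mul ((hlim.velocity i s).comp hsq)).mul (h.good_time_quotient hl hψ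
        fun m K hK => Box.mid_face_mem ((M m).lo_lt_hi K hK) i s)).const_mul (1 / 4))).congr
    (fun _ _ _ => rfl) fun z => ?_
  simp only [Fintype.sum_bool]
  unfold entropy
  have e : ∑ i, (1 / 4 * (r z * v z i ^ 2 * dt ψ z) + 1 / 4 * (r z * v z i ^ 2 * dt ψ z)) =
      1 / 2 * r z * dt ψ z * ∑ i, v z i ^ 2 := by
    rw [Finset.mul_sum]
    exact Finset.sum_congr rfl fun i _ => by ring
  rw [e]
  ring

end

/-- The energy of the time level `n`, weighted by `ψ` at the time `t`. -/
noncomputable def energy (γ ε : ℝ) (M : Mesh d Ω) (ρ : Box d → ℝ) (u : Face d → ℝ)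
    (ψ : (Fin d → ℝ) → ℝ) : ℝ :=
  ∑ K ∈ M.cells, (1 / ε ^ 2 * (ψ K.mid * (K.vol * relEnergy γ (ρ K))) +
    ∑ i, ∑ s : Bool, ψ (K.face i s).mid * (K.vol / 4 * (ρ K * u (K.face i s) ^ 2)))

/-- The discrete energy inequality, summed over all time steps. -/
theorem sum_energy_le (h : SolutionSequence M N δt T θ γ ε η ρ₀ u₀ ρ u κ c B)
    {ψ : ℝ × (Fin d → ℝ) → ℝ} (hψ : ∀ t ∈ Set.Icc 0 T, ∀ x ∈ closure Ω, 0 ≤ ψ (t, x))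
    (hψT : ∀ x ∈ closure Ω, ψ (T, x) = 0) (m : ℕ) :
    ∑ k ∈ h.pieces.idx m, (volume.restrict (Set.Ioo 0 T ×ˢ closure Ω)).real (h.pieces.piece m k) *
      ((M m).stepFlux γ ε (δt m) (η m k.1) (ρ m (k.1 + 1)) (u m k.1)
      (fun K => ψ ((k.1 + 1) * δt m, K.mid)) (fun σ => ψ ((k.1 + 1) * δt m, σ.mid))
      (fun i j K a s => ψ ((k.1 + 1) * δt m, K.edgeMid i j a s)) k.2 / k.2.vol -
      (1 / ε ^ 2 * (relEnergy γ (ρ m k.1 k.2) *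
        ((ψ ((k.1 + 1) * δt m, k.2.mid) - ψ (k.1 * δt m, k.2.mid)) / δt m)) +
      ∑ i, ∑ s : Bool, 1 / 4 * (ρ m k.1 k.2 * u m k.1 (k.2.face i s) ^ 2 *
        ((ψ ((k.1 + 1) * δt m, (k.2.face i s).mid) -
          ψ (k.1 * δt m, (k.2.face i s).mid)) / δt m)))) ≤
    energy γ ε (M m) (ρ m 0) (u m 0) (fun x => ψ (0, x)) +
    ∑ n ∈ Finset.range (N m), ∑ K ∈ (M m).cells, ∑ i, ∑ s : Bool,
      ψ ((n + 1) * δt m, (K.face i s).mid) *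
        (K.vol / 4 * (ρ m (n + 1) K * (u m (n + 1) (K.face i s) - u m n (K.face i s)) ^ 2)) := by
  have hδ := h.δt_pos m
  set E : ℕ → ℝ := fun n => energy γ ε (M m) (ρ m n) (u m n) (fun x => ψ (n * δt m, x)) with hE
  have hface : ∀ σ ∈ (M m).faces, σ.mid ∈ closure Ω := by
    intro σ hσ
    classical
    unfold Mesh.faces at hσ
    simp only [Finset.mem_biUnion, Finset.mem_image] at hσ
    obtain ⟨K, hK, p, -, rfl⟩ := hσ
    exact (M m).toSet_subset hK (Box.mid_face_mem ((M m).lo_lt_hi K hK) p.1 p.2)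
  have hcell : ∀ K ∈ (M m).cells, K.mid ∈ closure Ω := fun K hK =>
    (M m).toSet_subset hK (Box.mid_mem ((M m).lo_lt_hi K hK))
  -- The last time level is T, where the test function vanishes.
  have hEN : E (N m) = 0 := by
    simp only [hE, energy, h.mul_δt]
    refine Finset.sum_eq_zero fun K hK => ?_
    simp only [hψT _ (hcell K hK), hψT _ (hface _ ((M m).face_mem hK _ _))]
    simp
  have hE0 : E 0 = energy γ ε (M m) (ρ m 0) (u m 0) (fun x => ψ (0, x)) := by
    simp [hE]
  -- Discrete product rule a G₁ - b G₀ = a (G₁ - G₀) + (a - b) G₀: the weights of the balance belong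
  -- to the new level, and the differences of ψ multiply the old energy.
  have alg : ∀ X Y Z S G₁ G₀ a b V : ℝ, V ≠ 0 →
      1 / ε ^ 2 * (a * (V * G₁)) + X - (1 / ε ^ 2 * (b * (V * G₀)) + Y) +
        δt m * V * (S / V - (1 / ε ^ 2 * (G₀ * ((a - b) / δt m)) + Z)) =
      1 / ε ^ 2 * (a * (V * (G₁ - G₀))) + (X - Y - δt m * V * Z) + δt m * S := by
    intro X Y Z S G₁ G₀ a b V hV
    generalize 1 / ε ^ 2 = w
    field_simp
    ring
  have hstep : ∀ n ∈ Finset.range (N m), E (n + 1) - E n +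
      ∑ K ∈ (M m).cells, (volume.restrict (Set.Ioo 0 T ×ˢ closure Ω)).real
        (h.pieces.piece m (n, K)) *
      ((M m).stepFlux γ ε (δt m) (η m n) (ρ m (n + 1)) (u m n)
      (fun K => ψ ((n + 1) * δt m, K.mid)) (fun σ => ψ ((n + 1) * δt m, σ.mid))
      (fun i j K a s => ψ ((n + 1) * δt m, K.edgeMid i j a s)) K / K.vol -
      (1 / ε ^ 2 * (relEnergy γ (ρ m n K) *
        ((ψ ((n + 1) * δt m, K.mid) - ψ (n * δt m, K.mid)) / δt m)) +
      ∑ i, ∑ s : Bool, 1 / 4 * (ρ m n K * u m n (K.face i s) ^ 2 *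
        ((ψ ((n + 1) * δt m, (K.face i s).mid) -
          ψ (n * δt m, (K.face i s).mid)) / δt m)))) ≤
      ∑ K ∈ (M m).cells, ∑ i, ∑ s : Bool,
      ψ ((n + 1) * δt m, (K.face i s).mid) *
        (K.vol / 4 * (ρ m (n + 1) K * (u m (n + 1) (K.face i s) - u m n (K.face i s)) ^ 2)) := by
    intro n hn
    have hn := Finset.mem_range.1 hn
    have ht : ((n : ℝ) + 1) * δt m ∈ Set.Icc 0 T := by
      refine ⟨by positivity, ?_⟩
      rw [← h.mul_δt m]
      have : (n : ℝ) + 1 ≤ N m := by exact_mod_cast hn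
      exact mul_le_mul_of_nonneg_right this hδ.le
    have hpos : ∀ k ≤ N m, ∀ K ∈ (M m).cells, 0 < ρ m k K := fun k hk K hK =>
      h.c_pos.trans_le (h.density m k hk K hK).1
    refine le_trans (le_of_eq ?_) ((M m).sum_energy_step (ε := ε) h.one_le_γ hδ
      (fun σ hσ => (h.stabilisation m n hn σ hσ).1) (hpos (n + 1) hn) (hpos n hn.le)
      ((h.solution m).boundary (n + 1) hn) ((h.solution m).boundary n hn.le)
      ((h.solution m).mass n hn) ((h.solution m).momentum n hn)
      (φ := fun K => ψ ((n + 1) * δt m, K.mid)) (φ' := fun σ => ψ ((n + 1) * δt m, σ.mid))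
      (χ := fun i j K a s => ψ ((n + 1) * δt m, K.edgeMid i j a s))
      (fun K hK => hψ _ ht _ (hcell K hK)) (fun σ hσ => hψ _ ht _ (hface σ hσ))
      fun i j hij => (M m).edgeWeight hij (g := fun x => ψ ((n + 1) * δt m, x))
        fun x hx => hψ _ ht x hx)
    simp only [hE, energy]
    rw [← Finset.sum_sub_distrib, ← Finset.sum_add_distrib]
    refine Finset.sum_congr rfl fun K hK => ?_
    have hv := (Mesh.vol_pos hK).ne'
    rw [h.measure_piece (h.mem_idx.2 ⟨hn, hK⟩)]
    push_cast
    have e : ∑ i, ∑ s : Bool, ψ ((n + 1) * δt m, (K.face i s).mid) * (K.vol / 4 *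
          (ρ m (n + 1) K * u m (n + 1) (K.face i s) ^ 2 - ρ m n K * u m n (K.face i s) ^ 2)) =
        ∑ i, ∑ s : Bool, ψ ((n + 1) * δt m, (K.face i s).mid) *
          (K.vol / 4 * (ρ m (n + 1) K * u m (n + 1) (K.face i s) ^ 2)) -
        ∑ i, ∑ s : Bool, ψ (n * δt m, (K.face i s).mid) *
          (K.vol / 4 * (ρ m n K * u m n (K.face i s) ^ 2)) -
        δt m * K.vol * ∑ i, ∑ s : Bool, 1 / 4 * (ρ m n K * u m n (K.face i s) ^ 2 *
        ((ψ ((n + 1) * δt m, (K.face i s).mid) - ψ (n * δt m, (K.face i s).mid)) / δt m)) := by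
      simp only [Finset.mul_sum, ← Finset.sum_sub_distrib]
      refine Finset.sum_congr rfl fun i _ => Finset.sum_congr rfl fun s _ => ?_
      field_simp
      ring
    rw [e]
    exact alg _ _ _ _ _ _ _ _ _ hv
  have hsum := Finset.sum_le_sum hstep
  rw [Finset.sum_add_distrib, Finset.sum_range_sub, hEN, hE0] at hsum
  have hidx : h.pieces.idx m = Finset.range (N m) ×ˢ (M m).cells := rfl
  rw [hidx, Finset.sum_product]
  linarith

end SolutionSequence
end MAC

/-! ### Initial data, extraction of subsequences, passage to the limit. -/

namespace MAC

variable {d : ℕ} {Ω : Set (Fin d → ℝ)}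

theorem Mesh.exists_average_bound {Ω : Set (Fin d → ℝ)} {f : (Fin d → ℝ) → ℝ}
    (hf : MemLp f ⊤ (volume.restrict (closure Ω))) :
    ∃ C, ∀ M : Mesh d Ω, ∀ K ∈ M.cells, |(∫ x in K.toSet, f x) / K.vol| ≤ C := by
  obtain ⟨C, hC⟩ : ∃ C, ∀ᵐ x ∂(volume.restrict (closure Ω)), ‖f x‖ ≤ C := by
    have hfin : eLpNormEssSup f (volume.restrict (closure Ω)) ≠ ⊤ := by
      simpa using hf.eLpNorm_ne_top
    refine ⟨(eLpNormEssSup f (volume.restrict (closure Ω))).toReal,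
      (ae_le_eLpNormEssSup (f := f)).mono fun x hx => ?_⟩
    simpa using ENNReal.toReal_mono hfin hx
  refine ⟨C, fun M K hK => ?_⟩
  have hv := Mesh.vol_pos hK
  rw [abs_div, abs_of_pos hv, div_le_iff₀ hv]
  have hvol : volume.real K.toSet = K.vol := by
    rw [← Box.volume_openSet (M.lo_lt_hi K hK)]
    exact (measureReal_congr K.openSet_ae_eq).symm
  rw [← hvol, ← Real.norm_eq_abs]
  refine norm_setIntegral_le_of_norm_le_const_ae' ?_ ?_
  · exact (isCompact_Icc (a := K.lo) (b := K.hi)).measure_lt_top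
  · rw [ae_restrict_iff' isClosed_closure.measurableSet] at hC
    filter_upwards [hC] with x hx hxK
    exact hx (M.toSet_subset hK hxK)

theorem isFiniteMeasure_closure (hb : Bornology.IsBounded Ω) :
    IsFiniteMeasure (volume.restrict (closure Ω)) :=
  ⟨by rw [Measure.restrict_apply_univ]; exact hb.closure.measure_lt_top⟩

theorem RegularSequence.good_space {M : ℕ → Mesh d Ω} {N : ℕ → ℕ} {δt : ℕ → ℝ} {T θ : ℝ}
    (h : RegularSequence M N δt T θ) {l : Filter ℕ} (hl : l ≤ atTop) {g : (Fin d → ℝ) → ℝ}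
    (hg : ContDiff ℝ 1 g) {x : Box d → Fin d → ℝ} (hx : ∀ m, ∀ K ∈ (M m).cells, x K ∈ K.toSet) :
    (spacePieces M).Good l (fun _ K => g (x K)) g := by
  obtain ⟨R, hR⟩ := h.bounded.closure.subset_closedBall 0
  obtain ⟨L, hL, hLip⟩ := exists_lipschitz_bound hg (isCompact_closedBall (0 : Fin d → ℝ) R)
    (convex_closedBall _ _)
  obtain ⟨C, hC⟩ := (isCompact_closedBall (0 : Fin d → ℝ) R).exists_bound_of_continuousOn
    hg.continuous.continuousOn
  have hb : Tendsto (fun m => L * (M m).size) atTop (𝓝 0) := by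
    simpa using h.tendsto_size.const_mul L
  refine Pieces.good_of_uniform hl hb ⟨C, fun m K hK => ?_⟩ fun m K hK z hz => ?_
  · exact hC _ (hR ((M m).toSet_subset hK (hx m K hK)))
  · have hzK := K.openSet_subset_toSet hz
    have h1 := hLip _ (hR ((M m).toSet_subset hK (hx m K hK))) _ (hR ((M m).toSet_subset hK hzK))
    rw [Real.norm_eq_abs] at h1
    refine h1.trans (mul_le_mul_of_nonneg_left ?_ hL)
    rw [← dist_eq_norm]
    exact (M m).dist_le hK (hx m K hK) hzK

namespace SolutionSequence

variable {M : ℕ → Mesh d Ω} {N : ℕ → ℕ} {δt : ℕ → ℝ} {T θ γ ε : ℝ}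
  {η : ℕ → ℕ → Face d → ℝ} {ρ₀ : (Fin d → ℝ) → ℝ} {u₀ : (Fin d → ℝ) → Fin d → ℝ}
  {ρ : ℕ → ℕ → Box d → ℝ} {u : ℕ → ℕ → Face d → ℝ} {κ : ℕ → ℝ} {c B : ℝ}
  (h : SolutionSequence M N δt T θ γ ε η ρ₀ u₀ ρ u κ c B)
include h

/-- Finitely many families converge in L¹, so successive extraction gives one filter that serves all
of them. -/
theorem exists_limit (hθ : 0 ≤ θ) {r : ℝ × (Fin d → ℝ) → ℝ} {v : ℝ × (Fin d → ℝ) → Fin d → ℝ}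
    (hr : Integrable r (volume.restrict (Set.Ioo 0 T ×ˢ closure Ω)))
    (hv : ∀ i, Integrable (fun z => v z i) (volume.restrict (Set.Ioo 0 T ×ˢ closure Ω)))
    (hρ : Tendsto (fun m => eLpNorm (fun z => (M m).density (δt m) (ρ m) z - r z) 1
      (volume.restrict (Set.Ioo 0 T ×ˢ closure Ω))) atTop (𝓝 0))
    (hu : ∀ i, Tendsto (fun m => eLpNorm (fun z => (M m).velocity (δt m) (u m) z i - v z i) 1
      (volume.restrict (Set.Ioo 0 T ×ˢ closure Ω))) atTop (𝓝 0)) {C : ℝ}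
    (hC : ∀ m, ∑ n ∈ Finset.range (N m), ∑ K ∈ (M m).cells,
      K.vol * |ρ m (n + 1) K - ρ m n K| ≤ C) :
    ∃ l ≤ atTop, l.NeBot ∧ l.IsCountablyGenerated ∧ h.Limit l r v := by
  have := h.isFiniteMeasure
  have c0 := h.lconv_density hr hρ
  have c1 := h.lconv_succ hr c0 hC
  have c2 := fun i s => h.lconv_nbr hθ hr c1 i s
  have c3 := fun i s => h.lconv_velocity (hv i) h.velocity (hu i) s
  have c4 := fun i a j s => h.lconv_nbr hθ (hv i) (c3 i a) j s
  have bρ : ∀ m n, n ≤ N m → ∀ K ∈ (M m).cells, |ρ m n K| ≤ B := fun m n hn K hK =>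
    h.abs_density_le hn hK
  have bu : ∀ m n, n ≤ N m → ∀ K ∈ (M m).cells, ∀ i s, |u m n (K.face i s)| ≤ B :=
    fun m n hn K hK i s => h.velocity m n hn _ ((M m).face_mem hK i s)
  obtain ⟨l₀, l0, _, _, g0⟩ := c0.exists_good hr ⟨B, fun m k hk =>
    bρ m k.1 (h.mem_idx.1 hk).1.le _ (h.mem_idx.1 hk).2⟩ le_rfl
  obtain ⟨l₁, l1, _, _, g1⟩ := c1.exists_good hr ⟨B, fun m k hk =>
    bρ m (k.1 + 1) (h.mem_idx.1 hk).1 _ (h.mem_idx.1 hk).2⟩ l0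
  obtain ⟨l₂, l2, _, _, g2⟩ := Pieces.exists_good_family
    (fun p : Fin d × Bool => c2 p.1 p.2) (fun _ => hr) (fun p => ⟨B, fun m k hk =>
    bρ m (k.1 + 1) (h.mem_idx.1 hk).1 _ ((M m).nbr_mem (h.mem_idx.1 hk).2 _ _)⟩) (l1.trans l0)
  obtain ⟨l₃, l3, _, _, g3⟩ := Pieces.exists_good_family
    (fun p : Fin d × Bool => c3 p.1 p.2) (fun p => hv p.1) (fun p => ⟨B, fun m k hk =>
    bu m k.1 (h.mem_idx.1 hk).1.le _ (h.mem_idx.1 hk).2 _ _⟩) (l2.trans (l1.trans l0))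
  obtain ⟨l₄, l4, n4, k4, g4⟩ := Pieces.exists_good_family
    (fun p : (Fin d × Bool) × Fin d × Bool => c4 p.1.1 p.1.2 p.2.1 p.2.2) (fun p => hv p.1.1)
    (fun p => ⟨B, fun m k hk =>
    bu m k.1 (h.mem_idx.1 hk).1.le _ ((M m).nbr_mem (h.mem_idx.1 hk).2 _ _) _ _⟩)
    (l3.trans (l2.trans (l1.trans l0)))
  exact ⟨l₄, l4.trans (l3.trans (l2.trans (l1.trans l0))), n4, k4,
    ⟨g0.mono (l4.trans (l3.trans (l2.trans l1))), g1.mono (l4.trans (l3.trans l2)),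
      fun i s => (g2 (i, s)).mono (l4.trans l3), fun i s => (g3 (i, s)).mono l4,
      fun i a j s => g4 ((i, a), j, s)⟩⟩

open Classical in
/-- The initial energy is bounded from above by quantities that converge to the energy of the
initial data. -/
theorem exists_initial_energy_bound (hρ₀ : MemLp ρ₀ ⊤ (volume.restrict (closure Ω)))
    (hu₀ : ∀ i, MemLp (fun x => u₀ x i) ⊤ (volume.restrict (closure Ω)))
    {g : (Fin d → ℝ) → ℝ} (hg : ContDiff ℝ 1 g) (hg0 : ∀ x ∈ closure Ω, 0 ≤ g x)
    {l : Filter ℕ} (hl : l ≤ atTop) [l.NeBot] [l.IsCountablyGenerated] :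
    ∃ l' ≤ l, l'.NeBot ∧ l'.IsCountablyGenerated ∧ ∃ E : ℕ → ℝ,
      (∀ m, energy γ ε (M m) (ρ m 0) (u m 0) g ≤ E m) ∧
      Tendsto E l' (𝓝 (∫ x in closure Ω, entropy γ ε (ρ₀ x) (u₀ x) * g x)) := by
  have := isFiniteMeasure_closure h.bounded
  have iρ : Integrable ρ₀ (volume.restrict (closure Ω)) := hρ₀.integrable le_top
  have iu : ∀ i, Integrable (fun x => u₀ x i) (volume.restrict (closure Ω)) := fun i =>
    (hu₀ i).integrable le_top
  -- On external faces the discrete velocity is zero and does not approximate u₀. Replacing it by a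
  -- cell average restores convergence and can only increase the kinetic energy, so no estimate of a
  -- boundary layer is needed.
  set a : Fin d → Bool → ℕ → Box d → ℝ := fun i s m K =>
    if (M m).IsInternal K i s then u m 0 (K.face i s) else (∫ x in K.toSet, u₀ x i) / K.vol with ha
  have hd := h.two_le
  have cρ : (spacePieces M).Lconv (fun m K => ρ m 0 K) ρ₀ :=
    h.lconv_average iρ ⟨0, by omega⟩ true fun m K hK => Or.inl ((h.solution m).init_density K hK)
  have cu : ∀ i s, (spacePieces M).Lconv (a i s) (fun x => u₀ x i) := fun i s => by
    refine h.lconv_average (iu i) i s fun m K hK => ?_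
    by_cases hi : (M m).IsInternal K i s
    · refine Or.inr ⟨hi, ?_⟩
      simp only [ha, if_pos hi]
      cases s
      · rw [← ((M m).nbr_spec hi).2]
        exact (h.solution m).init_velocity _ ((M m).nbr_mem hK i _) i ((M m).isInternal_nbr hK hi)
      · exact (h.solution m).init_velocity K hK i hi
    · exact Or.inl (by simp only [ha, if_neg hi])
  obtain ⟨l₀, l0, _, _, gρ⟩ := cρ.exists_good iρ ⟨B, fun m K hK =>
    h.abs_density_le (Nat.zero_le _) hK⟩ hl
  obtain ⟨l₁, l1, n1, k1, gu⟩ := Pieces.exists_good_family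
    (fun p : Fin d × Bool => cu p.1 p.2) (fun p => iu p.1) (fun p => by
      obtain ⟨C, hC⟩ := Mesh.exists_average_bound (hu₀ p.1)
      refine ⟨max B C, fun m K hK => ?_⟩
      simp only [ha]
      split_ifs
      · exact (h.velocity m 0 (Nat.zero_le _) _ ((M m).face_mem hK _ _)).trans (le_max_left _ _)
      · exact (hC (M m) K hK).trans (le_max_right _ _)) (l0.trans hl)
  have hl1 := l1.trans (l0.trans hl)
  have gρ := gρ.mono l1
  have gK := h.good_space hl1 hg (x := Box.mid) fun m K hK => Box.mid_mem ((M m).lo_lt_hi K hK)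
  have gF := fun i s => h.good_space hl1 hg (x := fun K => (K.face i s).mid) fun m K hK =>
    Box.mid_face_mem ((M m).lo_lt_hi K hK) i s
  have hG := continuous_relEnergy h.one_le_γ
  have hsq : Continuous fun x : ℝ => x ^ 2 := by fun_prop
  have g1 := (gK.mul (gρ.comp hG)).const_mul (1 / ε ^ 2)
  have g2 := Pieces.Good.sum Finset.univ fun i (_ : i ∈ (Finset.univ : Finset (Fin d))) =>
    Pieces.Good.sum Finset.univ fun s (_ : s ∈ (Finset.univ : Finset Bool)) =>
      ((gF i s).mul (gρ.mul ((gu (i, s)).comp hsq))).const_mul (1 / 4)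
  have key := ((g1.add g2).congr (fun _ _ _ => rfl)
    (f' := fun x => entropy γ ε (ρ₀ x) (u₀ x) * g x) fun x => ?_).tendsto_sum
  · refine ⟨l₁, l1.trans l0, n1, k1, _, fun m => ?_, key⟩
    refine Finset.sum_le_sum fun K hK => ?_
    rw [measure_spacePieces M hK, mul_add]
    have hv := Mesh.vol_pos hK
    refine add_le_add (le_of_eq (by ring)) ?_
    simp only [Finset.mul_sum]
    refine Finset.sum_le_sum fun i _ => Finset.sum_le_sum fun s _ => ?_
    have h1 : 0 ≤ g (K.face i s).mid :=
      hg0 _ ((M m).toSet_subset hK (Box.mid_face_mem ((M m).lo_lt_hi K hK) i s))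
    have h2 : 0 ≤ ρ m 0 K := h.c_pos.le.trans (h.density m 0 (Nat.zero_le _) K hK).1
    have h3 : u m 0 (K.face i s) ^ 2 ≤ a i s m K ^ 2 := by
      simp only [ha]
      split_ifs with hi
      · exact le_rfl
      · rw [(h.solution m).boundary 0 (Nat.zero_le _) K hK i s hi]
        simpa using sq_nonneg _
    calc g (K.face i s).mid * (K.vol / 4 * (ρ m 0 K * u m 0 (K.face i s) ^ 2)) ≤
        g (K.face i s).mid * (K.vol / 4 * (ρ m 0 K * a i s m K ^ 2)) := by gcongr
      _ = _ := by ring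
  · simp only [Fintype.sum_bool]
    unfold entropy
    have e : ∑ i, (1 / 4 * (g x * (ρ₀ x * u₀ x i ^ 2)) + 1 / 4 * (g x * (ρ₀ x * u₀ x i ^ 2))) =
        1 / 2 * ρ₀ x * g x * ∑ i, u₀ x i ^ 2 := by
      rw [Finset.mul_sum]
      exact Finset.sum_congr rfl fun i _ => by ring
    rw [e]
    ring

/-- The limit of the discrete solutions satisfies the entropy inequality. -/
theorem entropy_inequality (hθ : 0 ≤ θ) {r : ℝ × (Fin d → ℝ) → ℝ}
    {v : ℝ × (Fin d → ℝ) → Fin d → ℝ}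
    (hρ₀ : MemLp ρ₀ ⊤ (volume.restrict (closure Ω)))
    (hu₀ : ∀ i, MemLp (fun x => u₀ x i) ⊤ (volume.restrict (closure Ω)))
    (hr : Integrable r (volume.restrict (Set.Ioo 0 T ×ˢ closure Ω)))
    (hv : ∀ i, Integrable (fun z => v z i) (volume.restrict (Set.Ioo 0 T ×ˢ closure Ω)))
    (hρ : Tendsto (fun m => eLpNorm (fun z => (M m).density (δt m) (ρ m) z - r z) 1
      (volume.restrict (Set.Ioo 0 T ×ˢ closure Ω))) atTop (𝓝 0))
    (hu : ∀ i, Tendsto (fun m => eLpNorm (fun z => (M m).velocity (δt m) (u m) z i - v z i) 1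
      (volume.restrict (Set.Ioo 0 T ×ˢ closure Ω))) atTop (𝓝 0)) {C : ℝ}
    (hC : ∀ m, ∑ n ∈ Finset.range (N m), ∑ K ∈ (M m).cells,
      K.vol * |ρ m (n + 1) K - ρ m n K| ≤ C)
    {ψ : ℝ × (Fin d → ℝ) → ℝ} (hψ : ContDiff ℝ 2 ψ)
    (hψ0 : ∀ t ∈ Set.Icc 0 T, ∀ x ∈ closure Ω, 0 ≤ ψ (t, x))
    (hψT : ∀ x ∈ closure Ω, ψ (T, x) = 0) :
    -(∫ z in Set.Ioo 0 T ×ˢ closure Ω, (entropy γ ε (r z) (v z) * dt ψ z +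
        entropyFlux γ ε (r z) (v z) * ∑ i, v z i * dx ψ i z)) ≤
      ∫ x in closure Ω, entropy γ ε (ρ₀ x) (u₀ x) * ψ (0, x) := by
  have := h.isFiniteMeasure
  obtain ⟨l, hl, _, _, hlim⟩ := h.exists_limit hθ hr hv hρ hu hC
  have hT : 0 ≤ T := by
    rw [← h.mul_δt 0]
    have := h.δt_pos 0
    positivity
  have hg : ContDiff ℝ 1 fun x : Fin d → ℝ => ψ (0, x) :=
    (hψ.of_le one_le_two).comp (contDiff_const.prodMk contDiff_id)
  obtain ⟨l', hl', _, _, E, hE, hElim⟩ := h.exists_initial_energy_bound hρ₀ hu₀ hg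
    (hψ0 0 ⟨le_rfl, hT⟩) hl
  obtain ⟨W, hW⟩ := ((isCompact_Icc (a := (0 : ℝ)) (b := T)).prod
    h.bounded.isCompact_closure).exists_bound_of_continuousOn hψ.continuous.continuousOn
  obtain ⟨A, hA⟩ := h.exists_residual_bound W
  have hgood := ((hlim.good_stepFlux hl hψ).sub (hlim.good_time hl hψ)).mono hl'
  have hlhs := hgood.tendsto_sum
  have hrhs : Tendsto (fun m => E m + A * |κ m|) l'
      (𝓝 (∫ x in closure Ω, entropy γ ε (ρ₀ x) (u₀ x) * ψ (0, x))) := by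
    simpa using hElim.add (((h.tendsto_ratio.mono_left (hl'.trans hl)).abs).const_mul A)
  -- The discrete inequality holds for every m; both sides converge along the common filter, the
  -- residual being absorbed by A|κ m|.
  have hle := le_of_tendsto_of_tendsto hlhs hrhs (.of_forall fun m => by
    refine (h.sum_energy_le hψ0 hψT m).trans (add_le_add (hE m) ?_)
    refine hA m (fun n σ => ψ ((n + 1) * δt m, σ.mid)) fun n hn σ hσ => ?_
    have hσ' : σ.mid ∈ closure Ω := by
      unfold Mesh.faces at hσ
      simp only [Finset.mem_biUnion, Finset.mem_image] at hσ
      obtain ⟨K, hK, p, -, rfl⟩ := hσ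
      exact (M m).toSet_subset hK (Box.mid_face_mem ((M m).lo_lt_hi K hK) p.1 p.2)
    have ht : ((n : ℝ) + 1) * δt m ∈ Set.Icc 0 T := by
      have hδ := h.δt_pos m
      refine ⟨by positivity, ?_⟩
      rw [← h.mul_δt m]
      have : (n : ℝ) + 1 ≤ N m := by exact_mod_cast hn
      exact mul_le_mul_of_nonneg_right this hδ.le
    exact ⟨hψ0 _ ht _ hσ', (le_abs_self _).trans (hW (_, _) ⟨ht, hσ'⟩)⟩)
  refine le_trans (le_of_eq ?_) hle
  rw [← integral_neg]
  refine integral_congr_ae (.of_forall fun z => ?_)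
  ring

end SolutionSequence
end MAC

/-! ### From the assumptions on the grids to the ratio κ; conclusion. -/

namespace MAC

variable {d : ℕ} {Ω : Set (Fin d → ℝ)}

namespace Mesh

theorem cells_nonempty (M : Mesh d Ω) (h : Ω.Nonempty) : M.cells.Nonempty := by
  obtain ⟨x, hx⟩ := h
  have hx : x ∈ ⋃ K ∈ M.cells, K.toSet := M.union_eq ▸ subset_closure hx
  obtain ⟨K, hK, -⟩ := Set.mem_iUnion₂.1 hx
  exact ⟨K, hK⟩

variable {M : Mesh d Ω} {K : Box d}

/-- The volume is a face area, at most diam^(d-1), times the length across it, so regularity of the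
volume bounds the diameter by each length. -/
theorem diam_le_of_regular (hK : K ∈ M.cells) (hd : 2 ≤ d) {θ : ℝ} (hθ : 0 ≤ θ)
    (h : K.diam ^ d / K.vol ≤ θ) (i : Fin d) : K.diam ≤ θ * K.len i := by
  have hl := len_pos hK i
  have hD : 0 < K.diam := hl.trans_le (K.len_le_diam i)
  rw [div_le_iff₀ (vol_pos hK), ← K.area_mul_len i true] at h
  have h1 := mul_le_mul_of_nonneg_left (K.area_le (M.lo_lt_hi K hK) i true)
    (mul_nonneg hθ hl.le)
  obtain ⟨n, rfl⟩ : ∃ n, d = n + 1 := ⟨d - 1, by omega⟩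
  rw [pow_succ] at h
  simp only [Nat.add_sub_cancel] at h1
  have hp : 0 < K.diam ^ n := pow_pos hD n
  refine le_of_mul_le_mul_left ?_ hp
  linarith

theorem minArea_le (hK : K ∈ M.cells) (i : Fin d) (s : Bool) :
    M.minArea ≤ (K.face i s).area :=
  csInf_le (M.faces.finite_toSet.image _).bddBelow ⟨_, M.face_mem hK i s, rfl⟩

theorem minArea_pos (hK : K ∈ M.cells) (i : Fin d) : 0 < M.minArea := by
  classical
  have hne : (Face.area '' (M.faces : Set (Face d))).Nonempty := ⟨_, _, M.face_mem hK i true, rfl⟩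
  obtain ⟨σ, hσ, e⟩ := hne.csInf_mem (M.faces.finite_toSet.image _)
  unfold minArea
  rw [← e]
  have hσ : σ ∈ M.faces := hσ
  unfold faces at hσ
  simp only [Finset.mem_biUnion, Finset.mem_image] at hσ
  obtain ⟨L, hL, p, -, rfl⟩ := hσ
  exact area_pos hL p.1 p.2

variable (M) in
/-- A time step that is small compared with the areas of the faces is small compared with the lengths
of the cells. -/
theorem step_le_ratio_mul_len (hK : K ∈ M.cells) (hd : 2 ≤ d) {δt θ : ℝ} (hδt : 0 ≤ δt)
    {i : Fin d} (h : K.diam ≤ θ * K.len i) :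
    δt ≤ δt / M.minArea * M.size ^ (d - 2) * θ * K.len i := by
  have hA := M.minArea_pos hK i
  have hD : 0 ≤ K.diam := Real.sqrt_nonneg _
  have h1 := (M.minArea_le hK i true).trans (K.area_le (M.lo_lt_hi K hK) i true)
  obtain ⟨n, rfl⟩ : ∃ n, d = n + 2 := ⟨d - 2, by omega⟩
  have h2 : K.diam ^ n ≤ M.size ^ n := pow_le_pow_left₀ hD (M.diam_le_size hK) n
  -- Of the d - 1 factors diam(K) that bound a face area, one is compared with the length in
  -- direction i and the others with the mesh size.
  have h3 : M.minArea ≤ M.size ^ n * (θ * K.len i) := by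
    refine h1.trans ?_
    rw [show n + 2 - 1 = n + 1 from rfl, pow_succ]
    exact mul_le_mul h2 h hD ((pow_nonneg hD n).trans h2)
  calc δt = δt / M.minArea * M.minArea := by field_simp
    _ ≤ δt / M.minArea * (M.size ^ n * (θ * K.len i)) :=
        mul_le_mul_of_nonneg_left h3 (div_nonneg hδt hA.le)
    _ = _ := by rw [Nat.add_sub_cancel]; ring

end Mesh
end MAC

theorem mainTheorem5
    (d : ℕ) (hd : d = 2 ∨ d = 3)
    (Ω : Set (Fin d → ℝ)) (hΩo : IsOpen Ω) (hΩb : Bornology.IsBounded Ω) (hΩne : Ω.Nonempty)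
    (hΩf : MeasureTheory.volume (frontier Ω) = 0)
    (T γ ε : ℝ) (hT : 0 < T) (hγ : 1 ≤ γ) (hε : 0 < ε)
    -- initial data
    (ρ₀ : (Fin d → ℝ) → ℝ) (u₀ : (Fin d → ℝ) → Fin d → ℝ)
    (hρ₀ : MeasureTheory.MemLp ρ₀ ⊤ (MeasureTheory.volume.restrict Ω))
    (hu₀ : ∀ i, MeasureTheory.MemLp (fun x => u₀ x i) ⊤ (MeasureTheory.volume.restrict Ω))
    -- space-time discretisations
    (M : ℕ → MAC.Mesh d Ω) (N : ℕ → ℕ) (δt : ℕ → ℝ)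
    (hN : ∀ m, 0 < N m) (hδt : ∀ m, δt m = T / N m)
    (hδt0 : Filter.Tendsto δt Filter.atTop (nhds 0))
    (hh0 : Filter.Tendsto (fun m => (M m).size) Filter.atTop (nhds 0))
    -- stabilisation parameters
    (η : ℕ → ℕ → MAC.Face d → ℝ) (ηmax : ℝ)
    (hη : ∀ m, ∀ n < N m, ∀ σ ∈ (M m).faces, 0 < η m n σ ∧ η m n σ ≤ ηmax)
    -- discrete solutions
    (ρd : ℕ → ℕ → MAC.Box d → ℝ) (ud : ℕ → ℕ → MAC.Face d → ℝ)
    (hsol : ∀ m, MAC.IsSolution (M m) γ ε (δt m) (N m) (η m) ρ₀ u₀ (ρd m) (ud m))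
    -- uniform bounds
    (Clow Cup Cu : ℝ) (hClow : 0 < Clow)
    (hρbd : ∀ m, ∀ n ≤ N m, ∀ K ∈ (M m).cells, Clow ≤ ρd m n K ∧ ρd m n K ≤ Cup)
    (hubd : ∀ m, ∀ n ≤ N m, ∀ σ ∈ (M m).faces, |ud m n σ| ≤ Cu)
    -- conditions on the discretisations
    (θ : ℝ)
    (hCFL : ∀ m, ∀ K ∈ (M m).cells, δt m / K.vol ≤ θ)
    (hreg : ∀ m, ∀ K ∈ (M m).cells, K.diam ^ d / K.vol ≤ θ)
    (hface : Filter.Tendsto (fun m => δt m / (M m).minArea) Filter.atTop (nhds 0))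
    -- discrete BV estimates in time
    (Cbv : ℝ)
    (hBVρ : ∀ m, ∑ n ∈ Finset.range (N m), ∑ K ∈ (M m).cells,
      K.vol * |ρd m (n + 1) K - ρd m n K| ≤ Cbv)
    (hBVu : ∀ m, ∑ n ∈ Finset.range (N m), ∑ σ ∈ (M m).faces,
      (M m).dualVol σ * |ud m (n + 1) σ - ud m n σ| ≤ Cbv)
    -- the limit, and the convergence in every `L^r`, `1 ≤ r < ∞`
    (ρ : ℝ × (Fin d → ℝ) → ℝ) (u : ℝ × (Fin d → ℝ) → Fin d → ℝ)
    (hρ : MeasureTheory.MemLp ρ ⊤ (MeasureTheory.volume.restrict (Set.Ioo 0 T ×ˢ Ω)))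
    (hu : ∀ i, MeasureTheory.MemLp (fun z => u z i) ⊤
      (MeasureTheory.volume.restrict (Set.Ioo 0 T ×ˢ Ω)))
    (hρlim : ∀ r : ENNReal, 1 ≤ r → r ≠ ⊤ → Filter.Tendsto
      (fun m => MeasureTheory.eLpNorm (fun z => (M m).density (δt m) (ρd m) z - ρ z) r
        (MeasureTheory.volume.restrict (Set.Ioo 0 T ×ˢ Ω))) Filter.atTop (nhds 0))
    (hulim : ∀ r : ENNReal, 1 ≤ r → r ≠ ⊤ → ∀ i, Filter.Tendsto
      (fun m => MeasureTheory.eLpNorm (fun z => (M m).velocity (δt m) (ud m) z i - u z i) r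
        (MeasureTheory.volume.restrict (Set.Ioo 0 T ×ˢ Ω))) Filter.atTop (nhds 0)) :
    ∀ ψ : ℝ × (Fin d → ℝ) → ℝ, MAC.IsTestFunction T Ω ψ →
      (∀ t ∈ Set.Ico 0 T, ∀ x ∈ closure Ω, 0 ≤ ψ (t, x)) →
      -(∫ z in Set.Ioo 0 T ×ˢ Ω,
          (MAC.entropy γ ε (ρ z) (u z) * MAC.dt ψ z +
            MAC.entropyFlux γ ε (ρ z) (u z) * ∑ i, u z i * MAC.dx ψ i z)) ≤
        ∫ x in Ω, MAC.entropy γ ε (ρ₀ x) (u₀ x) * ψ (0, x) := by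
  have hd2 : 2 ≤ d := by omega
  have hδpos : ∀ m, 0 < δt m := fun m => by
    rw [hδt]
    have : (0 : ℝ) < N m := by exact_mod_cast hN m
    positivity
  have hcells : ∀ m, (M m).cells.Nonempty := fun m => (M m).cells_nonempty hΩne
  have hθ : 0 ≤ θ := by
    obtain ⟨K, hK⟩ := hcells 0
    refine le_trans (div_nonneg (pow_nonneg (Real.sqrt_nonneg _) _) ?_) (hreg 0 K hK)
    exact (MAC.Mesh.vol_pos hK).le
  have hdiam : ∀ m, ∀ K ∈ (M m).cells, ∀ i, K.diam ≤ θ * K.len i := fun m K hK i =>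
    MAC.Mesh.diam_le_of_regular hK hd2 hθ (hreg m K hK) i
  set κ : ℕ → ℝ := fun m => δt m / (M m).minArea * (M m).size ^ (d - 2) * θ
  have hκ : Filter.Tendsto κ Filter.atTop (nhds 0) := by
    simpa using (hface.mul (hh0.pow (d - 2))).mul_const θ
  have hκle : ∀ m, ∀ K ∈ (M m).cells, ∀ i, δt m ≤ κ m * K.len i := fun m K hK i =>
    (M m).step_le_ratio_mul_len hK hd2 (hδpos m).le (hdiam m K hK i)
  set B := max (max ηmax Cup) (max Cu Cbv)
  have b1 : ηmax ≤ B := (le_max_left _ _).trans (le_max_left _ _)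
  have b2 : Cup ≤ B := (le_max_right _ _).trans (le_max_left _ _)
  have b3 : Cu ≤ B := (le_max_left _ _).trans (le_max_right _ _)
  have b4 : Cbv ≤ B := (le_max_right _ _).trans (le_max_right _ _)
  have h : MAC.SolutionSequence M N δt T θ γ ε η ρ₀ u₀ ρd ud κ Clow B :=
    { two_le := hd2
      bounded := hΩb
      δt_pos := hδpos
      mul_δt := fun m => by
        rw [hδt]
        have : (N m : ℝ) ≠ 0 := by exact_mod_cast (hN m).ne'
        field_simp
      tendsto_δt := hδt0
      tendsto_size := hh0
      diam_le := hdiam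
      one_le_γ := hγ
      stabilisation := fun m n hn σ hσ =>
        ⟨(hη m n hn σ hσ).1.le, (hη m n hn σ hσ).2.trans b1⟩
      solution := hsol
      c_pos := hClow
      density := fun m n hn K hK => ⟨(hρbd m n hn K hK).1, (hρbd m n hn K hK).2.trans b2⟩
      velocity := fun m n hn σ hσ => (hubd m n hn σ hσ).trans b3
      variation := fun m => (hBVu m).trans b4
      tendsto_ratio := hκ
      δt_le := hκle }
  -- The cells tile the closure of Ω; since the boundary is null, all integrals may be taken there.
  have e1 : MeasureTheory.volume.restrict Ω = MeasureTheory.volume.restrict (closure Ω) :=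
    MeasureTheory.Measure.restrict_congr_set (closure_ae_eq_of_null_frontier hΩf).symm
  have e2 : MeasureTheory.volume.restrict (Set.Ioo 0 T ×ˢ Ω) =
      MeasureTheory.volume.restrict (Set.Ioo 0 T ×ˢ closure Ω) := by
    rw [MeasureTheory.Measure.volume_eq_prod, ← MeasureTheory.Measure.prod_restrict, e1,
      MeasureTheory.Measure.prod_restrict]
  rw [e2] at hρ
  simp only [e2] at hu hρlim hulim
  simp only [e1] at hρ₀ hu₀
  intro ψ hψ hψ0
  obtain ⟨hψs, T', hT', hψT⟩ := hψ
  have hψT : ∀ x ∈ closure Ω, ψ (T, x) = 0 := hψT T ⟨hT'.le, le_rfl⟩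
  have hfin := h.isFiniteMeasure
  rw [e1, e2]
  refine h.entropy_inequality hθ hρ₀ hu₀ (hρ.integrable le_top) (fun i => (hu i).integrable le_top)
    (hρlim 1 le_rfl ENNReal.one_ne_top) (hulim 1 le_rfl ENNReal.one_ne_top) hBVρ
    (hψs.of_le (WithTop.coe_le_coe.2 (le_top : (2 : ℕ∞) ≤ ⊤))) (fun t ht x hx => ?_) hψT
  -- The last weights are taken at time T itself, where nonnegativity comes from the vanishing of ψ.
  rcases ht.2.lt_or_eq with h1 | rfl
  · exact hψ0 t ⟨ht.1, h1⟩ x hx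
  · exact (hψT x hx).ge
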